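/- **Setting.** A *double groupoid* $\mathcal T$ consists of non-empty sets $\mathcal B$ (boxes), $\mathcal H$ (horizontal edges), $\mathcal V$ (vertical edges), $\mathcal P$ (points) and four groupoids: $\mathcal B\rightrightarrows\mathcal H$ (every box $A$ has a top $t(A)$ and a bottom $b(A)$; composition is vertical composition of boxes), $\mathcal B\rightrightarrows\mathcal V$ (every box has a left side $l(A)$ and a right side $r(A)$; composition is horizontal composition), $\mathcal H\rightrightarrows\mathcal P$ (with $l(x), r(x)$) and $\mathcal V\rightrightarrows\mathcal P$ (with $t(g), b(g)$). The four sides of a box have matching corners, sources and targets of each composition of boxes are compatible with the composition of edges, the interchange law holds, identity boxes $\mathrm{id}\,x$ (vertical identity of $x\in\mathcal H$) and $\mathrm{id}\,g$ (horizontal identity of $g\in\mathcal V$) have identity edges as their remaining sides and are multiplicative in $x$ and $g$, and the two identity boxes of the identities at a point coincide. It is *finite* if the four sets are finite, and *vacant* if for all $x\in\mathcal H$, $g\in\mathcal V$ with $r(x)=t(g)$ there is exactly one box with top $x$ and right side $g$. For $A\in\mathcal B$ let $A^{-1}$ be its inverse with respect to both compositions (the vertical inverse of the horizontal inverse). Let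 $k$ be a field and $\mathcal T$ a finite vacant double groupoid. **The weak bialgebra $k\mathcal T$** has basis $\mathcal B$. The product $A\cdot B$ of two boxes is their vertical composition ($A$ on top of $B$) if $b(A)=t(B)$, and $0$ otherwise; $1=\sum_{x\in\mathcal H}\mathrm{id}\,x$; $\Delta(A)=\sum B\otimes C$, over all horizontal decompositions $A=BC$; $\varepsilon(A)=1$ if $A=\mathrm{id}\,l(A)$ is a horizontal identity, and $\varepsilon(A)=0$ otherwise. (It is a weak Hopf algebra with antipode $A\mapsto A^{-1}$.) $\operatorname{Rep}k\mathcal T$ is the category of finite-dimensional $k\mathcal T$-modules with its standard monoidal structure: $V\otimes W$ is the subspace $\Delta(1)\cdot(V\otimes_kW)$ with $k\mathcal T$ acting through $\Delta$, and the unit object is the target subalgebra $k\mathcal T_t=\varepsilon_t(k\mathcal T)$, $\varepsilon_t(h)=(\varepsilon\otimes\mathrm{id})(\Delta(1)(h\otimes1))$, with action $h\cdot z=\varepsilon_t(hz)$. **The category $\mathcal T$-bund.** Objects are $\mathcal H$-graded finite-dimensional $k$-vector spaces $V=\bigoplus_{x\in\mathcal H}V_x$ with an action of the vertical groupoid $\mathcal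 B\rightrightarrows\mathcal H$ by linear isomorphisms $A:V_{b(A)}\to V_{t(A)}$, $A\in\mathcal B$; morphisms are graded linear maps that commute with the action. It is monoidal with: * *tensor product* $(V\otimes W)_z=\bigoplus_{xy=z}V_x\otimes_kW_y$, $z\in\mathcal H$, on which $\mathcal B$ acts through $\Delta$: a box $A$ maps $v\otimes w$ with $v\in V_x$, $w\in W_y$ to $Bv\otimes Cw$, where $A=BC$ is the horizontal decomposition with $b(B)=x$, $b(C)=y$; the associativity isomorphism is the obvious one; * *unit object* $\mathbf 1=\bigoplus_{P\in\mathcal P}k\,{}_P\mathbf 1$, with ${}_P\mathbf 1$ in degree $\mathrm{id}\,P\in\mathcal H$, and $A\cdot{}_P\mathbf 1={}_Q\mathbf 1$ if $A=\mathrm{id}\,g$ for some $g\in\mathcal V$ with $b(g)=P$, $t(g)=Q$, and $A\cdot{}_P\mathbf 1=0$ otherwise; the unit isomorphisms are ${}_P\mathbf 1\otimes v\mapsto v$ and $v\otimes{}_P\mathbf 1\mapsto v$; * *dual* $V^*$ of $V$, given by $(V^*)_x=(V_{x^{-1}})^*$, on which $A$ acts as the transpose $(A^{-1})^*:(V^*)_{b(A)}\to(V^*)_{t(A)}$.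 A *multifusion category* over $k$ is an abelian $k$-linear monoidal category with $k$-bilinear tensor product that is rigid and semisimple (every object is a finite direct sum of simple objects), has finitely many isomorphism classes of simple objects and has finite-dimensional hom-spaces. **Proposition.** Let $\mathcal T$ be a finite vacant double groupoid and $k$ a field with $\operatorname{char}k=0$. Then $\mathcal T$-bund, with the monoidal structure above, is a multifusion category over $k$; for every $\mathcal T$-bundle $V$ the bundle $V^*$ is a dual of $V$ (on both sides); and there is a $k$-linear monoidal equivalence of categories $\mathcal T\text{-bund}\simeq\operatorname{Rep}k\mathcal T$. -/

import Mathlib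

universe u

/-- A groupoid presented by its set of arrows `A` and its set of objects (base) `O`, with source,
target, identities, composition of composable pairs and inverses. Composition is written in
diagrammatic order: `comp f g` is first `f`, then `g`. -/
structure ArrowGroupoid (A O : Type u) where
  src : A → O
  tgt : A → O
  one : O → A
  comp : (f g : A) → tgt f = src g → A
  inv : A → A
  src_one : ∀ x, src (one x) = x
  tgt_one : ∀ x, tgt (one x) = x
  src_comp : ∀ f g (p : tgt f = src g), src (comp f g p) = src f
  tgt_comp : ∀ f g (p : tgt f = src g), tgt (comp f g p) = tgt g
  one_comp : ∀ f (p : tgt (one (src f)) = src f), comp (one (src f)) f p = f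
  comp_one : ∀ f (p : tgt f = src (one (tgt f))), comp f (one (tgt f)) p = f
  assoc : ∀ f g h (p : tgt f = src g) (q : tgt g = src h)
    (p' : tgt (comp f g p) = src h) (q' : tgt f = src (comp g h q)),
    comp (comp f g p) h p' = comp f (comp g h q) q'
  src_inv : ∀ f, src (inv f) = tgt f
  tgt_inv : ∀ f, tgt (inv f) = src f
  comp_inv : ∀ f (p : tgt f = src (inv f)), comp f (inv f) p = one (src f)
  inv_comp : ∀ f (p : tgt (inv f) = src f), comp (inv f) f p = one (tgt f)

namespace ArrowGroupoid

variable {A O : Type u} (G : ArrowGroupoid A O)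

/-- `f` and `g` are composable and their composition is `h`. -/
def IsComp (f g h : A) : Prop := ∃ p : G.tgt f = G.src g, G.comp f g p = h

variable {G}

theorem IsComp.src {f g h : A} (w : G.IsComp f g h) : G.src h = G.src f := by
  obtain ⟨p, rfl⟩ := w; exact G.src_comp _ _ _

theorem IsComp.tgt {f g h : A} (w : G.IsComp f g h) : G.tgt h = G.tgt g := by
  obtain ⟨p, rfl⟩ := w; exact G.tgt_comp _ _ _

theorem IsComp.mid {f g h : A} (w : G.IsComp f g h) : G.tgt f = G.src g := w.1

theorem IsComp.eq {f g h h' : A} (w : G.IsComp f g h) (w' : G.IsComp f g h') : h = h' := by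
  obtain ⟨p, rfl⟩ := w; obtain ⟨p', rfl⟩ := w'; rfl

theorem isComp_comp (f g : A) (p : G.tgt f = G.src g) : G.IsComp f g (G.comp f g p) := ⟨p, rfl⟩

theorem isComp_one_left (f : A) : G.IsComp (G.one (G.src f)) f f :=
  ⟨G.tgt_one _, G.one_comp _ _⟩

theorem isComp_one_right (f : A) : G.IsComp f (G.one (G.tgt f)) f :=
  ⟨(G.src_one _).symm, G.comp_one _ _⟩

theorem isComp_inv_right (f : A) : G.IsComp f (G.inv f) (G.one (G.src f)) :=
  ⟨(G.src_inv _).symm, G.comp_inv _ _⟩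

theorem isComp_inv_left (f : A) : G.IsComp (G.inv f) f (G.one (G.tgt f)) :=
  ⟨G.tgt_inv _, G.inv_comp _ _⟩

theorem IsComp.assoc {f g h fg gh k : A} (w : G.IsComp f g fg) (w' : G.IsComp g h gh)
    (v : G.IsComp fg h k) : G.IsComp f gh k := by
  obtain ⟨p, rfl⟩ := w; obtain ⟨q, rfl⟩ := w'; obtain ⟨p', rfl⟩ := v
  exact ⟨by rw [G.src_comp]; exact p, (G.assoc _ _ _ _ _ _ _).symm⟩

theorem IsComp.assoc' {f g h fg gh k : A} (w : G.IsComp f g fg) (w' : G.IsComp g h gh)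
    (v : G.IsComp f gh k) : G.IsComp fg h k := by
  obtain ⟨p, rfl⟩ := w; obtain ⟨q, rfl⟩ := w'; obtain ⟨p', rfl⟩ := v
  exact ⟨by rw [G.tgt_comp]; exact q, G.assoc _ _ _ _ _ _ _⟩

theorem IsComp.eq_of_one_left {x : O} {f g : A} (w : G.IsComp (G.one x) f g) : g = f := by
  have : G.src f = x := by rw [← w.mid, G.tgt_one]
  subst this
  exact w.eq (isComp_one_left f)

theorem IsComp.eq_of_one_right {x : O} {f g : A} (w : G.IsComp f (G.one x) g) : g = f := by
  have : G.tgt f = x := by rw [w.mid, G.src_one]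
  subst this
  exact w.eq (isComp_one_right f)

/-- From `f g = h` we get `f⁻¹ h = g`. -/
theorem IsComp.inv_left {f g h : A} (w : G.IsComp f g h) : G.IsComp (G.inv f) h g := by
  refine (isComp_inv_left f).assoc w ?_
  rw [w.mid]; exact isComp_one_left g

/-- From `f g = h` we get `h g⁻¹ = f`. -/
theorem IsComp.inv_right {f g h : A} (w : G.IsComp f g h) : G.IsComp h (G.inv g) f := by
  refine w.assoc' (isComp_inv_right g) ?_
  rw [← w.mid]; exact isComp_one_right f

theorem IsComp.cancel_left {f g g' h : A} (w : G.IsComp f g h) (w' : G.IsComp f g' h) : g = g' :=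
  w.inv_left.eq w'.inv_left

theorem IsComp.cancel_right {f f' g h : A} (w : G.IsComp f g h) (w' : G.IsComp f' g h) :
    f = f' :=
  w.inv_right.eq w'.inv_right

theorem inv_inv (f : A) : G.inv (G.inv f) = f := by
  have h := isComp_inv_left (G := G) f
  exact (isComp_inv_right (G.inv f)).cancel_left (by rw [G.src_inv]; exact h)

theorem inv_one (x : O) : G.inv (G.one x) = G.one x := by
  have h := isComp_inv_left (G := G) (G.one x)
  have := h.eq_of_one_right
  rw [← this, G.tgt_one]

theorem IsComp.inv {f g h : A} (w : G.IsComp f g h) :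
    G.IsComp (G.inv g) (G.inv f) (G.inv h) := by
  have := w.inv_left.inv_right
  exact this.inv_left

theorem IsComp.eq_inv_of_one {f g : A} {x : O} (w : G.IsComp f g (G.one x)) : g = G.inv f :=
  w.inv_left.eq_of_one_right.symm ▸ rfl

end ArrowGroupoid

/-- A double groupoid: boxes `Box`, horizontal edges `Hor`, vertical edges `Ver` and points `Pt`,
with four groupoid structures
* `vert` on `Box ⇉ Hor` (source = top, target = bottom; vertical composition of boxes),
* `horiz` on `Box ⇉ Ver` (source = left, target = right; horizontal composition of boxes),
* `hor` on `Hor ⇉ Pt` (source = left, target = right),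
* `ver` on `Ver ⇉ Pt` (source = top, target = bottom),
subject to the usual compatibilities. In the axioms the proofs of composability that are quantified
over follow from the ones before them. -/
structure DoubleGroupoid where
  Pt : Type u
  Hor : Type u
  Ver : Type u
  Box : Type u
  nonempty_pt : Nonempty Pt
  hor : ArrowGroupoid Hor Pt
  ver : ArrowGroupoid Ver Pt
  vert : ArrowGroupoid Box Hor
  horiz : ArrowGroupoid Box Ver
  left_top : ∀ A, hor.src (vert.src A) = ver.src (horiz.src A)
  right_top : ∀ A, hor.tgt (vert.src A) = ver.src (horiz.tgt A)
  left_bot : ∀ A, hor.src (vert.tgt A) = ver.tgt (horiz.src A)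
  right_bot : ∀ A, hor.tgt (vert.tgt A) = ver.tgt (horiz.tgt A)
  top_hcomp : ∀ A B (p : horiz.tgt A = horiz.src B)
    (q : hor.tgt (vert.src A) = hor.src (vert.src B)),
    vert.src (horiz.comp A B p) = hor.comp (vert.src A) (vert.src B) q
  bot_hcomp : ∀ A B (p : horiz.tgt A = horiz.src B)
    (q : hor.tgt (vert.tgt A) = hor.src (vert.tgt B)),
    vert.tgt (horiz.comp A B p) = hor.comp (vert.tgt A) (vert.tgt B) q
  left_vcomp : ∀ A B (p : vert.tgt A = vert.src B)
    (q : ver.tgt (horiz.src A) = ver.src (horiz.src B)),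
    horiz.src (vert.comp A B p) = ver.comp (horiz.src A) (horiz.src B) q
  right_vcomp : ∀ A B (p : vert.tgt A = vert.src B)
    (q : ver.tgt (horiz.tgt A) = ver.src (horiz.tgt B)),
    horiz.tgt (vert.comp A B p) = ver.comp (horiz.tgt A) (horiz.tgt B) q
  interchange : ∀ A B C D (hAB : horiz.tgt A = horiz.src B) (hCD : horiz.tgt C = horiz.src D)
    (vAC : vert.tgt A = vert.src C) (vBD : vert.tgt B = vert.src D)
    (p : vert.tgt (horiz.comp A B hAB) = vert.src (horiz.comp C D hCD))
    (q : horiz.tgt (vert.comp A C vAC) = horiz.src (vert.comp B D vBD)),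
    vert.comp (horiz.comp A B hAB) (horiz.comp C D hCD) p =
      horiz.comp (vert.comp A C vAC) (vert.comp B D vBD) q
  left_vone : ∀ x, horiz.src (vert.one x) = ver.one (hor.src x)
  right_vone : ∀ x, horiz.tgt (vert.one x) = ver.one (hor.tgt x)
  top_hone : ∀ g, vert.src (horiz.one g) = hor.one (ver.src g)
  bot_hone : ∀ g, vert.tgt (horiz.one g) = hor.one (ver.tgt g)
  one_one : ∀ P, vert.one (hor.one P) = horiz.one (ver.one P)
  vcomp_hone : ∀ g h (p : ver.tgt g = ver.src h)
    (q : vert.tgt (horiz.one g) = vert.src (horiz.one h)),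
    vert.comp (horiz.one g) (horiz.one h) q = horiz.one (ver.comp g h p)
  hcomp_vone : ∀ x y (p : hor.tgt x = hor.src y)
    (q : horiz.tgt (vert.one x) = horiz.src (vert.one y)),
    horiz.comp (vert.one x) (vert.one y) q = vert.one (hor.comp x y p)

namespace DoubleGroupoid

open ArrowGroupoid

variable (T : DoubleGroupoid.{u})

/-- The double groupoid is finite: all four sets are finite. -/
class IsFinite : Prop where
  pt : Finite T.Pt
  hor : Finite T.Hor
  ver : Finite T.Ver
  box : Finite T.Box

/-- The double groupoid is vacant: a pair consisting of a horizontal edge `x` and a vertical edge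
`g` with `r(x) = t(g)` is the (top, right) pair of exactly one box. -/
class IsVacant : Prop where
  existsUnique_box : ∀ (x : T.Hor) (g : T.Ver), T.hor.tgt x = T.ver.src g →
    ∃! X : T.Box, T.vert.src X = x ∧ T.horiz.tgt X = g

instance [h : T.IsFinite] : Finite T.Pt := h.pt
instance [h : T.IsFinite] : Finite T.Hor := h.hor
instance [h : T.IsFinite] : Finite T.Ver := h.ver
instance [h : T.IsFinite] : Finite T.Box := h.box

/-- The inverse `A⁻¹ = (Aʰ)ᵛ` of a box with respect to both compositions. -/
def boxInv (A : T.Box) : T.Box := T.vert.inv (T.horiz.inv A)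

variable {T}

theorem top_isComp {A B C : T.Box} (w : T.horiz.IsComp A B C) :
    T.hor.IsComp (T.vert.src A) (T.vert.src B) (T.vert.src C) := by
  obtain ⟨p, rfl⟩ := w
  have q : T.hor.tgt (T.vert.src A) = T.hor.src (T.vert.src B) := by
    rw [T.right_top, T.left_top, p]
  exact ⟨q, (T.top_hcomp A B p q).symm⟩

theorem bot_isComp {A B C : T.Box} (w : T.horiz.IsComp A B C) :
    T.hor.IsComp (T.vert.tgt A) (T.vert.tgt B) (T.vert.tgt C) := by
  obtain ⟨p, rfl⟩ := w
  have q : T.hor.tgt (T.vert.tgt A) = T.hor.src (T.vert.tgt B) := by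
    rw [T.right_bot, T.left_bot, p]
  exact ⟨q, (T.bot_hcomp A B p q).symm⟩

theorem left_isComp {A B C : T.Box} (w : T.vert.IsComp A B C) :
    T.ver.IsComp (T.horiz.src A) (T.horiz.src B) (T.horiz.src C) := by
  obtain ⟨p, rfl⟩ := w
  have q : T.ver.tgt (T.horiz.src A) = T.ver.src (T.horiz.src B) := by
    rw [← T.left_bot, ← T.left_top, p]
  exact ⟨q, (T.left_vcomp A B p q).symm⟩

theorem right_isComp {A B C : T.Box} (w : T.vert.IsComp A B C) :
    T.ver.IsComp (T.horiz.tgt A) (T.horiz.tgt B) (T.horiz.tgt C) := by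
  obtain ⟨p, rfl⟩ := w
  have q : T.ver.tgt (T.horiz.tgt A) = T.ver.src (T.horiz.tgt B) := by
    rw [← T.right_bot, ← T.right_top, p]
  exact ⟨q, (T.right_vcomp A B p q).symm⟩

/-- If all four compositions of the arrangement `A B / C D` exist, then so do the two total ones,
and they agree. -/
theorem isComp_interchange {A B C D E F G K : T.Box} (hE : T.horiz.IsComp A B E)
    (hF : T.horiz.IsComp C D F) (vG : T.vert.IsComp A C G) (vK : T.vert.IsComp B D K) :
    ∃ M, T.vert.IsComp E F M ∧ T.horiz.IsComp G K M := by
  have p : T.vert.tgt E = T.vert.src F := by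
    have h1 := bot_isComp hE
    have h2 := top_isComp hF
    rw [vG.mid, vK.mid] at h1
    exact h1.eq h2
  have q : T.horiz.tgt G = T.horiz.src K := by
    have h1 := right_isComp vG
    have h2 := left_isComp vK
    rw [hE.mid, hF.mid] at h1
    exact h1.eq h2
  obtain ⟨a, rfl⟩ := hE; obtain ⟨b, rfl⟩ := hF; obtain ⟨c, rfl⟩ := vG; obtain ⟨d, rfl⟩ := vK
  exact ⟨_, ⟨p, rfl⟩, q, (T.interchange A B C D a b c d p q).symm⟩

theorem isComp_vone {x y z : T.Hor} (w : T.hor.IsComp x y z) :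
    T.horiz.IsComp (T.vert.one x) (T.vert.one y) (T.vert.one z) := by
  obtain ⟨p, rfl⟩ := w
  exact ⟨by rw [T.right_vone, T.left_vone, p], T.hcomp_vone _ _ _ _⟩

theorem isComp_hone {g h k : T.Ver} (w : T.ver.IsComp g h k) :
    T.vert.IsComp (T.horiz.one g) (T.horiz.one h) (T.horiz.one k) := by
  obtain ⟨p, rfl⟩ := w
  exact ⟨by rw [T.bot_hone, T.top_hone, p], T.vcomp_hone _ _ _ _⟩

theorem top_hinv (A : T.Box) : T.vert.src (T.horiz.inv A) = T.hor.inv (T.vert.src A) := by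
  have h := top_isComp (isComp_inv_right A)
  rw [T.top_hone] at h
  exact h.eq_inv_of_one

theorem bot_hinv (A : T.Box) : T.vert.tgt (T.horiz.inv A) = T.hor.inv (T.vert.tgt A) := by
  have h := bot_isComp (isComp_inv_right A)
  rw [T.bot_hone] at h
  exact h.eq_inv_of_one

theorem left_vinv (A : T.Box) : T.horiz.src (T.vert.inv A) = T.ver.inv (T.horiz.src A) := by
  have h := left_isComp (isComp_inv_right A)
  rw [T.left_vone] at h
  exact h.eq_inv_of_one

theorem right_vinv (A : T.Box) : T.horiz.tgt (T.vert.inv A) = T.ver.inv (T.horiz.tgt A) := by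
  have h := right_isComp (isComp_inv_right A)
  rw [T.right_vone] at h
  exact h.eq_inv_of_one

theorem hinv_vone (x : T.Hor) : T.horiz.inv (T.vert.one x) = T.vert.one (T.hor.inv x) := by
  have h := isComp_vone (isComp_inv_right x)
  rw [T.one_one] at h
  exact h.eq_inv_of_one.symm

theorem isComp_hinv {A B C : T.Box} (w : T.vert.IsComp A B C) :
    T.vert.IsComp (T.horiz.inv A) (T.horiz.inv B) (T.horiz.inv C) := by
  have p : T.vert.tgt (T.horiz.inv A) = T.vert.src (T.horiz.inv B) := by
    rw [bot_hinv, top_hinv, w.mid]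
  obtain ⟨M, h1, h2⟩ := isComp_interchange (isComp_inv_right A) (isComp_inv_right B) w
    (isComp_comp _ _ p)
  have h3 := isComp_hone (left_isComp w)
  rw [h1.eq h3] at h2
  rw [← h2.eq_inv_of_one]
  exact isComp_comp _ _ p

theorem src_boxInv (A : T.Box) : T.vert.src (T.boxInv A) = T.hor.inv (T.vert.tgt A) := by
  rw [boxInv, T.vert.src_inv, bot_hinv]

theorem tgt_boxInv (A : T.Box) : T.vert.tgt (T.boxInv A) = T.hor.inv (T.vert.src A) := by
  rw [boxInv, T.vert.tgt_inv, top_hinv]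

theorem boxInv_vone (x : T.Hor) : T.boxInv (T.vert.one x) = T.vert.one (T.hor.inv x) := by
  rw [boxInv, hinv_vone, ArrowGroupoid.inv_one]

theorem isComp_boxInv {A B C : T.Box} (w : T.vert.IsComp A B C) :
    T.vert.IsComp (T.boxInv B) (T.boxInv A) (T.boxInv C) :=
  (isComp_hinv w).inv

section Vacant

variable [T.IsVacant]

theorem eq_of_top_right {X Y : T.Box} (h : T.vert.src X = T.vert.src Y)
    (h' : T.horiz.tgt X = T.horiz.tgt Y) : X = Y :=
  (IsVacant.existsUnique_box (T.vert.src Y) (T.horiz.tgt Y) (T.right_top Y)).unique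
    ⟨h, h'⟩ ⟨rfl, rfl⟩

theorem eq_of_bot_right {X Y : T.Box} (h : T.vert.tgt X = T.vert.tgt Y)
    (h' : T.horiz.tgt X = T.horiz.tgt Y) : X = Y := by
  rw [← ArrowGroupoid.inv_inv (G := T.vert) X, ← ArrowGroupoid.inv_inv (G := T.vert) Y]
  congr 1
  apply eq_of_top_right
  · rw [T.vert.src_inv, T.vert.src_inv, h]
  · rw [right_vinv, right_vinv, h']

theorem exists_bot_right (y : T.Hor) (g : T.Ver) (h : T.hor.tgt y = T.ver.tgt g) :
    ∃ X : T.Box, T.vert.tgt X = y ∧ T.horiz.tgt X = g := by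
  obtain ⟨X, ⟨h1, h2⟩, -⟩ := IsVacant.existsUnique_box y (T.ver.inv g)
    (by rw [T.ver.src_inv, h])
  exact ⟨T.vert.inv X, by rw [T.vert.tgt_inv, h1],
    by rw [right_vinv, h2, ArrowGroupoid.inv_inv]⟩

/-- A decomposition of the bottom edge of a box lifts to a decomposition of the box. -/
theorem exists_split (A : T.Box) {x y : T.Hor} (w : T.hor.IsComp x y (T.vert.tgt A)) :
    ∃ B C, T.horiz.IsComp B C A ∧ T.vert.tgt B = x ∧ T.vert.tgt C = y := by
  obtain ⟨C, h1, h2⟩ := exists_bot_right y (T.horiz.tgt A) (by rw [← T.right_bot, ← w.tgt])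
  have h3 : T.horiz.tgt A = T.horiz.src (T.horiz.inv C) := by rw [T.horiz.src_inv, h2]
  have h4 := (isComp_comp _ _ h3).inv_right
  rw [ArrowGroupoid.inv_inv] at h4
  refine ⟨_, C, h4, ?_, h1⟩
  have h5 := bot_isComp h4
  rw [h1] at h5
  exact h5.cancel_right w

theorem split_unique {A B C B' C' : T.Box} (w : T.horiz.IsComp B C A)
    (w' : T.horiz.IsComp B' C' A) (h' : T.vert.tgt C = T.vert.tgt C') : B = B' ∧ C = C' := by
  have : C = C' := eq_of_bot_right h' (by rw [← w.tgt, ← w'.tgt])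
  subst this
  exact ⟨w.cancel_right w', rfl⟩

/-- A box whose bottom edge is an identity is a horizontal identity. -/
theorem eq_hone_of_bot {A : T.Box} {P : T.Pt} (h : T.vert.tgt A = T.hor.one P) :
    A = T.horiz.one (T.horiz.tgt A) := by
  apply eq_of_bot_right
  · rw [T.bot_hone, ← T.right_bot, h, T.hor.tgt_one]
  · rw [T.horiz.tgt_one]

end Vacant

end DoubleGroupoid

open CategoryTheory TensorProduct

/-- A finite-dimensional `k`-linear bundle over a groupoid: a family of finite-dimensional vector
spaces `fib x` indexed by the objects `x`, with a linear map `fib (tgt g) → fib (src g)` for every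
arrow `g`, compatible with identities and composition. (The endpoints of `g` are named through
equations, so that no transport along equalities of objects is needed. The maps `act g` are
automatically isomorphisms.) -/
structure Bundle (k : Type u) [Field k] {A O : Type u} (G : ArrowGroupoid A O) where
  fib : O → Type u
  [addCommGroup : ∀ x, AddCommGroup (fib x)]
  [module : ∀ x, Module k (fib x)]
  [finite : ∀ x, FiniteDimensional k (fib x)]
  act : ∀ (g : A) {a b : O}, G.src g = a → G.tgt g = b → (fib b →ₗ[k] fib a)
  act_one : ∀ (x : O) (h : G.src (G.one x) = x) (h' : G.tgt (G.one x) = x),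
    act (G.one x) h h' = LinearMap.id
  act_comp : ∀ {f g : A} (p : G.tgt f = G.src g) {a b c : O} (h₁ : G.src f = a) (h₂ : G.tgt f = b)
    (h₃ : G.src g = b) (h₄ : G.tgt g = c) (h₅ : G.src (G.comp f g p) = a)
    (h₆ : G.tgt (G.comp f g p) = c),
    act (G.comp f g p) h₅ h₆ = act f h₁ h₂ ∘ₗ act g h₃ h₄

namespace Bundle

attribute [instance] Bundle.addCommGroup Bundle.module Bundle.finite

variable {k : Type u} [Field k] {A O : Type u} {G : ArrowGroupoid A O}

/-- A morphism of bundles: a family of linear maps between the fibres commuting with the action. -/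
@[ext]
structure Hom (V W : Bundle k G) where
  app : ∀ x, V.fib x →ₗ[k] W.fib x
  comm : ∀ (g : A) {a b : O} (h : G.src g = a) (h' : G.tgt g = b) (v : V.fib b),
    app a (V.act g h h' v) = W.act g h h' (app b v)

instance : Category (Bundle k G) where
  Hom := Hom
  id V := ⟨fun _ => LinearMap.id, fun _ _ _ _ _ _ => rfl⟩
  comp f g := ⟨fun x => g.app x ∘ₗ f.app x, fun a _ _ h h' v => by simp [f.comm, g.comm]⟩

variable {U V W : Bundle k G}

@[ext]
theorem hom_ext {f g : V ⟶ W} (h : ∀ x, f.app x = g.app x) : f = g :=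
  Hom.ext (funext h)

@[simp] theorem id_app (x : O) : Hom.app (𝟙 V) x = LinearMap.id := rfl
@[simp] theorem comp_app (f : U ⟶ V) (g : V ⟶ W) (x : O) :
    Hom.app (f ≫ g) x = g.app x ∘ₗ f.app x := rfl

instance : Add (V ⟶ W) := ⟨fun f g => ⟨fun x => f.app x + g.app x, fun a _ _ h h' v => by
  simp [f.comm, g.comm]⟩⟩
instance : Zero (V ⟶ W) := ⟨⟨fun _ => 0, fun a _ _ h h' v => by simp⟩⟩
instance : Neg (V ⟶ W) := ⟨fun f => ⟨fun x => -f.app x, fun a _ _ h h' v => by simp [f.comm]⟩⟩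
instance : Sub (V ⟶ W) := ⟨fun f g => ⟨fun x => f.app x - g.app x, fun a _ _ h h' v => by
  simp [f.comm, g.comm]⟩⟩
instance : SMul ℕ (V ⟶ W) := ⟨fun n f => ⟨fun x => n • f.app x, fun a _ _ h h' v => by
  simp [f.comm]⟩⟩
instance : SMul ℤ (V ⟶ W) := ⟨fun n f => ⟨fun x => n • f.app x, fun a _ _ h h' v => by
  simp [f.comm]⟩⟩
instance : SMul k (V ⟶ W) := ⟨fun c f => ⟨fun x => c • f.app x, fun a _ _ h h' v => by
  simp [f.comm]⟩⟩

theorem app_injective :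
    Function.Injective (fun (f : V ⟶ W) (x : O) => (f.app x : V.fib x →ₗ[k] W.fib x)) :=
  fun _ _ h => Hom.ext h

instance : AddCommGroup (V ⟶ W) :=
  app_injective.addCommGroup _ rfl (fun _ _ => rfl) (fun _ => rfl) (fun _ _ => rfl)
    (fun _ _ => rfl) (fun _ _ => rfl)

@[simp] theorem add_app (f g : V ⟶ W) (x : O) : Hom.app (f + g) x = f.app x + g.app x := rfl
@[simp] theorem smul_app (c : k) (f : V ⟶ W) (x : O) : Hom.app (c • f) x = c • f.app x := rfl

instance : Module k (V ⟶ W) :=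
  app_injective.module k ⟨⟨_, rfl⟩, fun _ _ => rfl⟩ (fun _ _ => rfl)

instance : Preadditive (Bundle k G) where
  add_comp := by intros; ext; simp
  comp_add := by intros; ext; simp

instance : Linear k (Bundle k G) where
  smul_comp := by intros; ext; simp
  comp_smul := by intros; ext; simp

/-- Build an isomorphism of bundles from a morphism with a fibrewise inverse. -/
def isoMk (f : V ⟶ W) (g : ∀ x, W.fib x →ₗ[k] V.fib x)
    (h₁ : ∀ x, g x ∘ₗ f.app x = LinearMap.id) (h₂ : ∀ x, f.app x ∘ₗ g x = LinearMap.id) :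
    V ≅ W where
  hom := f
  inv := ⟨g, fun a x y h h' w => by
    have e : V.act a h h' (g y w) = g x (f.app x (V.act a h h' (g y w))) :=
      (LinearMap.congr_fun (h₁ x) _).symm
    rw [e, f.comm]
    congr 2
    exact (LinearMap.congr_fun (h₂ y) w).symm⟩
  hom_inv_id := by ext x : 1; exact h₁ x
  inv_hom_id := by ext x : 1; exact h₂ x

@[simp] theorem isoMk_hom (f : V ⟶ W) (g : ∀ x, W.fib x →ₗ[k] V.fib x)
    (h₁ : ∀ x, g x ∘ₗ f.app x = LinearMap.id) (h₂ : ∀ x, f.app x ∘ₗ g x = LinearMap.id) :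
    (isoMk f g h₁ h₂).hom = f := rfl

theorem act_isComp (V : Bundle k G) {f g h : A} (w : G.IsComp f g h) {a b c : O}
    (h₁ : G.src f = a) (h₂ : G.tgt f = b) (h₃ : G.src g = b) (h₄ : G.tgt g = c)
    (h₅ : G.src h = a) (h₆ : G.tgt h = c) (v : V.fib c) :
    V.act h h₅ h₆ v = V.act f h₁ h₂ (V.act g h₃ h₄ v) := by
  obtain ⟨p, rfl⟩ := w
  rw [V.act_comp p h₁ h₂ h₃ h₄ h₅ h₆]; rfl

end Bundle

/-- The category of finite-dimensional bundles over the vertical groupoid `Box ⇉ Hor` of a double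
groupoid: `Hor`-graded vector spaces with an action of the vertical groupoid. -/
abbrev TBund (k : Type u) [Field k] (T : DoubleGroupoid.{u}) := Bundle k T.vert

namespace TBund

noncomputable section

open scoped Classical DirectSum
open DoubleGroupoid ArrowGroupoid

attribute [local instance] Fintype.ofFinite

variable {k : Type u} [Field k] {T : DoubleGroupoid.{u}}

/-- The pairs `(x, y)` of composable horizontal edges with `x y = z`. -/
abbrev Fact (T : DoubleGroupoid.{u}) (z : T.Hor) : Type u :=
  {p : T.Hor × T.Hor // T.hor.IsComp p.1 p.2 z}

/-- The horizontal decompositions `A = B C` such that `B` and `C` have bottom edges `x` and `y`. -/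
abbrev Split (A : T.Box) (x y : T.Hor) : Type u :=
  {q : T.Box × T.Box // T.horiz.IsComp q.1 q.2 A ∧ T.vert.tgt q.1 = x ∧ T.vert.tgt q.2 = y}

/-- The homogeneous component of degree `z` of the tensor product: the direct sum of the spaces
`V_x ⊗ W_y` over all composable `x`, `y` with `x y = z`. -/
abbrev TensFib (V W : TBund k T) (z : T.Hor) : Type u :=
  ⨁ p : Fact T z, V.fib p.1.1 ⊗[k] W.fib p.1.2

/-- The element `v ⊗ w` of degree `z = x y`, for `v` of degree `x` and `w` of degree `y`. -/
def mkAux {V W : TBund k T} {x y z : T.Hor} (c : T.hor.IsComp x y z) :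
    V.fib x →ₗ[k] W.fib y →ₗ[k] TensFib V W z :=
  TensorProduct.curry
    (DirectSum.lof k (Fact T z) (fun p => V.fib p.1.1 ⊗[k] W.fib p.1.2) ⟨(x, y), c⟩)

/-- The linear map on the degree `z` component given by bilinear maps on `V_x × W_y`, `x y = z`. -/
def descAux {V W : TBund k T} {z : T.Hor} {M : Type u} [AddCommGroup M] [Module k M]
    (φ : ∀ x y, T.hor.IsComp x y z → V.fib x →ₗ[k] W.fib y →ₗ[k] M) : TensFib V W z →ₗ[k] M :=
  DirectSum.toModule k _ _ (fun p => TensorProduct.lift (φ p.1.1 p.1.2 p.2))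

@[simp]
theorem descAux_mkAux {V W : TBund k T} {z : T.Hor} {M : Type u} [AddCommGroup M] [Module k M]
    (φ : ∀ x y, T.hor.IsComp x y z → V.fib x →ₗ[k] W.fib y →ₗ[k] M) {x y : T.Hor}
    (c : T.hor.IsComp x y z) (v : V.fib x) (w : W.fib y) : descAux φ (mkAux c v w) = φ x y c v w := by
  simp only [descAux, mkAux, TensorProduct.curry_apply]
  rw [DirectSum.toModule_lof]
  rfl

theorem tensFib_ext {V W : TBund k T} {z : T.Hor} {M : Type u} [AddCommGroup M] [Module k M]
    {f g : TensFib V W z →ₗ[k] M}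
    (h : ∀ x y (c : T.hor.IsComp x y z) (v : V.fib x) (w : W.fib y),
      f (mkAux c v w) = g (mkAux c v w)) : f = g := by
  refine DirectSum.linearMap_ext k fun p => TensorProduct.ext' fun v w => ?_
  exact h p.1.1 p.1.2 p.2 v w

variable [T.IsFinite]

/-- The vector `_P 1` for all points `P` with `id P = x` form a basis of the degree `x` component
of the unit object: it is one-dimensional if `x` is an identity, and zero otherwise. -/
abbrev UnitFib (k : Type u) [Field k] (T : DoubleGroupoid.{u}) (x : T.Hor) : Type u :=
  {P : T.Pt // T.hor.one P = x} →₀ k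

/-- The box `A` maps `_P 1` to `_Q 1` if `A = id g` for a vertical edge `g` with bottom `P` and
top `Q`, and to zero otherwise. -/
def unitAct (k : Type u) [Field k] {T : DoubleGroupoid.{u}} [T.IsFinite] (A : T.Box) {a b : T.Hor}
    (h : T.vert.src A = a) (_h' : T.vert.tgt A = b) : UnitFib k T b →ₗ[k] UnitFib k T a :=
  Finsupp.lsum k fun P => ∑ g : {g : T.Ver // T.horiz.one g = A ∧ T.ver.tgt g = P.1},
    Finsupp.lsingle ⟨T.ver.src g.1, by rw [← T.top_hone, g.2.1, h]⟩

theorem one_injective {A O : Type u} (G : ArrowGroupoid A O) : Function.Injective G.one :=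
  fun x y h => by rw [← G.src_one x, h, G.src_one]

theorem unitAct_single (g : T.Ver) {A : T.Box} (e : T.horiz.one g = A) {a b : T.Hor}
    (h : T.vert.src A = a) (h' : T.vert.tgt A = b) (P Q : T.Pt) (hP : T.hor.one P = b)
    (hQ : T.hor.one Q = a) (eP : T.ver.tgt g = P) (eQ : T.ver.src g = Q) (c : k) :
    unitAct k A h h' (Finsupp.single ⟨P, hP⟩ c) = Finsupp.single ⟨Q, hQ⟩ c := by
  subst eQ
  rw [unitAct, Finsupp.lsum_single, Fintype.sum_eq_single
    (⟨g, e, eP⟩ : {g : T.Ver // T.horiz.one g = A ∧ T.ver.tgt g = P})]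
  · rfl
  · intro g' hne
    exact absurd (Subtype.ext (one_injective T.horiz (g'.2.1.trans e.symm))) hne

/-- The action of a box on a tensor product, given by the comultiplication `Δ(A) = ∑ B ⊗ C`, the
sum running over the horizontal decompositions `A = B C`. -/
def tensAct (V W : TBund k T) (A : T.Box) {a b : T.Hor} (h : T.vert.src A = a)
    (_h' : T.vert.tgt A = b) : TensFib V W b →ₗ[k] TensFib V W a :=
  descAux fun x y _ => ∑ q : Split A x y,
    (mkAux (h ▸ top_isComp q.2.1)).compl₁₂ (V.act q.1.1 rfl q.2.2.1) (W.act q.1.2 rfl q.2.2.2)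

variable [T.IsVacant]

theorem tensAct_mk {V W : TBund k T} {A B C : T.Box} (q : T.horiz.IsComp B C A)
    {a b x y x' y' : T.Hor} (h : T.vert.src A = a) (h' : T.vert.tgt A = b)
    (hx : T.vert.tgt B = x) (hy : T.vert.tgt C = y)
    (hx' : T.vert.src B = x') (hy' : T.vert.src C = y') (c : T.hor.IsComp x y b)
    (c' : T.hor.IsComp x' y' a) (v : V.fib x) (w : W.fib y) :
    tensAct V W A h h' (mkAux c v w) = mkAux c' (V.act B hx' hx v) (W.act C hy' hy w) := by
  subst hx' hy'
  rw [tensAct, descAux_mkAux, Finset.sum_eq_single (⟨(B, C), q, hx, hy⟩ : Split A x y)]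
  · rfl
  · intro q' _ hq'
    exfalso
    apply hq'
    obtain ⟨e₁, e₂⟩ := split_unique q'.2.1 q (q'.2.2.2.trans hy.symm)
    exact Subtype.ext (Prod.ext e₁ e₂)
  · intro h; exact absurd (Finset.mem_univ _) h

/-- The tensor product of two bundles. -/
def tens (V W : TBund k T) : TBund k T where
  fib := TensFib V W
  act := tensAct V W
  act_one z h h' := by
    refine tensFib_ext fun x y c v w => ?_
    rw [tensAct_mk (isComp_vone c) h h' (T.vert.tgt_one x) (T.vert.tgt_one y)
      (T.vert.src_one x) (T.vert.src_one y) c c, V.act_one, W.act_one]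
    rfl
  act_comp {f g} p {a b c} h₁ h₂ h₃ h₄ h₅ h₆ := by
    refine tensFib_ext fun x y e v w => ?_
    subst h₁ h₂ h₄
    obtain ⟨B', C', q', hB', hC'⟩ := exists_split g e
    have e₁ := top_isComp q'
    rw [h₃] at e₁
    obtain ⟨B, C, q, hB, hC⟩ := exists_split f e₁
    obtain ⟨M, m₁, m₂⟩ := isComp_interchange q q' (isComp_comp B B' hB) (isComp_comp C C' hC)
    rw [m₁.eq ⟨p, rfl⟩] at m₂
    rw [tensAct_mk m₂ h₅ h₆ ((T.vert.tgt_comp _ _ _).trans hB') ((T.vert.tgt_comp _ _ _).trans hC')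
      (T.vert.src_comp _ _ _) (T.vert.src_comp _ _ _) e (top_isComp q),
      LinearMap.comp_apply, tensAct_mk q' h₃ rfl hB' hC' rfl rfl e e₁,
      tensAct_mk q rfl rfl hB hC rfl rfl e₁ (top_isComp q)]
    rw [V.act_comp hB rfl hB rfl hB', W.act_comp hC rfl hC rfl hC']
    rfl

section Tensor

variable {V W V' W' : TBund k T} {M : Type u} [AddCommGroup M] [Module k M]

/-- The element `v ⊗ w` of degree `z = x y`, for `v` of degree `x` and `w` of degree `y`. -/
def mk {x y z : T.Hor} (c : T.hor.IsComp x y z) :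
    V.fib x →ₗ[k] W.fib y →ₗ[k] (tens V W).fib z := mkAux c

/-- The linear map on the degree `z` component given by bilinear maps on `V_x × W_y`, `x y = z`. -/
def desc {z : T.Hor}
    (φ : ∀ x y, T.hor.IsComp x y z → V.fib x →ₗ[k] W.fib y →ₗ[k] M) :
    (tens V W).fib z →ₗ[k] M := descAux φ

theorem desc_mk {z : T.Hor}
    (φ : ∀ x y, T.hor.IsComp x y z → V.fib x →ₗ[k] W.fib y →ₗ[k] M) {x y : T.Hor}
    (c : T.hor.IsComp x y z) (v : V.fib x) (w : W.fib y) : desc φ (mk c v w) = φ x y c v w :=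
  descAux_mkAux φ c v w

theorem tens_ext {z : T.Hor} {f g : (tens V W).fib z →ₗ[k] M}
    (h : ∀ x y (c : T.hor.IsComp x y z) (v : V.fib x) (w : W.fib y),
      f (mk c v w) = g (mk c v w)) : f = g :=
  tensFib_ext h

theorem tens_ext' {z : T.Hor} {f g : (tens V W).fib z →ₗ[k] M}
    (h : ∀ x y (c : T.hor.IsComp x y z) (w : W.fib y),
      f ∘ₗ (mk c).flip w = g ∘ₗ (mk c).flip w) : f = g :=
  tens_ext fun x y c v w => LinearMap.congr_fun (h x y c w) v

theorem act_mk {A B C : T.Box} (q : T.horiz.IsComp B C A)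
    {a b x y x' y' : T.Hor} (h : T.vert.src A = a) (h' : T.vert.tgt A = b)
    (hx : T.vert.tgt B = x) (hy : T.vert.tgt C = y)
    (hx' : T.vert.src B = x') (hy' : T.vert.src C = y') (c : T.hor.IsComp x y b)
    (c' : T.hor.IsComp x' y' a) (v : V.fib x) (w : W.fib y) :
    (tens V W).act A h h' (mk c v w) = mk c' (V.act B hx' hx v) (W.act C hy' hy w) :=
  tensAct_mk q h h' hx hy hx' hy' c c' v w

/-- The tensor product of two morphisms of bundles in degree `z`. -/
def tensMapApp (f : V ⟶ V') (g : W ⟶ W') (z : T.Hor) :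
    (tens V W).fib z →ₗ[k] (tens V' W').fib z :=
  desc fun x y c => (mk c).compl₁₂ (f.app x) (g.app y)

theorem tensMapApp_mk (f : V ⟶ V') (g : W ⟶ W') {x y z : T.Hor}
    (c : T.hor.IsComp x y z) (v : V.fib x) (w : W.fib y) :
    tensMapApp f g z (mk c v w) = mk c (f.app x v) (g.app y w) := by
  rw [tensMapApp, desc_mk]; rfl

/-- The tensor product of two morphisms of bundles. -/
def tensMap (f : V ⟶ V') (g : W ⟶ W') : tens V W ⟶ tens V' W' where
  app := tensMapApp f g
  comm A {a b} h h' t := by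
    refine LinearMap.congr_fun (f := tensMapApp f g a ∘ₗ (tens V W).act A h h')
      (g := (tens V' W').act A h h' ∘ₗ tensMapApp f g b)
      (tens_ext fun x y c v w => ?_) t
    subst h h'
    obtain ⟨B, C, q, hB, hC⟩ := exists_split A c
    simp only [LinearMap.comp_apply]
    rw [act_mk q rfl rfl hB hC rfl rfl c (top_isComp q), tensMapApp_mk, tensMapApp_mk,
      act_mk q rfl rfl hB hC rfl rfl c (top_isComp q), f.comm, g.comm]

@[simp]
theorem tensMap_mk (f : V ⟶ V') (g : W ⟶ W') {x y z : T.Hor}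
    (c : T.hor.IsComp x y z) (v : V.fib x) (w : W.fib y) :
    Bundle.Hom.app (tensMap f g) z (mk c v w) = mk c (f.app x v) (g.app y w) :=
  tensMapApp_mk f g c v w

end Tensor

/-- The unit object. -/
def unit (k : Type u) [Field k] (T : DoubleGroupoid.{u}) [T.IsFinite] [T.IsVacant] :
    TBund k T where
  fib := UnitFib k T
  act := unitAct k
  act_one x h h' := by
    refine Finsupp.lhom_ext fun P c => ?_
    obtain ⟨P, rfl⟩ := P
    rw [unitAct_single (T.ver.one P) (T.one_one P).symm h h' P P rfl rfl (T.ver.tgt_one P)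
      (T.ver.src_one P)]
    rfl
  act_comp {f g} p {a b c} h₁ h₂ h₃ h₄ h₅ h₆ := by
    refine Finsupp.lhom_ext fun P e => ?_
    obtain ⟨P, hP⟩ := P
    have hg := eq_hone_of_bot (h₄.trans hP.symm)
    obtain ⟨g', rfl⟩ : ∃ g', T.horiz.one g' = g := ⟨_, hg.symm⟩
    have hP' : T.ver.tgt g' = P :=
      one_injective T.hor (by rw [← T.bot_hone]; exact h₄.trans hP.symm)
    have hb : T.hor.one (T.ver.src g') = b := by rw [← T.top_hone]; exact h₃
    have hf := eq_hone_of_bot (h₂.trans hb.symm)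
    obtain ⟨f', rfl⟩ : ∃ f', T.horiz.one f' = f := ⟨_, hf.symm⟩
    have hQ : T.ver.tgt f' = T.ver.src g' :=
      one_injective T.hor (by rw [← T.bot_hone]; exact h₂.trans hb.symm)
    have ha : T.hor.one (T.ver.src f') = a := by rw [← T.top_hone]; exact h₁
    rw [LinearMap.comp_apply, unitAct_single g' rfl h₃ h₄ P _ hP hb hP' rfl,
      unitAct_single f' rfl h₁ h₂ _ _ hb ha hQ rfl,
      unitAct_single (T.ver.comp f' g' hQ) (T.vcomp_hone _ _ _ _).symm h₅ h₆ P _ hP ha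
        ((T.ver.tgt_comp _ _ _).trans hP') (T.ver.src_comp _ _ _)]

/-- The basis vector `_P 1` of the unit object, multiplied by a scalar. -/
def unitVec {x : T.Hor} (P : T.Pt) (hP : T.hor.one P = x) : k →ₗ[k] (unit k T).fib x :=
  Finsupp.lsingle ⟨P, hP⟩

theorem unit_ext {x : T.Hor} {M : Type u} [AddCommGroup M] [Module k M]
    {f g : (unit k T).fib x →ₗ[k] M}
    (h : ∀ P (hP : T.hor.one P = x), f (unitVec P hP 1) = g (unitVec P hP 1)) : f = g := by
  refine Finsupp.lhom_ext' fun P => LinearMap.ext_ring ?_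
  exact h P.1 P.2

theorem act_unitVec (g : T.Ver) {A : T.Box} (e : T.horiz.one g = A) {a b : T.Hor}
    (h : T.vert.src A = a) (h' : T.vert.tgt A = b) (P Q : T.Pt) (hP : T.hor.one P = b)
    (hQ : T.hor.one Q = a) (eP : T.ver.tgt g = P) (eQ : T.ver.src g = Q) (c : k) :
    (unit k T).act A h h' (unitVec P hP c) = unitVec Q hQ c :=
  unitAct_single g e h h' P Q hP hQ eP eQ c

/-- The linear map on the degree `x` component of the unit object with given values at `_P 1`. -/
def unitDesc {x : T.Hor} {M : Type u} [AddCommGroup M] [Module k M]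
    (φ : ∀ P, T.hor.one P = x → M) : (unit k T).fib x →ₗ[k] M :=
  Finsupp.lift M k {P : T.Pt // T.hor.one P = x} fun P => φ P.1 P.2

theorem unitDesc_unitVec {x : T.Hor} {M : Type u} [AddCommGroup M] [Module k M]
    (φ : ∀ P, T.hor.one P = x → M) (P : T.Pt) (hP : T.hor.one P = x) (c : k) :
    unitDesc φ (unitVec P hP c) = c • φ P hP := by
  refine (Finsupp.lift_apply _ _ _ _ _).trans ?_
  exact Finsupp.sum_single_index (zero_smul _ _)

section Assoc

variable {U V W : TBund k T}

theorem tens_ext₃ {z : T.Hor} {M : Type u} [AddCommGroup M] [Module k M]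
    {f g : (tens (tens V W) U).fib z →ₗ[k] M}
    (h : ∀ p u (c : T.hor.IsComp p u z) x y (d : T.hor.IsComp x y p)
      (v : V.fib x) (w : W.fib y) (t : U.fib u),
      f (mk c (mk d v w) t) = g (mk c (mk d v w) t)) : f = g := by
  refine tens_ext fun p u c s t => ?_
  exact LinearMap.congr_fun (f := f ∘ₗ (mk c).flip t) (g := g ∘ₗ (mk c).flip t)
    (tens_ext fun x y d v w => h p u c x y d v w t) s

theorem tens_ext₃' {z : T.Hor} {M : Type u} [AddCommGroup M] [Module k M]
    {f g : (tens V (tens W U)).fib z →ₗ[k] M}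
    (h : ∀ x q (c : T.hor.IsComp x q z) y u (d : T.hor.IsComp y u q)
      (v : V.fib x) (w : W.fib y) (t : U.fib u),
      f (mk c v (mk d w t)) = g (mk c v (mk d w t))) : f = g := by
  refine tens_ext fun p u c s t => ?_
  exact LinearMap.congr_fun (f := f ∘ₗ mk c s) (g := g ∘ₗ mk c s)
    (tens_ext fun x y d v w => h p u c x y d s v w) t

/-- The trilinear map `(v, w, t) ↦ v ⊗ (w ⊗ t)`. -/
def triR {x y u q z : T.Hor} (d : T.hor.IsComp y u q) (c : T.hor.IsComp x q z) :
    V.fib x →ₗ[k] W.fib y →ₗ[k] U.fib u →ₗ[k] (tens V (tens W U)).fib z :=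
  LinearMap.mk₂ k (fun v w => mk c v ∘ₗ mk d w)
    (fun _ _ _ => by ext; simp only [map_add, LinearMap.comp_apply, LinearMap.add_apply])
    (fun _ _ _ => by ext; simp only [map_smul, LinearMap.comp_apply, LinearMap.smul_apply])
    (fun _ _ _ => by ext; simp only [map_add, LinearMap.comp_apply, LinearMap.add_apply])
    (fun _ _ _ => by ext; simp only [map_smul, LinearMap.comp_apply, LinearMap.smul_apply])

/-- The trilinear map `(w, t, v) ↦ (v ⊗ w) ⊗ t`. -/
def triL {x y u p z : T.Hor} (d : T.hor.IsComp x y p) (c : T.hor.IsComp p u z) :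
    W.fib y →ₗ[k] U.fib u →ₗ[k] V.fib x →ₗ[k] (tens (tens V W) U).fib z :=
  LinearMap.mk₂ k (fun w t => (mk c).flip t ∘ₗ (mk d).flip w)
    (fun _ _ _ => by ext; simp only [map_add, LinearMap.comp_apply, LinearMap.add_apply])
    (fun _ _ _ => by ext; simp only [map_smul, LinearMap.comp_apply, LinearMap.smul_apply])
    (fun _ _ _ => by ext; simp only [map_add, LinearMap.comp_apply, LinearMap.add_apply])
    (fun _ _ _ => by ext; simp only [map_smul, LinearMap.comp_apply, LinearMap.smul_apply])

/-- The associativity map `(v ⊗ w) ⊗ t ↦ v ⊗ (w ⊗ t)` in degree `z`. -/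
def assocApp (V W U : TBund k T) (z : T.Hor) :
    (tens (tens V W) U).fib z →ₗ[k] (tens V (tens W U)).fib z :=
  desc fun _ _ c => desc fun _ _ d =>
    triR (isComp_comp _ _ (d.tgt.symm.trans c.mid)) (d.assoc (isComp_comp _ _ _) c)

/-- The inverse associativity map `v ⊗ (w ⊗ t) ↦ (v ⊗ w) ⊗ t` in degree `z`. -/
def assocInvApp (V W U : TBund k T) (z : T.Hor) :
    (tens V (tens W U)).fib z →ₗ[k] (tens (tens V W) U).fib z :=
  desc fun _ _ c => (desc fun _ _ d =>
    triL (isComp_comp _ _ (c.mid.trans d.src)) ((isComp_comp _ _ _).assoc' d c)).flip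

theorem assocApp_mk {x y u p q z : T.Hor} (c : T.hor.IsComp p u z) (d : T.hor.IsComp x y p)
    (d' : T.hor.IsComp y u q) (c' : T.hor.IsComp x q z)
    (v : V.fib x) (w : W.fib y) (t : U.fib u) :
    assocApp V W U z (mk c (mk d v w) t) = mk c' v (mk d' w t) := by
  obtain ⟨e, rfl⟩ := d'
  rw [assocApp, desc_mk, desc_mk]; rfl

theorem assocInvApp_mk {x y u p q z : T.Hor} (c : T.hor.IsComp p u z) (d : T.hor.IsComp x y p)
    (d' : T.hor.IsComp y u q) (c' : T.hor.IsComp x q z)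
    (v : V.fib x) (w : W.fib y) (t : U.fib u) :
    assocInvApp V W U z (mk c' v (mk d' w t)) = mk c (mk d v w) t := by
  obtain ⟨e, rfl⟩ := d
  rw [assocInvApp, desc_mk, LinearMap.flip_apply, desc_mk]; rfl

/-- The associativity isomorphism. -/
def assocIso (V W U : TBund k T) : tens (tens V W) U ≅ tens V (tens W U) :=
  Bundle.isoMk
    { app := assocApp V W U
      comm := fun A {a b} h h' t => by
        refine LinearMap.congr_fun (f := assocApp V W U a ∘ₗ (tens (tens V W) U).act A h h')
          (g := (tens V (tens W U)).act A h h' ∘ₗ assocApp V W U b)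
          (tens_ext₃ fun p u c x y d v w t => ?_) t
        subst h h'
        obtain ⟨B, C, q, hB, hC⟩ := exists_split A c
        subst hB
        obtain ⟨B₁, B₂, q', hB₁, hB₂⟩ := exists_split B d
        have e := isComp_comp B₂ C (q'.tgt.symm.trans q.mid)
        have e' := q'.assoc e q
        have d' := bot_isComp e
        have c' := bot_isComp e'
        rw [hB₂, hC] at d'
        rw [hB₁] at c'
        simp only [LinearMap.comp_apply]
        rw [act_mk q rfl rfl rfl hC rfl rfl c (top_isComp q),
          act_mk q' rfl rfl hB₁ hB₂ rfl rfl d (top_isComp q'),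
          assocApp_mk _ _ (top_isComp e) (top_isComp e'), assocApp_mk _ _ d' c',
          act_mk e' rfl rfl hB₁ rfl rfl rfl c' (top_isComp e'),
          act_mk e rfl rfl hB₂ hC rfl rfl d' (top_isComp e)] }
    (assocInvApp V W U)
    (fun z => tens_ext₃ fun p u c x y d v w t => by
      have d' := isComp_comp y u (d.tgt.symm.trans c.mid)
      simp only [LinearMap.comp_apply]
      rw [assocApp_mk c d d' (d.assoc d' c), assocInvApp_mk c d d' (d.assoc d' c)]; rfl)
    (fun z => tens_ext₃' fun x q c' y u d' v w t => by
      have d := isComp_comp x y (c'.mid.trans d'.src)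
      simp only [LinearMap.comp_apply]
      rw [assocInvApp_mk (d.assoc' d' c') d d' c', assocApp_mk (d.assoc' d' c') d d' c']; rfl)

theorem assocIso_mk {x y u p q z : T.Hor} (c : T.hor.IsComp p u z) (d : T.hor.IsComp x y p)
    (d' : T.hor.IsComp y u q) (c' : T.hor.IsComp x q z)
    (v : V.fib x) (w : W.fib y) (t : U.fib u) :
    Bundle.Hom.app (assocIso V W U).hom z (mk c (mk d v w) t) = mk c' v (mk d' w t) :=
  assocApp_mk c d d' c' v w t

end Assoc

section Unitors

variable {V : TBund k T}

/-- The left unit map `_P 1 ⊗ v ↦ v`, given by the (trivial) action of the identity box of `z`. -/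
def leftApp (V : TBund k T) (z : T.Hor) : (tens (unit k T) V).fib z →ₗ[k] V.fib z :=
  desc fun _ _ c => unitDesc fun _ hP => V.act (T.vert.one z) (T.vert.src_one z)
    ((T.vert.tgt_one z).trans ((hP ▸ c : T.hor.IsComp (T.hor.one _) _ z).eq_of_one_left))

/-- The right unit map `v ⊗ _P 1 ↦ v`, given by the (trivial) action of the identity box of `z`. -/
def rightApp (V : TBund k T) (z : T.Hor) : (tens V (unit k T)).fib z →ₗ[k] V.fib z :=
  desc fun _ _ c => (unitDesc fun _ hP => V.act (T.vert.one z) (T.vert.src_one z)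
    ((T.vert.tgt_one z).trans
      ((hP ▸ c : T.hor.IsComp _ (T.hor.one _) z).eq_of_one_right))).flip

theorem leftApp_mk {x z : T.Hor} (c : T.hor.IsComp x z z) (P : T.Pt) (hP : T.hor.one P = x)
    (a : k) (v : V.fib z) : leftApp V z (mk c (unitVec P hP a) v) = a • v := by
  rw [leftApp, desc_mk, unitDesc_unitVec, V.act_one]; rfl

theorem rightApp_mk {x z : T.Hor} (c : T.hor.IsComp z x z) (P : T.Pt) (hP : T.hor.one P = x)
    (a : k) (v : V.fib z) : rightApp V z (mk c v (unitVec P hP a)) = a • v := by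
  rw [rightApp, desc_mk, LinearMap.flip_apply, unitDesc_unitVec, V.act_one]; rfl

theorem left_ext {z : T.Hor} {M : Type u} [AddCommGroup M] [Module k M]
    {f g : (tens (unit k T) V).fib z →ₗ[k] M}
    (h : ∀ x (c : T.hor.IsComp x z z) P (hP : T.hor.one P = x) (v : V.fib z),
      f (mk c (unitVec P hP 1) v) = g (mk c (unitVec P hP 1) v)) : f = g := by
  refine tens_ext fun x y c s t => ?_
  refine LinearMap.congr_fun (f := f ∘ₗ (mk c).flip t) (g := g ∘ₗ (mk c).flip t)
    (unit_ext fun P hP => ?_) s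
  obtain rfl : z = y := (hP ▸ c : T.hor.IsComp (T.hor.one P) y z).eq_of_one_left
  exact h x c P hP t

theorem right_ext {z : T.Hor} {M : Type u} [AddCommGroup M] [Module k M]
    {f g : (tens V (unit k T)).fib z →ₗ[k] M}
    (h : ∀ x (c : T.hor.IsComp z x z) P (hP : T.hor.one P = x) (v : V.fib z),
      f (mk c v (unitVec P hP 1)) = g (mk c v (unitVec P hP 1))) : f = g := by
  refine tens_ext fun x y c s t => ?_
  refine LinearMap.congr_fun (f := f ∘ₗ mk c s) (g := g ∘ₗ mk c s)
    (unit_ext fun P hP => ?_) t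
  obtain rfl : z = x := (hP ▸ c : T.hor.IsComp x (T.hor.one P) z).eq_of_one_right
  exact h y c P hP s

/-- The left unit isomorphism. -/
def leftIso (V : TBund k T) : tens (unit k T) V ≅ V :=
  Bundle.isoMk
    { app := leftApp V
      comm := fun A {a b} h h' t => by
        refine LinearMap.congr_fun (f := leftApp V a ∘ₗ (tens (unit k T) V).act A h h')
          (g := V.act A h h' ∘ₗ leftApp V b) (left_ext fun x c P hP v => ?_) t
        subst h h' hP
        have hP : P = T.ver.tgt (T.horiz.src A) := by
          rw [← T.left_bot, ← c.mid, T.hor.tgt_one]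
        have c' : T.hor.IsComp (T.hor.one (T.ver.src (T.horiz.src A))) (T.vert.src A)
            (T.vert.src A) := by
          rw [← T.left_top]; exact isComp_one_left _
        simp only [LinearMap.comp_apply]
        rw [leftApp_mk c P rfl,
          act_mk (isComp_one_left A) rfl rfl ((T.bot_hone _).trans (by rw [hP])) rfl
            (T.top_hone _) rfl c c',
          act_unitVec (T.horiz.src A) rfl _ _ P _ rfl rfl hP.symm rfl, leftApp_mk, map_smul] }
    (fun z => mk (isComp_one_left z) (unitVec (T.hor.src z) rfl 1))
    (fun z => left_ext fun x c P hP v => by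
      subst hP
      obtain rfl : P = T.hor.src z := by rw [← c.mid, T.hor.tgt_one]
      rw [LinearMap.comp_apply]
      exact (congrArg _ (leftApp_mk c _ rfl 1 v)).trans (by rw [one_smul]; rfl))
    (fun z => by
      ext v
      exact (leftApp_mk _ _ rfl 1 v).trans (one_smul _ _))

/-- The right unit isomorphism. -/
def rightIso (V : TBund k T) : tens V (unit k T) ≅ V :=
  Bundle.isoMk
    { app := rightApp V
      comm := fun A {a b} h h' t => by
        refine LinearMap.congr_fun (f := rightApp V a ∘ₗ (tens V (unit k T)).act A h h')
          (g := V.act A h h' ∘ₗ rightApp V b) (right_ext fun x c P hP v => ?_) t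
        subst h h' hP
        have hP : P = T.ver.tgt (T.horiz.tgt A) := by
          rw [← T.right_bot, c.mid, T.hor.src_one]
        have c' : T.hor.IsComp (T.vert.src A) (T.hor.one (T.ver.src (T.horiz.tgt A)))
            (T.vert.src A) := by
          rw [← T.right_top]; exact isComp_one_right _
        simp only [LinearMap.comp_apply]
        rw [rightApp_mk c P rfl,
          act_mk (isComp_one_right A) rfl rfl rfl ((T.bot_hone _).trans (by rw [hP]))
            rfl (T.top_hone _) c c',
          act_unitVec (T.horiz.tgt A) rfl _ _ P _ rfl rfl hP.symm rfl, rightApp_mk, map_smul] }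
    (fun z => (mk (isComp_one_right z)).flip (unitVec (T.hor.tgt z) rfl 1))
    (fun z => right_ext fun x c P hP v => by
      subst hP
      obtain rfl : P = T.hor.tgt z := by rw [c.mid, T.hor.src_one]
      rw [LinearMap.comp_apply]
      exact (congrArg _ (rightApp_mk c _ rfl 1 v)).trans (by rw [one_smul]; rfl))
    (fun z => by
      ext v
      exact (rightApp_mk _ _ rfl 1 v).trans (one_smul _ _))

theorem leftIso_mk {x z : T.Hor} (c : T.hor.IsComp x z z) (P : T.Pt) (hP : T.hor.one P = x)
    (a : k) (v : V.fib z) :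
    Bundle.Hom.app (leftIso V).hom z (mk c (unitVec P hP a) v) = a • v :=
  leftApp_mk c P hP a v

theorem rightIso_mk {x z : T.Hor} (c : T.hor.IsComp z x z) (P : T.Pt) (hP : T.hor.one P = x)
    (a : k) (v : V.fib z) :
    Bundle.Hom.app (rightIso V).hom z (mk c v (unitVec P hP a)) = a • v :=
  rightApp_mk c P hP a v

end Unitors

/-- The monoidal structure on the category of bundles. -/
instance : MonoidalCategory (TBund k T) where
  tensorObj := tens
  whiskerLeft V _ _ f := tensMap (𝟙 V) f
  whiskerRight f W := tensMap f (𝟙 W)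
  tensorHom f g := tensMap f g
  tensorUnit := unit k T
  associator := assocIso
  leftUnitor := leftIso
  rightUnitor := rightIso
  tensorHom_def f g := by
    ext z : 1
    refine tens_ext fun x y c v w => ?_
    simp
  id_tensorHom_id V W := by
    ext z : 1
    refine tens_ext fun x y c v w => ?_
    simp
  tensorHom_comp_tensorHom f g f' g' := by
    ext z : 1
    refine tens_ext fun x y c v w => ?_
    simp
  id_whiskerRight V W := by
    ext z : 1
    refine tens_ext fun x y c v w => ?_
    simp
  whiskerLeft_id V W := by
    ext z : 1
    refine tens_ext fun x y c v w => ?_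
    simp
  associator_naturality f g h := by
    ext z : 1
    refine tens_ext₃ fun p u c x y d v w t => ?_
    have d' := isComp_comp y u (d.tgt.symm.trans c.mid)
    have c' := d.assoc d' c
    simp only [Bundle.comp_app, LinearMap.comp_apply, tensMap_mk]
    rw [assocIso_mk c d d' c', assocIso_mk c d d' c', tensMap_mk, tensMap_mk]
  leftUnitor_naturality f := by
    ext z : 1
    refine left_ext fun x c P hP v => ?_
    simp only [Bundle.comp_app, LinearMap.comp_apply, tensMap_mk, Bundle.id_app,
      LinearMap.id_apply]
    rw [leftIso_mk, leftIso_mk, map_smul]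
  rightUnitor_naturality f := by
    ext z : 1
    refine right_ext fun x c P hP v => ?_
    simp only [Bundle.comp_app, LinearMap.comp_apply, tensMap_mk, Bundle.id_app,
      LinearMap.id_apply]
    rw [rightIso_mk, rightIso_mk, map_smul]
  pentagon V W U S := by
    ext z : 1
    refine tens_ext' fun q s e t => ?_
    refine tens_ext₃ fun p u c x y d v w m => ?_
    have yu := isComp_comp y u (d.tgt.symm.trans c.mid)
    have us := isComp_comp u s (c.tgt.symm.trans e.mid)
    have x_yu := d.assoc yu c
    have yu_s := isComp_comp _ s (yu.tgt.trans us.mid)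
    have x_yus := x_yu.assoc yu_s e
    have y_us := yu.assoc us yu_s
    have xy_us := c.assoc us e
    have x_yus' := d.assoc y_us xy_us
    simp only [Bundle.comp_app, LinearMap.comp_apply, LinearMap.flip_apply, tensMap_mk]
    rw [assocIso_mk c d yu x_yu, assocIso_mk e x_yu yu_s x_yus, tensMap_mk,
      assocIso_mk yu_s yu us y_us, assocIso_mk e c us xy_us, assocIso_mk xy_us d y_us x_yus]
    rfl
  triangle V W := by
    ext z : 1
    refine tens_ext' fun q s e t => ?_
    refine right_ext fun x c P hP v => ?_
    subst hP
    obtain rfl : T.hor.src s = P := by rw [← e.mid, c.mid, T.hor.src_one]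
    simp only [Bundle.comp_app, LinearMap.comp_apply, LinearMap.flip_apply, tensMap_mk]
    rw [assocIso_mk e c (isComp_one_left s) e, tensMap_mk, leftIso_mk, rightIso_mk]
    simp

/-- The dual bundle: `(V^*)_x = (V_{x⁻¹})^*`, on which a box `A` acts by the transpose of
`A⁻¹`. -/
def dual (V : TBund k T) : TBund k T where
  fib x := Module.Dual k (V.fib (T.hor.inv x))
  act A {a b} h h' := Module.Dual.transpose (R := k) (V.act (T.boxInv A)
    (by rw [src_boxInv, h']) (by rw [tgt_boxInv, h]))
  act_one x h h' := by
    ext φ v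
    have e := V.act_one (T.hor.inv x) (T.vert.src_one _) (T.vert.tgt_one _)
    simp only [Module.Dual.transpose_apply, boxInv_vone, LinearMap.comp_apply, e]
    rfl
  act_comp {f g} p {a b c} h₁ h₂ h₃ h₄ h₅ h₆ := by
    ext φ v
    simp only [Module.Dual.transpose_apply, LinearMap.comp_apply]
    rw [V.act_isComp (isComp_boxInv (isComp_comp f g p))]

end

end TBund

/-- A weak bialgebra: an algebra and coalgebra `A` such that `Δ` is multiplicative,
`Δ²(1) = (Δ(1) ⊗ 1)(1 ⊗ Δ(1)) = (1 ⊗ Δ(1))(Δ(1) ⊗ 1)` and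
`ε(abc) = ε(a b₁) ε(b₂ c) = ε(a b₂) ε(b₁ c)`. -/
class WeakBialgebra (k A : Type u) [Field k] [Ring A] [Algebra k A] [Coalgebra k A] : Prop where
  comul_mul : ∀ a b : A,
    Coalgebra.comul (R := k) (a * b) = Coalgebra.comul (R := k) a * Coalgebra.comul (R := k) b
  comul_one_left :
    (Coalgebra.comul (R := k) (A := A)).rTensor A (Coalgebra.comul (R := k) 1) =
      (Coalgebra.comul (R := k) (1 : A) ⊗ₜ[k] (1 : A)) *
        (TensorProduct.assoc k A A A).symm ((1 : A) ⊗ₜ[k] Coalgebra.comul (R := k) (1 : A))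
  comul_one_right :
    (Coalgebra.comul (R := k) (A := A)).rTensor A (Coalgebra.comul (R := k) 1) =
      (TensorProduct.assoc k A A A).symm ((1 : A) ⊗ₜ[k] Coalgebra.comul (R := k) (1 : A)) *
        (Coalgebra.comul (R := k) (1 : A) ⊗ₜ[k] (1 : A))
  counit_mul_left : ∀ a b c : A, Coalgebra.counit (R := k) (a * b * c) =
    LinearMap.mul' k k (TensorProduct.map
      (Coalgebra.counit (R := k) (A := A) ∘ₗ LinearMap.mulLeft k a)
      (Coalgebra.counit (R := k) (A := A) ∘ₗ LinearMap.mulRight k c)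
      (Coalgebra.comul (R := k) b))
  counit_mul_right : ∀ a b c : A, Coalgebra.counit (R := k) (a * b * c) =
    LinearMap.mul' k k (TensorProduct.map
      (Coalgebra.counit (R := k) (A := A) ∘ₗ LinearMap.mulRight k c)
      (Coalgebra.counit (R := k) (A := A) ∘ₗ LinearMap.mulLeft k a)
      (Coalgebra.comul (R := k) b))

namespace WeakBialgebra

noncomputable section

open Coalgebra

variable (k A : Type u) [Field k] [Ring A] [Algebra k A] [Coalgebra k A]

/-- The target map `ε_t(h) = (ε ⊗ id)(Δ(1)(h ⊗ 1))`. -/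
def epsT : A →ₗ[k] A :=
  (TensorProduct.lid k A).toLinearMap ∘ₗ (counit (R := k) (A := A)).rTensor A ∘ₗ
    LinearMap.mulLeft k (comul (R := k) (1 : A)) ∘ₗ (TensorProduct.mk k A A).flip 1

/-- The map `z ↦ (id ⊗ ε)(Δ(1)(1 ⊗ z))`. -/
def sig : A →ₗ[k] A :=
  (TensorProduct.rid k A).toLinearMap ∘ₗ (counit (R := k) (A := A)).lTensor A ∘ₗ
    LinearMap.mulLeft k (comul (R := k) (1 : A)) ∘ₗ TensorProduct.mk k A A 1

/-- The target subalgebra `A_t`, the image of `ε_t`. -/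
abbrev targetSub : Submodule k A := LinearMap.range (epsT k A)

/-- The target map with values in `A_t`. -/
def epsTR : A →ₗ[k] targetSub k A := (epsT k A).rangeRestrict

variable {k A}

theorem coe_epsTR (h : A) : (epsTR k A h : A) = epsT k A h := rfl

/-- The map `a ⊗ b ↦ ε(a g) b`. -/
def ctrL (g : A) : A ⊗[k] A →ₗ[k] A :=
  (TensorProduct.lid k A).toLinearMap ∘ₗ
    (counit (R := k) (A := A) ∘ₗ LinearMap.mulRight k g).rTensor A

/-- The map `a ⊗ b ↦ ε(b g) a`. -/
def ctrR (g : A) : A ⊗[k] A →ₗ[k] A :=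
  (TensorProduct.rid k A).toLinearMap ∘ₗ
    (counit (R := k) (A := A) ∘ₗ LinearMap.mulRight k g).lTensor A

@[simp] theorem ctrL_tmul (g a b : A) : ctrL (k := k) g (a ⊗ₜ b) = counit (R := k) (a * g) • b := by
  simp [ctrL]

@[simp] theorem ctrR_tmul (g a b : A) : ctrR (k := k) g (a ⊗ₜ b) = counit (R := k) (b * g) • a := by
  simp [ctrR]

theorem ctrL_one_comul (h : A) : ctrL (k := k) 1 (comul (R := k) h) = h := by
  have := rTensor_counit_comul (R := k) h
  have e : ctrL (k := k) (1 : A) =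
      (TensorProduct.lid k A).toLinearMap ∘ₗ (counit (R := k) (A := A)).rTensor A := by
    ext; simp
  rw [e, LinearMap.comp_apply, this]; simp

theorem ctrR_one_comul (h : A) : ctrR (k := k) 1 (comul (R := k) h) = h := by
  have := lTensor_counit_comul (R := k) h
  have e : ctrR (k := k) (1 : A) =
      (TensorProduct.rid k A).toLinearMap ∘ₗ (counit (R := k) (A := A)).lTensor A := by
    ext; simp
  rw [e, LinearMap.comp_apply, this]; simp

/-- The index set of a chosen expression of `Δ(1)` as a sum of pure tensors. -/
def idx (k A : Type u) [Field k] [Ring A] [Algebra k A] [Coalgebra k A] : Finset (A × A) :=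
  (TensorProduct.exists_finset (R := k) (comul (R := k) (1 : A))).choose

/-- The left factors of the chosen expression of `Δ(1)`. -/
def lf (i : A × A) : A := i.1

/-- The right factors of the chosen expression of `Δ(1)`. -/
def rf (i : A × A) : A := i.2

theorem sum_lf_rf : ∑ i ∈ idx k A, lf i ⊗ₜ[k] rf i = comul (R := k) (1 : A) :=
  (TensorProduct.exists_finset (R := k) (comul (R := k) (1 : A))).choose_spec.symm

theorem epsT_eq (h : A) :
    epsT k A h = ∑ i ∈ idx k A, counit (R := k) (lf i * h) • rf i := by
  simp [epsT, ← sum_lf_rf, Finset.sum_mul]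

theorem sig_eq (h : A) :
    sig k A h = ∑ i ∈ idx k A, counit (R := k) (rf i * h) • lf i := by
  simp [sig, ← sum_lf_rf, Finset.sum_mul]

theorem epsT_one : epsT k A 1 = 1 := by
  conv_rhs => rw [← ctrL_one_comul (k := k) (1 : A)]
  rw [epsT_eq, ← sum_lf_rf]
  simp

theorem sig_one : sig k A 1 = 1 := by
  conv_rhs => rw [← ctrR_one_comul (k := k) (1 : A)]
  rw [sig_eq, ← sum_lf_rf]
  simp

theorem triple_coassoc {M : Type u} [AddCommMonoid M] [Module k M]
    (Φ : A ⊗[k] (A ⊗[k] A) →ₗ[k] M) :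
    ∑ i ∈ idx k A, Φ (lf i ⊗ₜ comul (R := k) (rf i)) =
      ∑ i ∈ idx k A,
        Φ (TensorProduct.assoc k A A A (comul (R := k) (lf i) ⊗ₜ rf i)) := by
  have h := coassoc_apply (R := k) (1 : A)
  rw [← sum_lf_rf] at h
  simp only [map_sum, LinearMap.rTensor_tmul, LinearMap.lTensor_tmul] at h
  rw [← map_sum, ← map_sum, h]

variable [WeakBialgebra k A]

theorem comul_mul_one (h : A) :
    comul (R := k) h * comul (R := k) (1 : A) = comul (R := k) h := by
  rw [← comul_mul, mul_one]

theorem comul_one_mul (h : A) :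
    comul (R := k) (1 : A) * comul (R := k) h = comul (R := k) h := by
  rw [← comul_mul, one_mul]

theorem counit_mul_l (x y : A) : counit (R := k) (x * y) =
    ∑ i ∈ idx k A, counit (R := k) (x * lf i) * counit (R := k) (rf i * y) := by
  have := counit_mul_left (k := k) x 1 y
  rw [mul_one, ← sum_lf_rf] at this
  simpa only [map_sum, TensorProduct.map_tmul, LinearMap.mul'_apply, LinearMap.comp_apply,
    LinearMap.mulLeft_apply, LinearMap.mulRight_apply] using this

theorem counit_mul_r (x y : A) : counit (R := k) (x * y) =
    ∑ i ∈ idx k A, counit (R := k) (x * rf i) * counit (R := k) (lf i * y) := by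
  have := counit_mul_right (k := k) x 1 y
  rw [mul_one, ← sum_lf_rf] at this
  rw [this]
  simp only [map_sum, TensorProduct.map_tmul, LinearMap.mul'_apply, LinearMap.comp_apply,
    LinearMap.mulLeft_apply, LinearMap.mulRight_apply]
  exact Finset.sum_congr rfl fun _ _ => mul_comm _ _

theorem counit_mul_epsT (x g : A) :
    counit (R := k) (x * epsT k A g) = counit (R := k) (x * g) := by
  rw [counit_mul_r x g, epsT_eq]
  simp [Finset.mul_sum, mul_comm]

theorem epsT_mul_epsT (h g : A) : epsT k A (h * epsT k A g) = epsT k A (h * g) := by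
  rw [epsT_eq, epsT_eq (h * g)]
  simp only [← mul_assoc, counit_mul_epsT]

theorem epsT_epsT (g : A) : epsT k A (epsT k A g) = epsT k A g := by
  simpa using epsT_mul_epsT (k := k) 1 g

theorem sig_epsT (g : A) : sig k A (epsT k A g) = sig k A g := by
  simp only [sig_eq, counit_mul_epsT]

section Triple

variable {M : Type u} [AddCommMonoid M] [Module k M]

theorem triple_left (Φ : A ⊗[k] (A ⊗[k] A) →ₗ[k] M) :
    ∑ i ∈ idx k A, Φ (lf i ⊗ₜ comul (R := k) (rf i)) =
      ∑ i ∈ idx k A, ∑ j ∈ idx k A,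
        Φ (lf i ⊗ₜ ((rf i * lf j) ⊗ₜ rf j)) := by
  rw [triple_coassoc]
  have h := comul_one_left (k := k) (A := A)
  rw [← sum_lf_rf] at h
  simp only [map_sum, LinearMap.rTensor_tmul, TensorProduct.tmul_sum, TensorProduct.sum_tmul,
    TensorProduct.assoc_symm_tmul, Finset.sum_mul, Finset.mul_sum,
    Algebra.TensorProduct.tmul_mul_tmul, mul_one, one_mul] at h
  rw [← map_sum, ← map_sum, h]
  simp only [map_sum, TensorProduct.assoc_tmul]
  try rw [Finset.sum_comm]

theorem triple_right (Φ : A ⊗[k] (A ⊗[k] A) →ₗ[k] M) :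
    ∑ i ∈ idx k A, Φ (lf i ⊗ₜ comul (R := k) (rf i)) =
      ∑ i ∈ idx k A, ∑ j ∈ idx k A,
        Φ (lf i ⊗ₜ ((lf j * rf i) ⊗ₜ rf j)) := by
  rw [triple_coassoc]
  have h := comul_one_right (k := k) (A := A)
  rw [← sum_lf_rf] at h
  simp only [map_sum, LinearMap.rTensor_tmul, TensorProduct.tmul_sum, TensorProduct.sum_tmul,
    TensorProduct.assoc_symm_tmul, Finset.sum_mul, Finset.mul_sum,
    Algebra.TensorProduct.tmul_mul_tmul, mul_one, one_mul] at h
  rw [← map_sum, ← map_sum, h]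
  simp only [map_sum, TensorProduct.assoc_tmul]
  try rw [Finset.sum_comm]

end Triple

/-- `h ε_t(g) = ε(h₁ g) h₂`. -/
theorem mul_epsT (h g : A) : h * epsT k A g = ctrL (k := k) g (comul (R := k) h) := by
  have key := triple_right (k := k) ((TensorProduct.lid k A).toLinearMap ∘ₗ TensorProduct.map
    (counit (R := k) (A := A) ∘ₗ LinearMap.mulRight k g)
    (ctrL (k := k) 1 ∘ₗ LinearMap.mulLeft k (comul (R := k) h)))
  simp only [LinearMap.comp_apply, TensorProduct.map_tmul, LinearMap.mulLeft_apply,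
    LinearMap.mulRight_apply, ← comul_mul, ctrL_one_comul, LinearEquiv.coe_coe,
    TensorProduct.lid_tmul] at key
  have e : ∀ i j : A × A, comul (R := k) h * ((lf j * rf i) ⊗ₜ rf j) =
      comul (R := k) h * (lf j ⊗ₜ rf j) * (rf i ⊗ₜ 1) := by
    intro i j
    rw [mul_assoc, Algebra.TensorProduct.tmul_mul_tmul, mul_one]
  simp only [e, ← Finset.smul_sum, ← map_sum, ← Finset.sum_mul] at key
  simp only [← Finset.mul_sum, sum_lf_rf, comul_mul_one] at key
  rw [epsT_eq, Finset.mul_sum]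
  simp only [mul_smul_comm]
  rw [key]
  generalize comul (R := k) h = X
  induction X with
  | zero => simp
  | add x y hx hy => simp only [add_mul, map_add, smul_add, Finset.sum_add_distrib, hx, hy]
  | tmul a b =>
    simp only [Algebra.TensorProduct.tmul_mul_tmul, ctrL_tmul, mul_one]
    rw [counit_mul_r a g, Finset.sum_smul]
    simp only [smul_smul, mul_comm]

/-- `h σ(g) = ε(h₂ g) h₁`. -/
theorem mul_sig (h g : A) : h * sig k A g = ctrR (k := k) g (comul (R := k) h) := by
  have key := triple_left (k := k) ((TensorProduct.rid k A).toLinearMap ∘ₗ TensorProduct.map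
    (ctrR (k := k) 1 ∘ₗ LinearMap.mulLeft k (comul (R := k) h))
    (counit (R := k) (A := A) ∘ₗ LinearMap.mulRight k g) ∘ₗ
      (TensorProduct.assoc k A A A).symm.toLinearMap)
  rw [triple_coassoc] at key
  simp only [LinearMap.comp_apply, TensorProduct.map_tmul, LinearMap.mulLeft_apply,
    LinearMap.mulRight_apply, LinearEquiv.coe_coe, LinearEquiv.symm_apply_apply,
    TensorProduct.assoc_symm_tmul, ← comul_mul, ctrR_one_comul,
    TensorProduct.rid_tmul] at key
  have e : ∀ i j : A × A, comul (R := k) h * (lf i ⊗ₜ (rf i * lf j)) =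
      comul (R := k) h * (lf i ⊗ₜ rf i) * (1 ⊗ₜ lf j) := by
    intro i j
    rw [mul_assoc, Algebra.TensorProduct.tmul_mul_tmul, mul_one]
  rw [Finset.sum_comm] at key
  simp only [e, ← Finset.smul_sum, ← map_sum, ← Finset.sum_mul] at key
  simp only [← Finset.mul_sum, sum_lf_rf, comul_mul_one] at key
  rw [sig_eq, Finset.mul_sum]
  simp only [mul_smul_comm]
  rw [key]
  generalize comul (R := k) h = X
  induction X with
  | zero => simp
  | add x y hx hy => simp only [add_mul, map_add, smul_add, Finset.sum_add_distrib, hx, hy]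
  | tmul a b =>
    simp only [Algebra.TensorProduct.tmul_mul_tmul, ctrR_tmul, mul_one]
    rw [counit_mul_l b g, Finset.sum_smul]
    simp only [smul_smul, mul_comm]

theorem mul_target (h : A) {z : A} (hz : z ∈ targetSub k A) :
    h * z = ctrL (k := k) z (comul (R := k) h) := by
  obtain ⟨g, rfl⟩ := hz
  rw [mul_epsT]
  congr 1
  apply TensorProduct.ext'
  intro a b
  simp [counit_mul_epsT]

/-- `ε_t(h₁ z) h₂ = h z` for `z ∈ A_t`. -/
theorem target_mul (h : A) {z : A} (hz : z ∈ targetSub k A) :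
    LinearMap.mul' k A (TensorProduct.map (epsT k A ∘ₗ LinearMap.mulRight k z) LinearMap.id
      (comul (R := k) h)) = h * z := by
  have e : ∀ X : A ⊗[k] A, LinearMap.mul' k A
      (TensorProduct.map (epsT k A ∘ₗ LinearMap.mulRight k z) LinearMap.id X) =
        ctrL (k := k) z (comul (R := k) 1 * X) := by
    intro X
    induction X with
    | zero => simp
    | add x y hx hy => simp only [mul_add, map_add, hx, hy]
    | tmul a b =>
      rw [← sum_lf_rf]
      simp [epsT_eq, Finset.sum_mul, mul_assoc]
  rw [e, comul_one_mul, mul_target h hz]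

/-- `σ(h₂ z) h₁ = h σ(z)`. -/
theorem sig_mul (h z : A) :
    LinearMap.mul' k A (TensorProduct.comm k A A (TensorProduct.map LinearMap.id
      (sig k A ∘ₗ LinearMap.mulRight k z) (comul (R := k) h))) = h * sig k A z := by
  have e : ∀ X : A ⊗[k] A, LinearMap.mul' k A (TensorProduct.comm k A A
      (TensorProduct.map LinearMap.id (sig k A ∘ₗ LinearMap.mulRight k z) X)) =
        ctrR (k := k) z (comul (R := k) 1 * X) := by
    intro X
    induction X with
    | zero => simp
    | add x y hx hy => simp only [mul_add, map_add, hx, hy]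
    | tmul a b =>
      rw [← sum_lf_rf]
      simp [sig_eq, Finset.sum_mul, mul_assoc]
  rw [e, comul_one_mul, mul_sig]

/-- `ε_t(1₁) ⊗ 1₂ z = ε_t(1₁ z) ⊗ 1₂` for `z ∈ A_t`. -/
theorem target_left {z : A} (hz : z ∈ targetSub k A) :
    TensorProduct.map (epsTR k A) LinearMap.id (comul (R := k) 1 * (1 ⊗ₜ z)) =
      TensorProduct.map (epsTR k A) LinearMap.id (comul (R := k) 1 * (z ⊗ₜ[k] (1 : A))) := by
  have key := triple_left (k := k) (TensorProduct.map (epsTR k A) (ctrL (k := k) z))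
  simp only [TensorProduct.map_tmul, ← mul_target _ hz, ctrL_tmul, TensorProduct.tmul_smul] at key
  rw [← sum_lf_rf]
  simp only [Finset.sum_mul, map_sum, Algebra.TensorProduct.tmul_mul_tmul, mul_one,
    TensorProduct.map_tmul, LinearMap.id_apply]
  rw [key, Finset.sum_comm]
  refine Finset.sum_congr rfl fun j _ => ?_
  simp only [TensorProduct.smul_tmul', ← TensorProduct.sum_tmul]
  congr 1
  apply Subtype.ext
  simp only [AddSubmonoidClass.coe_finsetSum, Submodule.coe_smul, coe_epsTR, epsT_eq,
    Finset.smul_sum]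
  rw [Finset.sum_comm]
  refine Finset.sum_congr rfl fun l _ => ?_
  rw [counit_mul_l, Finset.sum_smul]
  refine Finset.sum_congr rfl fun i _ => ?_
  rw [smul_smul, mul_comm, mul_assoc]

/-- `1₁ σ(z) ⊗ ε_t(1₂) = 1₁ ⊗ ε_t(1₂ z)`. -/
theorem target_right (z : A) :
    TensorProduct.map LinearMap.id (epsTR k A) (comul (R := k) 1 * (sig k A z ⊗ₜ[k] (1 : A))) =
      TensorProduct.map LinearMap.id (epsTR k A) (comul (R := k) 1 * ((1 : A) ⊗ₜ z)) := by
  have key := triple_right (k := k) (TensorProduct.map (ctrR (k := k) z) (epsTR k A) ∘ₗ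
    (TensorProduct.assoc k A A A).symm.toLinearMap)
  rw [triple_coassoc] at key
  simp only [LinearMap.comp_apply, LinearEquiv.coe_coe, LinearEquiv.symm_apply_apply,
    TensorProduct.assoc_symm_tmul, TensorProduct.map_tmul, ← mul_sig, ctrR_tmul,
    TensorProduct.smul_tmul] at key
  rw [← sum_lf_rf]
  simp only [Finset.sum_mul, map_sum, Algebra.TensorProduct.tmul_mul_tmul, mul_one,
    TensorProduct.map_tmul, LinearMap.id_apply]
  rw [key]
  refine Finset.sum_congr rfl fun j _ => ?_
  simp only [← TensorProduct.tmul_sum]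
  congr 1
  apply Subtype.ext
  simp only [AddSubmonoidClass.coe_finsetSum, Submodule.coe_smul, coe_epsTR]
  rw [← epsT_epsT (k := k) (rf j * z), epsT_eq (rf j * z), map_sum]
  simp only [map_smul, mul_assoc]

/-- `1₁ σ(z) ⊗ 1₂ = 1₁ ⊗ 1₂ z` for `z ∈ A_t`. -/
theorem target_mid {z : A} (hz : z ∈ targetSub k A) :
    comul (R := k) 1 * (sig k A z ⊗ₜ[k] (1 : A)) = comul (R := k) 1 * ((1 : A) ⊗ₜ z) := by
  have key := triple_coassoc (k := k) (TensorProduct.map LinearMap.id (ctrL (k := k) z))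
  simp only [TensorProduct.map_tmul, ← mul_target _ hz, LinearMap.id_apply] at key
  have e : TensorProduct.map LinearMap.id (ctrL (k := k) z) ∘ₗ
      (TensorProduct.assoc k A A A).toLinearMap =
        TensorProduct.map (ctrR (k := k) z) LinearMap.id := by
    ext a b c
    simp [TensorProduct.smul_tmul]
  have e' : ∀ i, TensorProduct.map LinearMap.id (ctrL (k := k) z) (TensorProduct.assoc k A A A
      (comul (R := k) (lf i) ⊗ₜ rf i)) = (lf i * sig k A z) ⊗ₜ rf i := by
    intro i
    rw [mul_sig]
    exact LinearMap.congr_fun e _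
  simp only [e'] at key
  rw [← sum_lf_rf]
  simp only [Finset.sum_mul, Algebra.TensorProduct.tmul_mul_tmul, mul_one]
  exact key.symm

end

end WeakBialgebra

/-- A finite-dimensional representation of a `k`-algebra `A`. -/
structure FDRepr (k A : Type u) [Field k] [Ring A] [Algebra k A] where
  carrier : Type u
  [addCommGroup : AddCommGroup carrier]
  [module : Module k carrier]
  [finite : FiniteDimensional k carrier]
  ρ : A →ₐ[k] Module.End k carrier

namespace FDRepr

attribute [instance] FDRepr.addCommGroup FDRepr.module FDRepr.finite

section Cat

variable {k A : Type u} [Field k] [Ring A] [Algebra k A]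

/-- A morphism of representations. -/
@[ext]
structure Hom (V W : FDRepr k A) where
  lin : V.carrier →ₗ[k] W.carrier
  comm : ∀ (a : A) (v : V.carrier), lin (V.ρ a v) = W.ρ a (lin v)

instance : Category (FDRepr k A) where
  Hom := Hom
  id V := ⟨LinearMap.id, fun _ _ => rfl⟩
  comp f g := ⟨g.lin ∘ₗ f.lin, fun a v => by simp [f.comm, g.comm]⟩

variable {U V W : FDRepr k A}

@[ext]
theorem hom_ext {f g : V ⟶ W} (h : f.lin = g.lin) : f = g := Hom.ext h

@[simp] theorem id_lin : Hom.lin (𝟙 V) = LinearMap.id := rfl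
@[simp] theorem comp_lin (f : U ⟶ V) (g : V ⟶ W) : Hom.lin (f ≫ g) = g.lin ∘ₗ f.lin := rfl

instance : Add (V ⟶ W) := ⟨fun f g => ⟨f.lin + g.lin, fun a v => by simp [f.comm, g.comm]⟩⟩
instance : Zero (V ⟶ W) := ⟨⟨0, fun a v => by simp⟩⟩
instance : Neg (V ⟶ W) := ⟨fun f => ⟨-f.lin, fun a v => by simp [f.comm]⟩⟩
instance : Sub (V ⟶ W) := ⟨fun f g => ⟨f.lin - g.lin, fun a v => by simp [f.comm, g.comm]⟩⟩
instance : SMul ℕ (V ⟶ W) := ⟨fun n f => ⟨n • f.lin, fun a v => by simp [f.comm]⟩⟩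
instance : SMul ℤ (V ⟶ W) := ⟨fun n f => ⟨n • f.lin, fun a v => by simp [f.comm]⟩⟩
instance : SMul k (V ⟶ W) := ⟨fun c f => ⟨c • f.lin, fun a v => by simp [f.comm]⟩⟩

theorem lin_injective :
    Function.Injective (fun (f : V ⟶ W) => (f.lin : V.carrier →ₗ[k] W.carrier)) :=
  fun _ _ h => Hom.ext h

instance : AddCommGroup (V ⟶ W) :=
  lin_injective.addCommGroup _ rfl (fun _ _ => rfl) (fun _ => rfl) (fun _ _ => rfl)
    (fun _ _ => rfl) (fun _ _ => rfl)

@[simp] theorem add_lin (f g : V ⟶ W) : Hom.lin (f + g) = f.lin + g.lin := rfl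
@[simp] theorem smul_lin (c : k) (f : V ⟶ W) : Hom.lin (c • f) = c • f.lin := rfl

instance : Module k (V ⟶ W) :=
  lin_injective.module k ⟨⟨_, rfl⟩, fun _ _ => rfl⟩ (fun _ _ => rfl)

instance : Preadditive (FDRepr k A) where
  add_comp := by intros; ext; simp
  comp_add := by intros; ext; simp

instance : Linear k (FDRepr k A) where
  smul_comp := by intros; ext; simp
  comp_smul := by intros; ext; simp

/-- Build an isomorphism of representations from a morphism with a linear inverse. -/
def isoMk (f : V ⟶ W) (g : W.carrier →ₗ[k] V.carrier)
    (h₁ : ∀ v, g (f.lin v) = v) (h₂ : ∀ w, f.lin (g w) = w) : V ≅ W where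
  hom := f
  inv := ⟨g, fun a w => by rw [← h₁ (V.ρ a (g w)), f.comm, h₂]⟩
  hom_inv_id := by ext v; exact h₁ v
  inv_hom_id := by ext w; exact h₂ w

@[simp] theorem isoMk_hom (f : V ⟶ W) (g : W.carrier →ₗ[k] V.carrier)
    (h₁ : ∀ v, g (f.lin v) = v) (h₂ : ∀ w, f.lin (g w) = w) : (isoMk f g h₁ h₂).hom = f := rfl

end Cat

noncomputable section

open Coalgebra WeakBialgebra

variable {k A : Type u} [Field k] [Ring A] [Algebra k A]

/-- The action of `A ⊗ A` on `V ⊗ W`. -/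
def act₂ (V W : FDRepr k A) : A ⊗[k] A →ₐ[k] Module.End k (V.carrier ⊗[k] W.carrier) :=
  (Module.endTensorEndAlgHom (R := k) (S := k) (A := k) (M := V.carrier) (N := W.carrier)).comp
    (Algebra.TensorProduct.map V.ρ W.ρ)

@[simp]
theorem act₂_tmul (V W : FDRepr k A) (a b : A) :
    act₂ V W (a ⊗ₜ b) = TensorProduct.map (V.ρ a) (W.ρ b) := rfl

theorem act₂_natural {V W V' W' : FDRepr k A} (f : V ⟶ V') (g : W ⟶ W') (X : A ⊗[k] A)
    (t : V.carrier ⊗[k] W.carrier) :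
    TensorProduct.map f.lin g.lin (act₂ V W X t) =
      act₂ V' W' X (TensorProduct.map f.lin g.lin t) := by
  induction X with
  | zero => simp
  | add x y hx hy => simp only [map_add, LinearMap.add_apply, hx, hy]
  | tmul a b =>
    induction t with
    | zero => simp
    | add x y hx hy => simp only [map_add, hx, hy]
    | tmul v w => simp [f.comm, g.comm]

section Triple

variable {U V W : FDRepr k A}

variable (U V W) in
/-- The action of `(A ⊗ A) ⊗ A` on `(V ⊗ W) ⊗ U`. -/
def act₃L : (A ⊗[k] A) ⊗[k] A →ₐ[k]
    Module.End k ((V.carrier ⊗[k] W.carrier) ⊗[k] U.carrier) :=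
  (Module.endTensorEndAlgHom (R := k) (S := k) (A := k)
    (M := V.carrier ⊗[k] W.carrier) (N := U.carrier)).comp
      (Algebra.TensorProduct.map (act₂ V W) U.ρ)

variable (U V W) in
/-- The action of `A ⊗ (A ⊗ A)` on `V ⊗ (W ⊗ U)`. -/
def act₃R : A ⊗[k] (A ⊗[k] A) →ₐ[k]
    Module.End k (V.carrier ⊗[k] (W.carrier ⊗[k] U.carrier)) :=
  (Module.endTensorEndAlgHom (R := k) (S := k) (A := k)
    (M := V.carrier) (N := W.carrier ⊗[k] U.carrier)).comp
      (Algebra.TensorProduct.map V.ρ (act₂ W U))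

theorem act₃L_tmul (X : A ⊗[k] A) (a : A) (t : V.carrier ⊗[k] W.carrier) (u : U.carrier) :
    act₃L U V W (X ⊗ₜ a) (t ⊗ₜ u) = act₂ V W X t ⊗ₜ U.ρ a u := rfl

theorem act₃R_tmul (X : A ⊗[k] A) (a : A) (t : W.carrier ⊗[k] U.carrier) (v : V.carrier) :
    act₃R U V W (a ⊗ₜ X) (v ⊗ₜ t) = V.ρ a v ⊗ₜ act₂ W U X t := rfl

theorem assoc_act₃L (X : (A ⊗[k] A) ⊗[k] A)
    (t : (V.carrier ⊗[k] W.carrier) ⊗[k] U.carrier) :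
    TensorProduct.assoc k _ _ _ (act₃L U V W X t) =
      act₃R U V W (TensorProduct.assoc k A A A X) (TensorProduct.assoc k _ _ _ t) := by
  induction X with
  | zero => simp
  | add x y hx hy => simp only [map_add, LinearMap.add_apply, hx, hy]
  | tmul Y c =>
    induction Y with
    | zero => simp
    | add x y hx hy =>
      simp only [TensorProduct.add_tmul, map_add, LinearMap.add_apply, hx, hy]
    | tmul a b =>
      induction t with
      | zero => simp
      | add x y hx hy => simp only [map_add, hx, hy]
      | tmul s u =>
        induction s with
        | zero => simp
        | add x y hx hy => simp only [TensorProduct.add_tmul, map_add, hx, hy]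
        | tmul v w => simp [act₃L_tmul, act₃R_tmul]

end Triple

variable [Coalgebra k A]

/-- The underlying space of the tensor product of two representations: the subspace
`Δ(1)·(V ⊗ W)` of `V ⊗ W`. -/
abbrev tensCarrier (V W : FDRepr k A) : Submodule k (V.carrier ⊗[k] W.carrier) :=
  LinearMap.range (act₂ V W (comul (R := k) (1 : A)))

/-- The projection `V ⊗ W → Δ(1)·(V ⊗ W)`. -/
def prj (V W : FDRepr k A) : V.carrier ⊗[k] W.carrier →ₗ[k] tensCarrier V W :=
  LinearMap.rangeRestrict _

theorem coe_prj (V W : FDRepr k A) (t : V.carrier ⊗[k] W.carrier) :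
    (prj V W t : V.carrier ⊗[k] W.carrier) = act₂ V W (comul (R := k) (1 : A)) t := rfl

variable [WeakBialgebra k A]

theorem act₂_comul_one_mul (V W : FDRepr k A) (h : A) (t : V.carrier ⊗[k] W.carrier) :
    act₂ V W (comul (R := k) (1 : A)) (act₂ V W (comul (R := k) h) t) =
      act₂ V W (comul (R := k) h) t := by
  rw [← Module.End.mul_apply, ← map_mul, comul_one_mul]

theorem act₂_comul_mul_one (V W : FDRepr k A) (h : A) (t : V.carrier ⊗[k] W.carrier) :
    act₂ V W (comul (R := k) h) (act₂ V W (comul (R := k) (1 : A)) t) =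
      act₂ V W (comul (R := k) h) t := by
  rw [← Module.End.mul_apply, ← map_mul, comul_mul_one]

theorem act₂_coe {V W : FDRepr k A} (t : tensCarrier V W) :
    act₂ V W (comul (R := k) (1 : A)) (t : V.carrier ⊗[k] W.carrier) = t := by
  obtain ⟨_, s, rfl⟩ := t
  exact act₂_comul_one_mul V W 1 s

theorem prj_coe {V W : FDRepr k A} (t : tensCarrier V W) : prj V W t = t :=
  Subtype.ext (act₂_coe t)

/-- The tensor product of two representations: `Δ(1)·(V ⊗ W)`, with `A` acting via `Δ`. -/
def tens (V W : FDRepr k A) : FDRepr k A where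
  carrier := tensCarrier V W
  ρ := AlgHom.ofLinearMap
    { toFun := fun h => prj V W ∘ₗ act₂ V W (comul (R := k) h) ∘ₗ (tensCarrier V W).subtype
      map_add' := fun a b => by ext t : 1; simp
      map_smul' := fun a b => by ext t : 1; simp }
    (by
      ext t : 1
      exact (congrArg (prj V W) (act₂_coe t)).trans (prj_coe t))
    (fun a b => by
      ext t : 1
      apply Subtype.ext
      simp only [LinearMap.coe_mk, AddHom.coe_mk, LinearMap.comp_apply, Module.End.mul_apply,
        coe_prj, Submodule.subtype_apply, act₂_comul_one_mul, comul_mul, map_mul])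

/-- The inclusion of the tensor product `Δ(1)·(V ⊗ W)` in `V ⊗ W`. -/
def inc (V W : FDRepr k A) : (tens V W).carrier →ₗ[k] V.carrier ⊗[k] W.carrier :=
  (tensCarrier V W).subtype

/-- The projection of `V ⊗ W` to the tensor product `Δ(1)·(V ⊗ W)`. -/
def pro (V W : FDRepr k A) : V.carrier ⊗[k] W.carrier →ₗ[k] (tens V W).carrier := prj V W

theorem inc_pro {V W : FDRepr k A} (t : V.carrier ⊗[k] W.carrier) :
    inc V W (pro V W t) = act₂ V W (comul (R := k) (1 : A)) t := rfl

@[simp] theorem pro_inc {V W : FDRepr k A} (t : (tens V W).carrier) :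
    pro V W (inc V W t) = t := prj_coe t

theorem inc_injective (V W : FDRepr k A) : Function.Injective (inc V W) :=
  Subtype.val_injective

theorem act₂_inc {V W : FDRepr k A} (t : (tens V W).carrier) :
    act₂ V W (comul (R := k) (1 : A)) (inc V W t) = inc V W t := act₂_coe t

theorem inc_ρ {V W : FDRepr k A} (h : A) (t : (tens V W).carrier) :
    inc V W ((tens V W).ρ h t) = act₂ V W (comul (R := k) h) (inc V W t) :=
  act₂_comul_one_mul V W h _

/-- The tensor product of two morphisms. -/
def tensMap {V V' W W' : FDRepr k A} (f : V ⟶ V') (g : W ⟶ W') : tens V W ⟶ tens V' W' where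
  lin := pro V' W' ∘ₗ TensorProduct.map f.lin g.lin ∘ₗ inc V W
  comm a t := by
    apply inc_injective
    simp only [LinearMap.comp_apply, inc_ρ, inc_pro, act₂_natural, act₂_comul_one_mul,
      act₂_comul_mul_one]

theorem inc_tensMap {V V' W W' : FDRepr k A} (f : V ⟶ V') (g : W ⟶ W') (t : (tens V W).carrier) :
    inc V' W' ((tensMap f g).lin t) = TensorProduct.map f.lin g.lin (inc V W t) := by
  change inc V' W' (pro V' W' (TensorProduct.map f.lin g.lin (inc V W t))) = _
  rw [inc_pro, ← act₂_natural, act₂_inc]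

section Assoc

variable (U V W : FDRepr k A)

/-- The inclusion of `(V ⊗ W) ⊗ U` (tensor products of representations) in the tensor product of
vector spaces. -/
def incL : (tens (tens V W) U).carrier →ₗ[k] (V.carrier ⊗[k] W.carrier) ⊗[k] U.carrier :=
  (inc V W).rTensor _ ∘ₗ inc (tens V W) U

/-- The inclusion of `V ⊗ (W ⊗ U)` (tensor products of representations) in the tensor product of
vector spaces. -/
def incR : (tens V (tens W U)).carrier →ₗ[k] V.carrier ⊗[k] (W.carrier ⊗[k] U.carrier) :=
  (inc W U).lTensor _ ∘ₗ inc V (tens W U)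

/-- The projection to `(V ⊗ W) ⊗ U`. -/
def proL : (V.carrier ⊗[k] W.carrier) ⊗[k] U.carrier →ₗ[k] (tens (tens V W) U).carrier :=
  pro (tens V W) U ∘ₗ (pro V W).rTensor _

/-- The projection to `V ⊗ (W ⊗ U)`. -/
def proR : V.carrier ⊗[k] (W.carrier ⊗[k] U.carrier) →ₗ[k] (tens V (tens W U)).carrier :=
  pro V (tens W U) ∘ₗ (pro W U).lTensor _

variable {U V W}

theorem pro_comp_inc : pro V W ∘ₗ inc V W = LinearMap.id := LinearMap.ext pro_inc

theorem proL_incL (t : (tens (tens V W) U).carrier) : proL U V W (incL U V W t) = t := by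
  simp only [proL, incL, LinearMap.comp_apply]
  rw [← LinearMap.rTensor_comp_apply, pro_comp_inc, LinearMap.rTensor_id_apply, pro_inc]

theorem proR_incR (t : (tens V (tens W U)).carrier) : proR U V W (incR U V W t) = t := by
  simp only [proR, incR, LinearMap.comp_apply]
  rw [← LinearMap.lTensor_comp_apply, pro_comp_inc, LinearMap.lTensor_id_apply, pro_inc]

theorem incL_injective : Function.Injective (incL U V W) :=
  Function.LeftInverse.injective proL_incL

theorem incR_injective : Function.Injective (incR U V W) :=
  Function.LeftInverse.injective proR_incR

theorem act₃L_inc (X : A ⊗[k] A) (t : (tens V W).carrier ⊗[k] U.carrier) :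
    (inc V W).rTensor _ (act₂ (tens V W) U X t) =
      act₃L U V W ((comul (R := k) (A := A)).rTensor A X) ((inc V W).rTensor _ t) := by
  induction X with
  | zero => simp
  | add x y hx hy => simp only [map_add, LinearMap.add_apply, hx, hy]
  | tmul a b =>
    induction t with
    | zero => simp
    | add x y hx hy => simp only [map_add, hx, hy]
    | tmul s u =>
      simp only [act₂_tmul, TensorProduct.map_tmul, LinearMap.rTensor_tmul, act₃L_tmul, inc_ρ]

theorem act₃R_inc (X : A ⊗[k] A) (t : V.carrier ⊗[k] (tens W U).carrier) :
    (inc W U).lTensor _ (act₂ V (tens W U) X t) =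
      act₃R U V W ((comul (R := k) (A := A)).lTensor A X) ((inc W U).lTensor _ t) := by
  induction X with
  | zero => simp
  | add x y hx hy => simp only [map_add, LinearMap.add_apply, hx, hy]
  | tmul a b =>
    induction t with
    | zero => simp
    | add x y hx hy => simp only [map_add, hx, hy]
    | tmul s u =>
      simp only [act₂_tmul, TensorProduct.map_tmul, LinearMap.lTensor_tmul, act₃R_tmul, inc_ρ]

theorem act₃L_absorb (X : A ⊗[k] A) (t : (V.carrier ⊗[k] W.carrier) ⊗[k] U.carrier) :
    act₃L U V W ((comul (R := k) (A := A)).rTensor A X)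
      ((inc V W).rTensor _ ((pro V W).rTensor _ t)) =
      act₃L U V W ((comul (R := k) (A := A)).rTensor A X) t := by
  induction X with
  | zero => simp
  | add x y hx hy => simp only [map_add, LinearMap.add_apply, hx, hy]
  | tmul a b =>
    induction t with
    | zero => simp
    | add x y hx hy => simp only [map_add, hx, hy]
    | tmul s u =>
      simp only [LinearMap.rTensor_tmul, act₃L_tmul, inc_pro, act₂_comul_mul_one]

theorem act₃R_absorb (X : A ⊗[k] A) (t : V.carrier ⊗[k] (W.carrier ⊗[k] U.carrier)) :
    act₃R U V W ((comul (R := k) (A := A)).lTensor A X)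
      ((inc W U).lTensor _ ((pro W U).lTensor _ t)) =
      act₃R U V W ((comul (R := k) (A := A)).lTensor A X) t := by
  induction X with
  | zero => simp
  | add x y hx hy => simp only [map_add, LinearMap.add_apply, hx, hy]
  | tmul a b =>
    induction t with
    | zero => simp
    | add x y hx hy => simp only [map_add, hx, hy]
    | tmul s u =>
      simp only [LinearMap.lTensor_tmul, act₃R_tmul, inc_pro, act₂_comul_mul_one]

theorem incL_proL (t : (V.carrier ⊗[k] W.carrier) ⊗[k] U.carrier) :
    incL U V W (proL U V W t) =
      act₃L U V W ((comul (R := k) (A := A)).rTensor A (comul (R := k) 1)) t := by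
  simp only [incL, proL, LinearMap.comp_apply, inc_pro, act₃L_inc, act₃L_absorb]

theorem incR_proR (t : V.carrier ⊗[k] (W.carrier ⊗[k] U.carrier)) :
    incR U V W (proR U V W t) =
      act₃R U V W ((comul (R := k) (A := A)).lTensor A (comul (R := k) 1)) t := by
  simp only [incR, proR, LinearMap.comp_apply, inc_pro, act₃R_inc, act₃R_absorb]

theorem assoc_incL_proL (t : (V.carrier ⊗[k] W.carrier) ⊗[k] U.carrier) :
    TensorProduct.assoc k _ _ _ (incL U V W (proL U V W t)) =
      incR U V W (proR U V W (TensorProduct.assoc k _ _ _ t)) := by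
  rw [incL_proL, assoc_act₃L, incR_proR, coassoc_apply]

variable (U V W) in
/-- The associativity map: the restriction of the associativity of tensor products of vector
spaces. -/
def assocLin : (tens (tens V W) U).carrier →ₗ[k] (tens V (tens W U)).carrier :=
  proR U V W ∘ₗ (TensorProduct.assoc k _ _ _).toLinearMap ∘ₗ incL U V W

theorem incR_assocLin (t : (tens (tens V W) U).carrier) :
    incR U V W (assocLin U V W t) = TensorProduct.assoc k _ _ _ (incL U V W t) := by
  simp only [assocLin, LinearMap.comp_apply, LinearEquiv.coe_coe]
  rw [← assoc_incL_proL, proL_incL]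

theorem incL_ρ (h : A) (t : (tens (tens V W) U).carrier) :
    incL U V W ((tens (tens V W) U).ρ h t) =
      act₃L U V W ((comul (R := k) (A := A)).rTensor A (comul (R := k) h)) (incL U V W t) := by
  simp only [incL, LinearMap.comp_apply, inc_ρ, act₃L_inc]

theorem incR_ρ (h : A) (t : (tens V (tens W U)).carrier) :
    incR U V W ((tens V (tens W U)).ρ h t) =
      act₃R U V W ((comul (R := k) (A := A)).lTensor A (comul (R := k) h)) (incR U V W t) := by
  simp only [incR, LinearMap.comp_apply, inc_ρ, act₃R_inc]

variable (U V W) in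
/-- The associativity isomorphism `(V ⊗ W) ⊗ U ≅ V ⊗ (W ⊗ U)`, the restriction of the usual one. -/
def assocIso : tens (tens V W) U ≅ tens V (tens W U) :=
  isoMk
    { lin := assocLin U V W
      comm := fun h t => by
        apply incR_injective
        rw [incR_assocLin, incR_ρ, incL_ρ, incR_assocLin, assoc_act₃L, coassoc_apply] }
    (proL U V W ∘ₗ (TensorProduct.assoc k _ _ _).symm.toLinearMap ∘ₗ incR U V W)
    (fun t => by
      simp only [LinearMap.comp_apply, incR_assocLin, LinearEquiv.coe_coe,
        LinearEquiv.symm_apply_apply, proL_incL])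
    (fun t => by
      apply incR_injective
      simp only [LinearMap.comp_apply, incR_assocLin, LinearEquiv.coe_coe]
      rw [assoc_incL_proL, LinearEquiv.apply_symm_apply, proR_incR])

theorem incR_assocIso (t : (tens (tens V W) U).carrier) :
    incR U V W (Hom.lin (assocIso U V W).hom t) = TensorProduct.assoc k _ _ _ (incL U V W t) :=
  incR_assocLin t

theorem incL_tensMap {U' V' W' : FDRepr k A} (f : V ⟶ V') (g : W ⟶ W') (h : U ⟶ U')
    (t : (tens (tens V W) U).carrier) :
    incL U' V' W' ((tensMap (tensMap f g) h).lin t) =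
      TensorProduct.map (TensorProduct.map f.lin g.lin) h.lin (incL U V W t) := by
  simp only [incL, LinearMap.comp_apply, inc_tensMap]
  generalize inc (tens V W) U t = s
  induction s with
  | zero => simp
  | add x y hx hy => simp only [map_add, hx, hy]
  | tmul x y => simp [inc_tensMap]

theorem incR_tensMap {U' V' W' : FDRepr k A} (f : V ⟶ V') (g : W ⟶ W') (h : U ⟶ U')
    (t : (tens V (tens W U)).carrier) :
    incR U' V' W' ((tensMap f (tensMap g h)).lin t) =
      TensorProduct.map f.lin (TensorProduct.map g.lin h.lin) (incR U V W t) := by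
  simp only [incR, LinearMap.comp_apply, inc_tensMap]
  generalize inc V (tens W U) t = s
  induction s with
  | zero => simp
  | add x y hx hy => simp only [map_add, hx, hy]
  | tmul x y => simp [inc_tensMap]

end Assoc

section Pentagon

variable {V W U S : FDRepr k A}

variable (V W U S) in
/-- The inclusion of `V ⊗ (W ⊗ (U ⊗ S))` in the tensor product of vector spaces. -/
def incQ : (tens V (tens W (tens U S))).carrier →ₗ[k]
    V.carrier ⊗[k] (W.carrier ⊗[k] (U.carrier ⊗[k] S.carrier)) :=
  (incR S W U).lTensor _ ∘ₗ inc V _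

theorem incQ_injective : Function.Injective (incQ V W U S) := by
  refine Function.LeftInverse.injective (g := pro V _ ∘ₗ (proR S W U).lTensor _) fun t => ?_
  simp only [incQ, LinearMap.comp_apply]
  rw [← LinearMap.lTensor_comp_apply,
    show proR S W U ∘ₗ incR S W U = LinearMap.id from LinearMap.ext proR_incR,
    LinearMap.lTensor_id_apply, pro_inc]

theorem pentagon_lhs (t : (tens (tens (tens V W) U) S).carrier) :
    incQ V W U S ((tensMap (𝟙 V) (assocIso S W U).hom).lin (Hom.lin (assocIso S V (tens W U)).hom
      ((tensMap (assocIso U V W).hom (𝟙 S)).lin t))) =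
    (TensorProduct.assoc k _ _ _).toLinearMap.lTensor _ (TensorProduct.assoc k _ _ _
      (((TensorProduct.assoc k _ _ _).toLinearMap ∘ₗ incL U V W).rTensor _ (inc _ S t))) := by
  have hA : ∀ y, incQ V W U S ((tensMap (𝟙 V) (assocIso S W U).hom).lin y) =
      (TensorProduct.assoc k _ _ _).toLinearMap.lTensor _
        (((inc W U).rTensor _).lTensor _ (incR S V (tens W U) y)) := by
    intro y
    simp only [incQ, incR, LinearMap.comp_apply, inc_tensMap]
    generalize inc V _ y = q
    induction q with
    | zero => simp only [map_zero]
    | add x y hx hy => simp only [map_add, hx, hy]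
    | tmul v m =>
      simp only [TensorProduct.map_tmul, LinearMap.lTensor_tmul, id_lin, LinearMap.id_apply]
      congr 1
      exact incR_assocIso m
  have hN : ∀ q : (V.carrier ⊗[k] (tens W U).carrier) ⊗[k] S.carrier,
      ((inc W U).rTensor S.carrier).lTensor V.carrier (TensorProduct.assoc k _ _ _ q) =
        TensorProduct.assoc k _ _ _ (((inc W U).lTensor V.carrier).rTensor S.carrier q) := by
    intro q
    refine LinearMap.congr_fun (f := ((inc W U).rTensor S.carrier).lTensor V.carrier ∘ₗ
      (TensorProduct.assoc k _ _ _).toLinearMap) (g := (TensorProduct.assoc k _ _ _).toLinearMap ∘ₗ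
        ((inc W U).lTensor V.carrier).rTensor S.carrier) ?_ q
    ext v m s
    simp
  rw [hA, incR_assocIso, hN]
  congr 2
  simp only [incL, LinearMap.comp_apply, inc_tensMap]
  generalize inc _ S t = q
  induction q with
  | zero => simp only [map_zero]
  | add x y hx hy => simp only [map_add, hx, hy]
  | tmul m s =>
    simp only [TensorProduct.map_tmul, LinearMap.rTensor_tmul, id_lin, LinearMap.id_apply]
    congr 1
    exact incR_assocIso m

theorem pentagon_rhs (t : (tens (tens (tens V W) U) S).carrier) :
    incQ V W U S (Hom.lin (assocIso (tens U S) V W).hom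
      (Hom.lin (assocIso S (tens V W) U).hom t)) =
    TensorProduct.assoc k _ _ _ (TensorProduct.assoc k _ _ _
      ((incL U V W).rTensor _ (inc _ S t))) := by
  have hC : ∀ y, incQ V W U S y = ((inc U S).lTensor _).lTensor _ (incR (tens U S) V W y) := by
    intro y
    simp only [incQ, incR, LinearMap.comp_apply]
    rw [← LinearMap.lTensor_comp_apply]
  have hN : ∀ q : (V.carrier ⊗[k] W.carrier) ⊗[k] (tens U S).carrier,
      ((inc U S).lTensor W.carrier).lTensor V.carrier (TensorProduct.assoc k _ _ _ q) =
        TensorProduct.assoc k _ _ _ ((inc U S).lTensor (V.carrier ⊗[k] W.carrier) q) := by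
    intro q
    refine LinearMap.congr_fun (f := ((inc U S).lTensor W.carrier).lTensor V.carrier ∘ₗ
      (TensorProduct.assoc k _ _ _).toLinearMap) (g := (TensorProduct.assoc k _ _ _).toLinearMap ∘ₗ
        (inc U S).lTensor (V.carrier ⊗[k] W.carrier)) ?_ q
    ext v m s
    simp
  have hD : ∀ y, (inc U S).lTensor (V.carrier ⊗[k] W.carrier) (incL (tens U S) V W y) =
      (inc V W).rTensor _ (incR S (tens V W) U y) := by
    intro y
    simp only [incL, incR, LinearMap.comp_apply]
    rw [← LinearMap.comp_apply, ← LinearMap.comp_apply (LinearMap.rTensor _ _),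
      LinearMap.lTensor_comp_rTensor, LinearMap.rTensor_comp_lTensor]
  have hM : ∀ q : ((tens V W).carrier ⊗[k] U.carrier) ⊗[k] S.carrier,
      (inc V W).rTensor (U.carrier ⊗[k] S.carrier) (TensorProduct.assoc k _ _ _ q) =
        TensorProduct.assoc k _ _ _ (((inc V W).rTensor U.carrier).rTensor S.carrier q) := by
    intro q
    refine LinearMap.congr_fun (f := (inc V W).rTensor (U.carrier ⊗[k] S.carrier) ∘ₗ
      (TensorProduct.assoc k _ _ _).toLinearMap) (g := (TensorProduct.assoc k _ _ _).toLinearMap ∘ₗ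
        ((inc V W).rTensor U.carrier).rTensor S.carrier) ?_ q
    ext v m s
    simp
  rw [hC, incR_assocIso, hN, hD, incR_assocIso, hM]
  congr 2
  simp only [incL, LinearMap.comp_apply]
  rw [← LinearMap.rTensor_comp_apply]

end Pentagon

section Unit

variable [FiniteDimensional k A]

variable (k A) in
/-- The unit object: the target subalgebra `A_t` with the action `h · z = ε_t(h z)`. -/
def unit : FDRepr k A where
  carrier := targetSub k A
  ρ := AlgHom.ofLinearMap
    { toFun := fun h => epsTR k A ∘ₗ LinearMap.mulLeft k h ∘ₗ (targetSub k A).subtype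
      map_add' := fun a b => by ext t : 1; simp [add_mul]
      map_smul' := fun a b => by ext t : 1; simp }
    (by
      ext t : 1
      obtain ⟨_, g, rfl⟩ := t
      apply Subtype.ext
      simp [coe_epsTR, epsT_epsT])
    (fun a b => by
      ext t : 1
      apply Subtype.ext
      simp [coe_epsTR, epsT_mul_epsT])

/-- An element `z` of the target subalgebra as an element of `A`. -/
def toA : (unit k A).carrier →ₗ[k] A := (targetSub k A).subtype

/-- The target map with values in the unit object. -/
def eT : A →ₗ[k] (unit k A).carrier := epsTR k A

theorem toA_mem (z : (unit k A).carrier) : toA z ∈ targetSub k A := Subtype.coe_prop _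

theorem toA_injective : Function.Injective (toA (k := k) (A := A)) := Subtype.val_injective

theorem unit_ρ (h : A) (z : (unit k A).carrier) : (unit k A).ρ h z = eT (h * toA z) := rfl

theorem toA_eT (h : A) : toA (eT (k := k) h) = epsT k A h := rfl

/-- The unit `1 ∈ A_t`. -/
abbrev uOne : (unit k A).carrier := eT (k := k) 1

theorem toA_uOne : toA (uOne (k := k) (A := A)) = 1 := by rw [uOne, toA_eT, epsT_one]

variable (V W : FDRepr k A)

/-- The map `z ⊗ v ↦ z v`. -/
def mu : (unit k A).carrier ⊗[k] V.carrier →ₗ[k] V.carrier :=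
  TensorProduct.lift (V.ρ.toLinearMap ∘ₗ toA)

/-- The map `v ⊗ z ↦ σ(z) v`. -/
def nu : V.carrier ⊗[k] (unit k A).carrier →ₗ[k] V.carrier :=
  TensorProduct.lift ((V.ρ.toLinearMap ∘ₗ sig k A ∘ₗ toA).flip)

variable {V W}

@[simp] theorem mu_tmul (z : (unit k A).carrier) (v : V.carrier) :
    mu V (z ⊗ₜ v) = V.ρ (toA z) v := rfl

@[simp] theorem nu_tmul (z : (unit k A).carrier) (v : V.carrier) :
    nu V (v ⊗ₜ z) = V.ρ (sig k A (toA z)) v := rfl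

theorem mu_act₂_aux (X : A ⊗[k] A) (z : (unit k A).carrier) (v : V.carrier) :
    mu V (act₂ (unit k A) V X (z ⊗ₜ v)) = V.ρ (LinearMap.mul' k A
      (TensorProduct.map (epsT k A ∘ₗ LinearMap.mulRight k (toA z)) LinearMap.id X)) v := by
  induction X with
  | zero => simp
  | add x y hx hy => simp only [map_add, LinearMap.add_apply, hx, hy]
  | tmul a b => simp [unit_ρ, toA_eT]

theorem mu_act₂ (h : A) (t : (unit k A).carrier ⊗[k] V.carrier) :
    mu V (act₂ (unit k A) V (comul (R := k) h) t) = V.ρ h (mu V t) := by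
  induction t with
  | zero => simp
  | add x y hx hy => simp only [map_add, hx, hy]
  | tmul z v => rw [mu_act₂_aux, target_mul h (toA_mem z)]; simp

theorem nu_act₂_aux (X : A ⊗[k] A) (z : (unit k A).carrier) (v : V.carrier) :
    nu V (act₂ V (unit k A) X (v ⊗ₜ z)) = V.ρ (LinearMap.mul' k A (TensorProduct.comm k A A
      (TensorProduct.map LinearMap.id (sig k A ∘ₗ LinearMap.mulRight k (toA z)) X))) v := by
  induction X with
  | zero => simp
  | add x y hx hy => simp only [map_add, LinearMap.add_apply, hx, hy]
  | tmul a b => simp [unit_ρ, toA_eT, sig_epsT]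

theorem nu_act₂ (h : A) (t : V.carrier ⊗[k] (unit k A).carrier) :
    nu V (act₂ V (unit k A) (comul (R := k) h) t) = V.ρ h (nu V t) := by
  induction t with
  | zero => simp
  | add x y hx hy => simp only [map_add, hx, hy]
  | tmul v z => rw [nu_act₂_aux, sig_mul]; simp

theorem left_aux (z : (unit k A).carrier) (v : V.carrier) :
    act₂ (unit k A) V (comul (R := k) (1 : A)) (uOne ⊗ₜ V.ρ (toA z) v) =
      act₂ (unit k A) V (comul (R := k) (1 : A)) (z ⊗ₜ v) := by
  have e₁ : ∀ X : A ⊗[k] A, act₂ (unit k A) V X (uOne ⊗ₜ V.ρ (toA z) v) =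
      TensorProduct.map LinearMap.id (V.ρ.toLinearMap.flip v)
        (TensorProduct.map (eT) LinearMap.id (X * (1 ⊗ₜ toA z))) := by
    intro X
    induction X with
    | zero => simp
    | add x y hx hy => simp only [add_mul, map_add, LinearMap.add_apply, hx, hy]
    | tmul a b => simp [unit_ρ, toA_uOne]
  have e₂ : ∀ X : A ⊗[k] A, act₂ (unit k A) V X (z ⊗ₜ v) =
      TensorProduct.map LinearMap.id (V.ρ.toLinearMap.flip v)
        (TensorProduct.map (eT) LinearMap.id (X * (toA z ⊗ₜ[k] (1 : A)))) := by
    intro X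
    induction X with
    | zero => simp
    | add x y hx hy => simp only [add_mul, map_add, LinearMap.add_apply, hx, hy]
    | tmul a b => simp [unit_ρ]
  rw [e₁, e₂]
  exact congrArg _ (target_left (toA_mem z))

theorem right_aux (z : (unit k A).carrier) (v : V.carrier) :
    act₂ V (unit k A) (comul (R := k) (1 : A)) (V.ρ (sig k A (toA z)) v ⊗ₜ uOne) =
      act₂ V (unit k A) (comul (R := k) (1 : A)) (v ⊗ₜ z) := by
  have e₁ : ∀ X : A ⊗[k] A, act₂ V (unit k A) X (V.ρ (sig k A (toA z)) v ⊗ₜ uOne) =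
      TensorProduct.map (V.ρ.toLinearMap.flip v) LinearMap.id
        (TensorProduct.map LinearMap.id (eT) (X * (sig k A (toA z) ⊗ₜ[k] (1 : A)))) := by
    intro X
    induction X with
    | zero => simp
    | add x y hx hy => simp only [add_mul, map_add, LinearMap.add_apply, hx, hy]
    | tmul a b => simp [unit_ρ, toA_uOne]
  have e₂ : ∀ X : A ⊗[k] A, act₂ V (unit k A) X (v ⊗ₜ z) =
      TensorProduct.map (V.ρ.toLinearMap.flip v) LinearMap.id
        (TensorProduct.map LinearMap.id (eT) (X * ((1 : A) ⊗ₜ toA z))) := by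
    intro X
    induction X with
    | zero => simp
    | add x y hx hy => simp only [add_mul, map_add, LinearMap.add_apply, hx, hy]
    | tmul a b => simp [unit_ρ]
  rw [e₁, e₂]
  exact congrArg _ (target_right (toA z))

variable (V) in
/-- The left unit isomorphism, the restriction of `z ⊗ v ↦ z v`. -/
def leftIso : tens (unit k A) V ≅ V :=
  isoMk
    { lin := mu V ∘ₗ inc (unit k A) V
      comm := fun h t => by simp only [LinearMap.comp_apply, inc_ρ, mu_act₂] }
    (pro (unit k A) V ∘ₗ TensorProduct.mk k _ _ uOne)
    (fun t => by
      apply inc_injective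
      simp only [LinearMap.comp_apply, inc_pro, TensorProduct.mk_apply]
      conv_rhs => rw [← act₂_inc]
      generalize inc (unit k A) V t = s
      induction s with
      | zero => simp
      | add x y hx hy => simp only [map_add, TensorProduct.tmul_add, hx, hy]
      | tmul z v => rw [mu_tmul, left_aux])
    (fun v => by
      simp only [LinearMap.comp_apply, inc_pro, TensorProduct.mk_apply, mu_act₂, mu_tmul,
        toA_uOne, map_one, Module.End.one_apply])

variable (V) in
/-- The right unit isomorphism, the restriction of `v ⊗ z ↦ σ(z) v`, where
`σ(z) = (id ⊗ ε)(Δ(1)(1 ⊗ z))` (if `A` has a bijective antipode `S`, then `σ(z) = S⁻¹(z)` for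
`z ∈ A_t`). -/
def rightIso : tens V (unit k A) ≅ V :=
  isoMk
    { lin := nu V ∘ₗ inc V (unit k A)
      comm := fun h t => by simp only [LinearMap.comp_apply, inc_ρ, nu_act₂] }
    (pro V (unit k A) ∘ₗ (TensorProduct.mk k _ _).flip uOne)
    (fun t => by
      apply inc_injective
      simp only [LinearMap.comp_apply, inc_pro, LinearMap.flip_apply, TensorProduct.mk_apply]
      conv_rhs => rw [← act₂_inc]
      generalize inc V (unit k A) t = s
      induction s with
      | zero => simp
      | add x y hx hy => simp only [map_add, TensorProduct.add_tmul, hx, hy]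
      | tmul v z => rw [nu_tmul, right_aux])
    (fun v => by
      simp only [LinearMap.comp_apply, inc_pro, LinearMap.flip_apply, TensorProduct.mk_apply,
        nu_act₂, nu_tmul, toA_uOne, sig_one, map_one, Module.End.one_apply])

theorem leftIso_lin (t : (tens (unit k A) V).carrier) :
    Hom.lin (leftIso V).hom t = mu V (inc _ _ t) := rfl

theorem rightIso_lin (t : (tens V (unit k A)).carrier) :
    Hom.lin (rightIso V).hom t = nu V (inc _ _ t) := rfl

theorem triangle_aux (t : (V.carrier ⊗[k] (unit k A).carrier) ⊗[k] W.carrier) :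
    (mu W).lTensor V.carrier (TensorProduct.assoc k _ _ _ (act₃L W V (unit k A)
      ((comul (R := k) (A := A)).rTensor A (comul (R := k) 1)) t)) =
    (nu V).rTensor W.carrier (act₃L W V (unit k A)
      ((comul (R := k) (A := A)).rTensor A (comul (R := k) 1)) t) := by
  induction t with
  | zero => simp
  | add x y hx hy => simp only [map_add, hx, hy]
  | tmul s w =>
    induction s with
    | zero => simp
    | add x y hx hy => simp only [TensorProduct.add_tmul, map_add, hx, hy]
    | tmul v z =>
      have e₁ : ∀ X : A ⊗[k] A, (nu V).rTensor W.carrier (act₃L W V (unit k A)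
          ((comul (R := k) (A := A)).rTensor A X) ((v ⊗ₜ z) ⊗ₜ w)) =
          TensorProduct.map (V.ρ.toLinearMap.flip v) (W.ρ.toLinearMap.flip w)
            (X * (sig k A (toA z) ⊗ₜ[k] (1 : A))) := by
        intro X
        induction X with
        | zero => simp
        | add x y hx hy => simp only [add_mul, map_add, LinearMap.add_apply, hx, hy]
        | tmul a b => simp [act₃L_tmul, nu_act₂]
      have e₂ : ∀ X : A ⊗[k] A, (mu W).lTensor V.carrier (act₃R W V (unit k A)
          ((comul (R := k) (A := A)).lTensor A X) (v ⊗ₜ (z ⊗ₜ w))) =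
          TensorProduct.map (V.ρ.toLinearMap.flip v) (W.ρ.toLinearMap.flip w)
            (X * ((1 : A) ⊗ₜ toA z)) := by
        intro X
        induction X with
        | zero => simp
        | add x y hx hy => simp only [add_mul, map_add, LinearMap.add_apply, hx, hy]
        | tmul a b => simp [act₃R_tmul, mu_act₂]
      rw [assoc_act₃L, coassoc_apply, TensorProduct.assoc_tmul, e₁, e₂,
        target_mid (toA_mem z)]

theorem triangle_incL (t : (tens (tens V (unit k A)) W).carrier) :
    (mu W).lTensor V.carrier (TensorProduct.assoc k _ _ _ (incL W V (unit k A) t)) =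
      (nu V).rTensor W.carrier (incL W V (unit k A) t) := by
  have := triangle_aux (V := V) (W := W) (incL W V (unit k A) t)
  rwa [← incL_proL, proL_incL] at this

end Unit

section Monoidal

variable [FiniteDimensional k A]

/-- The monoidal structure on the category of finite-dimensional representations of a
finite-dimensional weak bialgebra. -/
instance : MonoidalCategory (FDRepr k A) where
  tensorObj := tens
  whiskerLeft V _ _ f := tensMap (𝟙 V) f
  whiskerRight f W := tensMap f (𝟙 W)
  tensorHom f g := tensMap f g
  tensorUnit := unit k A
  associator V W U := assocIso U V W
  leftUnitor := leftIso
  rightUnitor := rightIso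
  tensorHom_def f g := by
    ext t
    apply inc_injective
    simp only [comp_lin, LinearMap.comp_apply, inc_tensMap, id_lin]
    rw [TensorProduct.map_map]
    rfl
  id_tensorHom_id V W := by
    ext t
    apply inc_injective
    simp only [inc_tensMap, id_lin, TensorProduct.map_id, LinearMap.id_apply]
  tensorHom_comp_tensorHom f g f' g' := by
    ext t
    apply inc_injective
    simp only [comp_lin, LinearMap.comp_apply, inc_tensMap]
    rw [TensorProduct.map_comp]
    rfl
  id_whiskerRight V W := by
    ext t
    apply inc_injective
    simp only [inc_tensMap, id_lin, TensorProduct.map_id, LinearMap.id_apply]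
  whiskerLeft_id V W := by
    ext t
    apply inc_injective
    simp only [inc_tensMap, id_lin, TensorProduct.map_id, LinearMap.id_apply]
  associator_naturality f g h := by
    ext t
    apply incR_injective
    simp only [comp_lin, LinearMap.comp_apply, incR_assocIso, incL_tensMap, incR_tensMap]
    rw [TensorProduct.map_map_assoc]
  leftUnitor_naturality f := by
    ext t
    simp only [comp_lin, LinearMap.comp_apply, leftIso_lin, inc_tensMap]
    generalize inc _ _ t = s
    induction s with
    | zero => simp
    | add x y hx hy => simp only [map_add, hx, hy]
    | tmul x y => simp [f.comm]
  rightUnitor_naturality f := by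
    ext t
    simp only [comp_lin, LinearMap.comp_apply, rightIso_lin, inc_tensMap]
    generalize inc _ _ t = s
    induction s with
    | zero => simp
    | add x y hx hy => simp only [map_add, hx, hy]
    | tmul x y => simp [f.comm]
  pentagon V W U S := by
    ext t
    apply incQ_injective
    refine (pentagon_lhs t).trans (Eq.trans ?_ (pentagon_rhs t).symm)
    generalize inc _ S t = q
    rw [LinearMap.rTensor_comp_apply]
    generalize (incL U V W).rTensor _ q = Z
    refine LinearMap.congr_fun (f := (TensorProduct.assoc k _ _ _).toLinearMap.lTensor _ ∘ₗ
      (TensorProduct.assoc k _ _ _).toLinearMap ∘ₗ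
        (TensorProduct.assoc k _ _ _).toLinearMap.rTensor _)
      (g := (TensorProduct.assoc k _ _ _).toLinearMap ∘ₗ
        (TensorProduct.assoc k _ _ _).toLinearMap) ?_ Z
    ext a b c d
    simp
  triangle V W := by
    ext t
    apply inc_injective
    simp only [comp_lin, LinearMap.comp_apply, inc_tensMap]
    have h := triangle_incL t
    rw [← incR_assocIso] at h
    simp only [incL, incR, LinearMap.comp_apply] at h
    rw [← LinearMap.lTensor_comp_apply, ← LinearMap.rTensor_comp_apply] at h
    exact h

end Monoidal

end

end FDRepr

namespace DoubleGroupoid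

open ArrowGroupoid

variable {T : DoubleGroupoid.{u}}

/-- The box is the identity of its left edge for the horizontal composition. -/
def IsHone (A : T.Box) : Prop := A = T.horiz.one (T.horiz.src A)

theorem isHone_one (g : T.Ver) : IsHone (T.horiz.one g) := by
  rw [IsHone, T.horiz.src_one]

theorem IsHone.top {A : T.Box} (h : IsHone A) : ∃ P, T.vert.src A = T.hor.one P :=
  ⟨_, by rw [h, T.top_hone]⟩

theorem IsHone.bot {A : T.Box} (h : IsHone A) : ∃ P, T.vert.tgt A = T.hor.one P :=
  ⟨_, by rw [h, T.bot_hone]⟩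

theorem isComp_self_of_isHone {B : T.Box} (h : IsHone B) : T.horiz.IsComp B B B := by
  have w := isComp_one_left (G := T.horiz) B
  rwa [← h] at w

theorem eq_of_isHone {B X Y : T.Box} (w : T.horiz.IsComp X Y B) (hX : IsHone X) (hY : IsHone Y) :
    X = B ∧ Y = B := by
  have h₁ : Y = B := by
    rw [hX] at w; exact w.eq_of_one_left.symm
  have h₂ : X = B := by
    rw [hY] at w; exact w.eq_of_one_right.symm
  exact ⟨h₂, h₁⟩

section Vacant

variable [T.IsVacant]

/-- A box whose top edge is an identity is a horizontal identity. -/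
theorem eq_hone_of_top {A : T.Box} {P : T.Pt} (h : T.vert.src A = T.hor.one P) :
    A = T.horiz.one (T.horiz.tgt A) := by
  apply eq_of_top_right
  · rw [T.top_hone, ← T.right_top, h, T.hor.tgt_one]
  · rw [T.horiz.tgt_one]

theorem isHone_of_top {A : T.Box} {P : T.Pt} (h : T.vert.src A = T.hor.one P) : IsHone A := by
  rw [eq_hone_of_top h]; exact isHone_one _

theorem isHone_of_bot {A : T.Box} {P : T.Pt} (h : T.vert.tgt A = T.hor.one P) : IsHone A := by
  rw [eq_hone_of_bot h]; exact isHone_one _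

theorem isHone_iff_bot {A B : T.Box} (h : T.vert.tgt A = T.vert.src B) : IsHone A ↔ IsHone B := by
  constructor
  · intro w
    obtain ⟨P, hP⟩ := w.bot
    exact isHone_of_top (h ▸ hP)
  · intro w
    obtain ⟨P, hP⟩ := w.top
    exact isHone_of_bot (h.trans hP)

theorem isHone_comp_iff {A B C : T.Box} (w : T.vert.IsComp A B C) : IsHone C ↔ IsHone A := by
  constructor
  · intro h
    obtain ⟨P, hP⟩ := h.top
    exact isHone_of_top (w.src ▸ hP)
  · intro h
    obtain ⟨P, hP⟩ := h.top
    exact isHone_of_top (w.src.trans hP)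

/-- A decomposition of the top edge of a box lifts to a decomposition of the box. -/
theorem exists_split_top (A : T.Box) {x y : T.Hor} (w : T.hor.IsComp x y (T.vert.src A)) :
    ∃ B C, T.horiz.IsComp B C A ∧ T.vert.src B = x ∧ T.vert.src C = y := by
  obtain ⟨C, ⟨h1, h2⟩, -⟩ := IsVacant.existsUnique_box y (T.horiz.tgt A)
    (by rw [← T.right_top, ← w.tgt])
  have h3 : T.horiz.tgt A = T.horiz.src (T.horiz.inv C) := by rw [T.horiz.src_inv, h2]
  have h4 := (isComp_comp _ _ h3).inv_right
  rw [ArrowGroupoid.inv_inv] at h4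
  refine ⟨_, C, h4, ?_, h1⟩
  have h5 := top_isComp h4
  rw [h1] at h5
  exact h5.cancel_right w

theorem split_unique_top {A B C B' C' : T.Box} (w : T.horiz.IsComp B C A)
    (w' : T.horiz.IsComp B' C' A) (h' : T.vert.src C = T.vert.src C') : B = B' ∧ C = C' := by
  have : C = C' := eq_of_top_right h' (by rw [← w.tgt, ← w'.tgt])
  subst this
  exact ⟨w.cancel_right w', rfl⟩

/-- The horizontal decompositions of a vertical identity consist of vertical identities. -/
theorem split_vone {x : T.Hor} {B C : T.Box} (w : T.horiz.IsComp B C (T.vert.one x)) :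
    B = T.vert.one (T.vert.src B) ∧ C = T.vert.one (T.vert.src C) := by
  have h := top_isComp w
  rw [T.vert.src_one] at h
  exact split_unique_top w (isComp_vone h) (T.vert.src_one _).symm

end Vacant

end DoubleGroupoid

/-- The groupoid algebra `kT`: the vector space with basis the set of boxes. -/
def QG (k : Type u) [Field k] (T : DoubleGroupoid.{u}) : Type u := T.Box →₀ k

namespace QG

noncomputable section

open scoped Classical
open DoubleGroupoid ArrowGroupoid

attribute [local instance] Fintype.ofFinite

variable {k : Type u} [Field k] {T : DoubleGroupoid.{u}}

instance : AddCommGroup (QG k T) := inferInstanceAs (AddCommGroup (T.Box →₀ k))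
instance : Module k (QG k T) := inferInstanceAs (Module k (T.Box →₀ k))

/-- The basis vector of a box. -/
def box (k : Type u) [Field k] {T : DoubleGroupoid.{u}} (A : T.Box) : QG k T :=
  Finsupp.single (M := k) A 1

/-- The linear extension of a map defined on boxes. -/
def ext {M : Type u} [AddCommMonoid M] [Module k M] (f : T.Box → M) : QG k T →ₗ[k] M :=
  Finsupp.linearCombination k f

@[simp]
theorem ext_box {M : Type u} [AddCommMonoid M] [Module k M] (f : T.Box → M) (A : T.Box) :
    ext f (box k A) = f A := by
  exact (Finsupp.linearCombination_single k 1 A).trans (one_smul k _)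

theorem hom_ext {M : Type u} [AddCommMonoid M] [Module k M] {f g : QG k T →ₗ[k] M}
    (h : ∀ A, f (box k A) = g (box k A)) : f = g :=
  Finsupp.lhom_ext' fun A => LinearMap.ext_ring (h A)

/-- The product of two boxes: their vertical composition if it exists, otherwise zero. -/
def boxMul (k : Type u) [Field k] {T : DoubleGroupoid.{u}} (A B : T.Box) : QG k T :=
  if p : T.vert.tgt A = T.vert.src B then box k (T.vert.comp A B p) else 0

/-- The multiplication as a bilinear map. -/
def mulLin (k : Type u) [Field k] (T : DoubleGroupoid.{u}) : QG k T →ₗ[k] QG k T →ₗ[k] QG k T :=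
  ext fun A => ext fun B => boxMul k A B

theorem boxMul_isComp {A B C : T.Box} (w : T.vert.IsComp A B C) : boxMul k A B = box k C := by
  obtain ⟨p, rfl⟩ := w; exact dif_pos p

theorem boxMul_zero {A B : T.Box} (h : T.vert.tgt A ≠ T.vert.src B) : boxMul k A B = 0 :=
  dif_neg h

instance : Mul (QG k T) := ⟨fun a b => mulLin k T a b⟩

theorem mul_def (a b : QG k T) : a * b = mulLin k T a b := rfl

@[simp]
theorem box_mul_box (A B : T.Box) : box k A * box k B = boxMul k A B := by
  simp [mul_def, mulLin]

instance : NonUnitalNonAssocRing (QG k T) where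
  left_distrib a b c := map_add _ _ _
  right_distrib a b c := by simp [mul_def]
  zero_mul a := by simp [mul_def]
  mul_zero a := by simp [mul_def]

theorem boxMul_assoc (A B C : T.Box) : boxMul k A B * box k C = box k A * boxMul k B C := by
  by_cases p : T.vert.tgt A = T.vert.src B
  · by_cases q : T.vert.tgt B = T.vert.src C
    · have h1 := isComp_comp A B p
      have h2 := isComp_comp B C q
      have h3 := isComp_comp _ C (h1.tgt.trans q)
      rw [boxMul_isComp h1, boxMul_isComp h2, box_mul_box, box_mul_box, boxMul_isComp h3,
        boxMul_isComp (h1.assoc h2 h3)]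
    · rw [boxMul_zero q, boxMul_isComp (isComp_comp A B p), box_mul_box, boxMul_zero, mul_zero]
      rwa [T.vert.tgt_comp]
  · rw [boxMul_zero p, zero_mul]
    by_cases q : T.vert.tgt B = T.vert.src C
    · rw [boxMul_isComp (isComp_comp B C q), box_mul_box, boxMul_zero]
      rwa [T.vert.src_comp]
    · rw [boxMul_zero q, mul_zero]


theorem smul_mul (c : k) (a b : QG k T) : c • a * b = c • (a * b) := by
  simp [mul_def]

theorem mul_smul (c : k) (a b : QG k T) : a * c • b = c • (a * b) := by
  simp [mul_def]

@[elab_as_elim]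
theorem ind {p : QG k T → Prop} (a : QG k T) (zero : p 0) (add : ∀ a b, p a → p b → p (a + b))
    (smul : ∀ (c : k) A, p (c • box k A)) : p a :=
  Finsupp.induction_linear (motive := p) a zero add fun A c => by
    have h := smul c A
    have e : c • box k A = Finsupp.single (M := k) A c := by
      refine (Finsupp.smul_single c A (1 : k)).trans ?_
      rw [smul_eq_mul, mul_one]
    exact e ▸ h

theorem boxMul_vone (A : T.Box) (x : T.Hor) :
    boxMul k A (T.vert.one x) = if T.vert.tgt A = x then box k A else 0 := by
  split_ifs with h
  · subst h; exact boxMul_isComp (isComp_one_right A)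
  · exact boxMul_zero (by rwa [T.vert.src_one])

theorem vone_boxMul (A : T.Box) (x : T.Hor) :
    boxMul k (T.vert.one x) A = if T.vert.src A = x then box k A else 0 := by
  split_ifs with h
  · subst h; exact boxMul_isComp (isComp_one_left A)
  · exact boxMul_zero (by rw [T.vert.tgt_one]; exact fun h' => h h'.symm)

theorem ite_commute {R : Type u} [Ring R] {c d : Prop} [Decidable c] [Decidable d] {a b : R}
    (h : Commute a b) : Commute (if c then a else 0) (if d then b else 0) := by
  split_ifs
  · exact h
  · exact Commute.zero_right _
  · exact Commute.zero_left _
  · exact Commute.zero_left _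

variable [T.IsFinite]

instance : One (QG k T) := ⟨∑ x : T.Hor, box k (T.vert.one x)⟩

theorem one_def : (1 : QG k T) = ∑ x : T.Hor, box k (T.vert.one x) := rfl

instance : Ring (QG k T) where
  __ := (inferInstance : NonUnitalNonAssocRing (QG k T))
  one := 1
  mul_assoc a b c := by
    induction a using ind with
    | zero => simp only [zero_mul]
    | add a a' h h' => simp only [add_mul, h, h']
    | smul r A =>
      induction b using ind with
      | zero => simp only [zero_mul, mul_zero]
      | add a a' h h' => simp only [add_mul, mul_add, h, h']
      | smul s B =>
        induction c using ind with
        | zero => simp only [mul_zero]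
        | add a a' h h' => simp only [mul_add, h, h']
        | smul t C => simp only [smul_mul, mul_smul, box_mul_box, boxMul_assoc]
  one_mul a := by
    refine LinearMap.congr_fun (f := mulLin k T 1) (g := LinearMap.id) (hom_ext fun A => ?_) a
    change 1 * box k A = box k A
    rw [one_def, Finset.sum_mul]
    simp [vone_boxMul]
  mul_one a := by
    refine LinearMap.congr_fun (f := (mulLin k T).flip 1) (g := LinearMap.id)
      (hom_ext fun A => ?_) a
    change box k A * 1 = box k A
    rw [one_def, Finset.mul_sum]
    simp [boxMul_vone]

instance : Algebra k (QG k T) := Algebra.ofModule smul_mul (fun c a b => mul_smul c a b)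

instance : FiniteDimensional k (QG k T) := inferInstanceAs (FiniteDimensional k (T.Box →₀ k))

/-- The pairs `(B, C)` of boxes with horizontal composition `B C = A`. -/
abbrev Dec (A : T.Box) : Type u := {q : T.Box × T.Box // T.horiz.IsComp q.1 q.2 A}

/-- The comultiplication `Δ(A) = ∑ B ⊗ C`, the sum running over all horizontal decompositions
`A = B C`. -/
def comulLin (k : Type u) [Field k] (T : DoubleGroupoid.{u}) [T.IsFinite] :
    QG k T →ₗ[k] QG k T ⊗[k] QG k T :=
  ext fun A => ∑ q : Dec A, box k q.1.1 ⊗ₜ box k q.1.2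

/-- The counit: `ε(A) = 1` if `A` is the horizontal identity of its left edge, and `0` otherwise. -/
def counitLin (k : Type u) [Field k] (T : DoubleGroupoid.{u}) : QG k T →ₗ[k] k :=
  ext fun A => if A = T.horiz.one (T.horiz.src A) then 1 else 0

instance : Coalgebra k (QG k T) where
  comul := comulLin k T
  counit := counitLin k T
  coassoc := by
    refine hom_ext fun A => ?_
    simp only [comulLin, LinearMap.comp_apply, ext_box, map_sum, LinearMap.rTensor_tmul,
      LinearMap.lTensor_tmul, LinearEquiv.coe_coe, TensorProduct.sum_tmul, TensorProduct.tmul_sum,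
      TensorProduct.assoc_tmul]
    rw [Finset.sum_sigma', Finset.sum_sigma']
    refine Finset.sum_bij'
      (fun x _ => (⟨⟨(x.2.1.1, T.horiz.comp x.2.1.2 x.1.1.2
        (x.2.2.tgt.symm.trans x.1.2.mid)), x.2.2.assoc (isComp_comp _ _ _) x.1.2⟩,
          ⟨(x.2.1.2, x.1.1.2), isComp_comp _ _ _⟩⟩ : Σ q : Dec A, Dec q.1.2))
      (fun x _ => (⟨⟨(T.horiz.comp x.1.1.1 x.2.1.1 (x.1.2.mid.trans x.2.2.src), x.2.1.2),
        (isComp_comp _ _ _).assoc' x.2.2 x.1.2⟩,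
          ⟨(x.1.1.1, x.2.1.1), isComp_comp _ _ _⟩⟩ : Σ q : Dec A, Dec q.1.1))
      (fun _ _ => Finset.mem_univ _) (fun _ _ => Finset.mem_univ _) ?_ ?_ ?_
    · rintro ⟨⟨⟨B, C⟩, w⟩, ⟨⟨D, E⟩, p, v⟩⟩ -
      dsimp only at v ⊢
      subst v
      rfl
    · rintro ⟨⟨⟨B, C⟩, w⟩, ⟨⟨D, E⟩, p, v⟩⟩ -
      dsimp only at v ⊢
      subst v
      rfl
    · rintro ⟨⟨⟨B, C⟩, w⟩, ⟨⟨D, E⟩, v⟩⟩ -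
      rfl
  rTensor_counit_comp_comul := by
    refine hom_ext fun A => ?_
    simp only [comulLin, counitLin, LinearMap.comp_apply, ext_box, map_sum, LinearMap.rTensor_tmul]
    rw [Fintype.sum_eq_single (⟨(T.horiz.one (T.horiz.src A), A), isComp_one_left A⟩ : Dec A)]
    · rw [if_pos (by rw [T.horiz.src_one])]; rfl
    · rintro ⟨⟨B, C⟩, w⟩ hne
      rw [if_neg, TensorProduct.zero_tmul]
      intro h
      apply hne
      have h' : B = T.horiz.one (T.horiz.src A) := by rw [w.src]; exact h
      dsimp only at w
      subst h'
      rw [Subtype.mk.injEq, w.eq_of_one_left]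
  lTensor_counit_comp_comul := by
    refine hom_ext fun A => ?_
    simp only [comulLin, counitLin, LinearMap.comp_apply, ext_box, map_sum, LinearMap.lTensor_tmul]
    rw [Fintype.sum_eq_single (⟨(A, T.horiz.one (T.horiz.tgt A)), isComp_one_right A⟩ : Dec A)]
    · rw [if_pos (by rw [T.horiz.src_one])]; rfl
    · rintro ⟨⟨B, C⟩, w⟩ hne
      rw [if_neg, TensorProduct.tmul_zero]
      intro h
      apply hne
      have h' : C = T.horiz.one (T.horiz.tgt A) := by
        rw [w.tgt]; dsimp only at h ⊢; rw [h, T.horiz.tgt_one]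
      dsimp only at w
      subst h'
      rw [Subtype.mk.injEq, w.eq_of_one_right]

open Coalgebra

theorem comul_box (A : T.Box) :
    comul (R := k) (box k A) = ∑ q : Dec A, box k q.1.1 ⊗ₜ[k] box k q.1.2 :=
  ext_box _ A

theorem counit_box (A : T.Box) : counit (R := k) (box k A) = if IsHone A then 1 else 0 :=
  ext_box _ A

/-- The idempotent of `kT` attached to a horizontal edge. -/
def idem (k : Type u) [Field k] {T : DoubleGroupoid.{u}} (x : T.Hor) : QG k T := box k (T.vert.one x)

theorem idem_mul_idem (x y : T.Hor) :
    idem k x * idem k y = if x = y then idem k x else 0 := by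
  rw [idem, idem, box_mul_box, boxMul_vone, T.vert.tgt_one]

theorem comul_one_aux {R : Type u} [Ring R] (f g : T.Hor × T.Hor → R) (F : T.Hor → T.Hor → T.Hor → R)
    (h : ∀ x y z, (if T.hor.tgt x = T.hor.src y then f (x, y) else 0) *
      (if T.hor.tgt y = T.hor.src z then g (y, z) else 0) =
        if T.hor.tgt x = T.hor.src y ∧ T.hor.tgt y = T.hor.src z then F x y z else 0)
    (h₀ : ∀ x y u z, y ≠ u → f (x, y) * g (u, z) = 0) :
    (∑ p : T.Hor × T.Hor, if T.hor.tgt p.1 = T.hor.src p.2 then f p else 0) *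
      (∑ p : T.Hor × T.Hor, if T.hor.tgt p.1 = T.hor.src p.2 then g p else 0) =
      ∑ x : T.Hor, ∑ y : T.Hor, ∑ z : T.Hor,
        if T.hor.tgt x = T.hor.src y ∧ T.hor.tgt y = T.hor.src z then F x y z else 0 := by
  rw [Fintype.sum_prod_type, Fintype.sum_prod_type, Finset.sum_mul]
  refine Finset.sum_congr rfl fun x _ => ?_
  rw [Finset.sum_mul]
  refine Finset.sum_congr rfl fun y _ => ?_
  rw [Finset.mul_sum, Fintype.sum_eq_single y, Finset.mul_sum]
  · exact Finset.sum_congr rfl fun z _ => h x y z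
  · intro u hu
    rw [Finset.mul_sum]
    refine Finset.sum_eq_zero fun z _ => ?_
    split_ifs
    · exact h₀ x y u z hu.symm
    · rw [mul_zero]
    · rw [zero_mul]
    · rw [zero_mul]

theorem idem_commute (x y : T.Hor) : Commute (idem k x) (idem k y) := by
  rw [Commute, SemiconjBy, idem_mul_idem, idem_mul_idem]
  by_cases h : x = y
  · subst h; rfl
  · rw [if_neg h, if_neg (Ne.symm h)]

variable [T.IsVacant]

theorem comul_boxMul (A B : T.Box) : comul (R := k) (boxMul k A B) =
    comul (R := k) (box k A) * comul (R := k) (box k B) := by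
  rw [comul_box, comul_box, Finset.sum_mul]
  simp only [Finset.mul_sum, Algebra.TensorProduct.tmul_mul_tmul, box_mul_box]
  by_cases p : T.vert.tgt A = T.vert.src B
  · have hC := isComp_comp A B p
    have key : ∀ q : Dec A, ∃ r : Dec B, ∃ s : Dec (T.vert.comp A B p),
        T.vert.IsComp q.1.1 r.1.1 s.1.1 ∧ T.vert.IsComp q.1.2 r.1.2 s.1.2 := by
      rintro ⟨⟨X, Y⟩, w⟩
      have h := bot_isComp w
      rw [p] at h
      obtain ⟨R, S, v, hR, hS⟩ := exists_split_top B h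
      obtain ⟨M, m₁, m₂⟩ := isComp_interchange w v (isComp_comp X R hR.symm)
        (isComp_comp Y S hS.symm)
      rw [m₁.eq hC] at m₂
      exact ⟨⟨(R, S), v⟩, ⟨(_, _), m₂⟩, isComp_comp _ _ _, isComp_comp _ _ _⟩
    choose r s h₁ h₂ using key
    rw [boxMul_isComp hC, comul_box]
    symm
    refine Fintype.sum_bijective s ⟨?_, ?_⟩ _ _ ?_
    · rintro q q' e
      have e₁ := (h₂ q).src
      have e₂ := (h₂ q').src
      rw [← e, e₁] at e₂
      obtain ⟨a, b⟩ := split_unique_top q.2 q'.2 e₂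
      exact Subtype.ext (Prod.ext a b)
    · intro t
      have h := top_isComp t.2
      rw [hC.src] at h
      obtain ⟨X, Y, w, hX, hY⟩ := exists_split_top A h
      refine ⟨⟨(X, Y), w⟩, ?_⟩
      obtain ⟨a, b⟩ := split_unique_top (s ⟨(X, Y), w⟩).2 t.2 ((h₂ ⟨(X, Y), w⟩).src.trans hY)
      exact Subtype.ext (Prod.ext a b)
    · intro q
      rw [Fintype.sum_eq_single (r q)]
      · rw [boxMul_isComp (h₁ q), boxMul_isComp (h₂ q)]
      · intro t ht
        by_cases e : T.vert.tgt q.1.2 = T.vert.src t.1.2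
        · exfalso
          apply ht
          obtain ⟨a, b⟩ := split_unique_top t.2 (r q).2 (e.symm.trans (h₂ q).mid)
          exact Subtype.ext (Prod.ext a b)
        · rw [boxMul_zero e, TensorProduct.tmul_zero]
  · rw [boxMul_zero p, map_zero]
    symm
    refine Finset.sum_eq_zero fun q _ => Finset.sum_eq_zero fun r _ => ?_
    by_cases e₁ : T.vert.tgt q.1.1 = T.vert.src r.1.1
    · by_cases e₂ : T.vert.tgt q.1.2 = T.vert.src r.1.2
      · exfalso
        apply p
        have h := bot_isComp q.2
        rw [e₁, e₂] at h
        exact h.eq (top_isComp r.2)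
      · rw [boxMul_zero e₂, TensorProduct.tmul_zero]
    · rw [boxMul_zero e₁, TensorProduct.zero_tmul]

theorem comul_idem (z : T.Hor) : comul (R := k) (idem k z) =
    ∑ x : T.Hor, ∑ y : T.Hor, if T.hor.IsComp x y z then idem k x ⊗ₜ[k] idem k y else 0 := by
  rw [idem, comul_box, ← Fintype.sum_prod_type', ← Finset.sum_filter]
  refine Finset.sum_bij' (fun q _ => (T.vert.src q.1.1, T.vert.src q.1.2))
    (fun p hp => ⟨(T.vert.one p.1, T.vert.one p.2), isComp_vone (Finset.mem_filter.1 hp).2⟩)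
    ?_ (fun _ _ => Finset.mem_univ _) ?_ ?_ ?_
  · intro q _
    have h := top_isComp q.2
    rw [T.vert.src_one] at h
    exact Finset.mem_filter.2 ⟨Finset.mem_univ _, h⟩
  · intro q _
    obtain ⟨a, b⟩ := split_vone q.2
    exact Subtype.ext (Prod.ext a.symm b.symm)
  · intro p _
    exact Prod.ext (T.vert.src_one _) (T.vert.src_one _)
  · intro q _
    obtain ⟨a, b⟩ := split_vone q.2
    simp only [idem]
    rw [← a, ← b]

theorem comul_one : comul (R := k) (1 : QG k T) = ∑ x : T.Hor, ∑ y : T.Hor,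
    if T.hor.tgt x = T.hor.src y then idem k x ⊗ₜ[k] idem k y else 0 := by
  have h : (1 : QG k T) = ∑ z : T.Hor, idem k z := one_def
  rw [h, map_sum]
  simp only [comul_idem]
  rw [Finset.sum_comm]
  refine Finset.sum_congr rfl fun x _ => ?_
  rw [Finset.sum_comm]
  refine Finset.sum_congr rfl fun y _ => ?_
  split_ifs with h
  · rw [Fintype.sum_eq_single (T.hor.comp x y h), if_pos (isComp_comp x y h)]
    intro z hz
    rw [if_neg]
    exact fun w => hz (w.eq (isComp_comp x y h))
  · exact Finset.sum_eq_zero fun z _ => if_neg fun w => h w.mid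

theorem sum_comm₄ {X M : Type u} [Fintype X] [AddCommMonoid M] (F : X → X → X → X → M) :
    ∑ x, ∑ y, ∑ a, ∑ b, F x y a b = ∑ a, ∑ b, ∑ y, ∑ x, F x y a b := by
  have h : ∀ x, ∑ y, ∑ a, ∑ b, F x y a b = ∑ a, ∑ b, ∑ y, F x y a b := by
    intro x
    rw [Finset.sum_comm]
    exact Finset.sum_congr rfl fun a _ => Finset.sum_comm
  simp only [h]
  rw [Finset.sum_comm]
  refine Finset.sum_congr rfl fun a _ => ?_
  rw [Finset.sum_comm]
  exact Finset.sum_congr rfl fun b _ => Finset.sum_comm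

theorem comul_comul_one :
    (comul (R := k) (A := QG k T)).rTensor (QG k T) (comul (R := k) 1) =
      ∑ x : T.Hor, ∑ y : T.Hor, ∑ z : T.Hor,
        if T.hor.tgt x = T.hor.src y ∧ T.hor.tgt y = T.hor.src z then
          (idem k x ⊗ₜ[k] idem k y) ⊗ₜ[k] idem k z else 0 := by
  rw [comul_one]
  simp only [map_sum, apply_ite (LinearMap.rTensor _ _), LinearMap.rTensor_tmul, map_zero,
    comul_idem, TensorProduct.sum_tmul, TensorProduct.ite_tmul]
  have e : ∀ (c : Prop) [Decidable c] (f : T.Hor → T.Hor → (QG k T ⊗[k] QG k T) ⊗[k] QG k T),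
      (if c then ∑ a, ∑ b, f a b else 0) = ∑ a, ∑ b, if c then f a b else 0 := by
    intro c _ f
    split_ifs <;> simp
  simp only [e]
  rw [sum_comm₄]
  refine Finset.sum_congr rfl fun x _ => Finset.sum_congr rfl fun y _ =>
    Finset.sum_congr rfl fun z _ => ?_
  split_ifs with h
  · have w := isComp_comp x y h.1
    rw [Fintype.sum_eq_single _ ?_, if_pos, if_pos w]
    · rw [w.tgt, h.2]
    · intro u hu
      split_ifs with h₁ h₂
      · exact absurd (h₂.eq w) hu
      · rfl
      · rfl
  · refine Finset.sum_eq_zero fun u _ => ?_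
    split_ifs with h₁ h₂
    · exact absurd ⟨h₂.mid, h₂.tgt.symm.trans h₁⟩ h
    · rfl
    · rfl

theorem comul_one_eq : comul (R := k) (1 : QG k T) = ∑ p : T.Hor × T.Hor,
    if T.hor.tgt p.1 = T.hor.src p.2 then idem k p.1 ⊗ₜ[k] idem k p.2 else 0 := by
  rw [comul_one, Fintype.sum_prod_type]

theorem comul_one_tmul_one : comul (R := k) (1 : QG k T) ⊗ₜ[k] (1 : QG k T) =
    ∑ p : T.Hor × T.Hor, if T.hor.tgt p.1 = T.hor.src p.2 then
      (idem k p.1 ⊗ₜ[k] idem k p.2) ⊗ₜ[k] (1 : QG k T) else 0 := by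
  rw [comul_one_eq, TensorProduct.sum_tmul]
  simp only [TensorProduct.ite_tmul]

theorem one_tmul_comul_one :
    (TensorProduct.assoc k (QG k T) (QG k T) (QG k T)).symm
      ((1 : QG k T) ⊗ₜ[k] comul (R := k) (1 : QG k T)) =
    ∑ p : T.Hor × T.Hor, if T.hor.tgt p.1 = T.hor.src p.2 then
      ((1 : QG k T) ⊗ₜ[k] idem k p.1) ⊗ₜ[k] idem k p.2 else 0 := by
  rw [comul_one_eq, TensorProduct.tmul_sum, map_sum]
  refine Finset.sum_congr rfl fun p _ => ?_
  split_ifs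
  · rw [TensorProduct.assoc_symm_tmul]
  · rw [TensorProduct.tmul_zero, map_zero]

theorem comul_one_mul_comul_one :
    (comul (R := k) (A := QG k T)).rTensor (QG k T) (comul (R := k) 1) =
      (comul (R := k) (1 : QG k T) ⊗ₜ[k] (1 : QG k T)) *
        (TensorProduct.assoc k (QG k T) (QG k T) (QG k T)).symm
          ((1 : QG k T) ⊗ₜ[k] comul (R := k) (1 : QG k T)) := by
  rw [comul_comul_one, comul_one_tmul_one, one_tmul_comul_one]
  symm
  refine comul_one_aux (R := (QG k T ⊗[k] QG k T) ⊗[k] QG k T)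
    (fun p => (idem k p.1 ⊗ₜ[k] idem k p.2) ⊗ₜ[k] (1 : QG k T))
    (fun p => ((1 : QG k T) ⊗ₜ[k] idem k p.1) ⊗ₜ[k] idem k p.2) _ ?_ ?_
  · intro x y z
    by_cases h₁ : T.hor.tgt x = T.hor.src y
    · by_cases h₂ : T.hor.tgt y = T.hor.src z
      · rw [if_pos h₁, if_pos h₂, if_pos ⟨h₁, h₂⟩]
        simp only [Algebra.TensorProduct.tmul_mul_tmul, mul_one, one_mul, idem_mul_idem, if_true]
      · rw [if_neg h₂, mul_zero]
        exact (if_neg fun h => h₂ h.2).symm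
    · rw [if_neg h₁, zero_mul]
      exact (if_neg fun h => h₁ h.1).symm
  · intro x y u z h
    simp only [Algebra.TensorProduct.tmul_mul_tmul, mul_one, one_mul, idem_mul_idem, if_neg h,
      TensorProduct.tmul_zero, TensorProduct.zero_tmul]

theorem comul_one_commute : Commute (comul (R := k) (1 : QG k T) ⊗ₜ[k] (1 : QG k T))
    ((TensorProduct.assoc k (QG k T) (QG k T) (QG k T)).symm
      ((1 : QG k T) ⊗ₜ[k] comul (R := k) (1 : QG k T))) := by
  rw [comul_one_tmul_one, one_tmul_comul_one]
  refine Commute.sum_left (R := (QG k T ⊗[k] QG k T) ⊗[k] QG k T) _ _ _ fun p _ =>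
    Commute.sum_right (R := (QG k T ⊗[k] QG k T) ⊗[k] QG k T) _ _ _ fun q _ => ?_
  refine ite_commute (R := (QG k T ⊗[k] QG k T) ⊗[k] QG k T) ?_
  rw [Commute, SemiconjBy]
  simp only [Algebra.TensorProduct.tmul_mul_tmul, mul_one, one_mul]
  rw [(idem_commute p.2 q.1).eq]

theorem counit_boxMul (A B : T.Box) : counit (R := k) (boxMul k A B) =
    if T.vert.tgt A = T.vert.src B ∧ IsHone A ∧ IsHone B then 1 else 0 := by
  by_cases p : T.vert.tgt A = T.vert.src B
  · have w := isComp_comp A B p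
    rw [boxMul_isComp w, counit_box]
    refine if_congr ?_ rfl rfl
    rw [isHone_comp_iff w, ← isHone_iff_bot p]
    tauto
  · rw [boxMul_zero p, map_zero, if_neg fun h => p h.1]

theorem counit_triple (A B C : T.Box) : counit (R := k) (boxMul k A B * box k C) =
    if (T.vert.tgt A = T.vert.src B ∧ T.vert.tgt B = T.vert.src C) ∧
      (IsHone A ∧ IsHone B ∧ IsHone C) then 1 else 0 := by
  by_cases p : T.vert.tgt A = T.vert.src B
  · have w := isComp_comp A B p
    rw [boxMul_isComp w, box_mul_box, counit_boxMul]
    refine if_congr ?_ rfl rfl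
    rw [w.tgt, isHone_comp_iff w, ← isHone_iff_bot p]
    tauto
  · rw [boxMul_zero p, zero_mul, map_zero, if_neg fun h => p h.1.1]

theorem counit_dec (A B C : T.Box) :
    ∑ q : Dec B, counit (R := k) (boxMul k A q.1.1) * counit (R := k) (boxMul k q.1.2 C) =
      counit (R := k) (boxMul k A B * box k C) := by
  rw [counit_triple]
  simp only [counit_boxMul]
  split_ifs with h
  · obtain ⟨⟨h₁, h₂⟩, hA, hB, hC⟩ := h
    rw [Fintype.sum_eq_single (⟨(B, B), isComp_self_of_isHone hB⟩ : Dec B)]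
    · rw [if_pos ⟨h₁, hA, hB⟩, if_pos ⟨h₂, hB, hC⟩, mul_one]
    · intro q hq
      split_ifs with h₃ h₄
      · obtain ⟨a, b⟩ := eq_of_isHone q.2 h₃.2.2 h₄.2.1
        exact absurd (Subtype.ext (Prod.ext a b)) hq
      all_goals simp
  · refine Finset.sum_eq_zero fun q _ => ?_
    split_ifs with h₃ h₄
    · obtain ⟨a, b⟩ := eq_of_isHone q.2 h₃.2.2 h₄.2.1
      rw [a] at h₃
      rw [b] at h₄
      exact absurd ⟨⟨h₃.1, h₄.1⟩, h₃.2.1, h₃.2.2, h₄.2.2⟩ h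
    all_goals simp

theorem counit_dec_right (A B C : T.Box) :
    ∑ q : Dec B, counit (R := k) (boxMul k q.1.1 C) * counit (R := k) (boxMul k A q.1.2) =
      counit (R := k) (boxMul k A B * box k C) := by
  rw [counit_triple]
  simp only [counit_boxMul]
  split_ifs with h
  · obtain ⟨⟨h₁, h₂⟩, hA, hB, hC⟩ := h
    rw [Fintype.sum_eq_single (⟨(B, B), isComp_self_of_isHone hB⟩ : Dec B)]
    · rw [if_pos ⟨h₂, hB, hC⟩, if_pos ⟨h₁, hA, hB⟩, mul_one]
    · intro q hq
      split_ifs with h₃ h₄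
      · obtain ⟨a, b⟩ := eq_of_isHone q.2 h₃.2.1 h₄.2.2
        exact absurd (Subtype.ext (Prod.ext a b)) hq
      all_goals simp
  · refine Finset.sum_eq_zero fun q _ => ?_
    split_ifs with h₃ h₄
    · obtain ⟨a, b⟩ := eq_of_isHone q.2 h₃.2.1 h₄.2.2
      rw [a] at h₃
      rw [b] at h₄
      exact absurd ⟨⟨h₄.1, h₃.1⟩, h₄.2.1, h₄.2.2, h₃.2.2⟩ h
    all_goals simp

/-- For a finite vacant double groupoid, `kT` is a weak bialgebra. -/
instance : WeakBialgebra k (QG k T) where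
  comul_mul a b := by
    induction a using ind with
    | zero => simp only [zero_mul, map_zero]
    | add a a' h h' => simp only [add_mul, map_add, h, h']
    | smul r A =>
      induction b using ind with
      | zero => simp only [mul_zero, map_zero]
      | add a a' h h' => simp only [mul_add, map_add, h, h']
      | smul s B =>
        simp only [smul_mul_assoc, mul_smul_comm, map_smul, box_mul_box, comul_boxMul]
  comul_one_left := comul_one_mul_comul_one
  comul_one_right := comul_one_mul_comul_one.trans comul_one_commute.eq
  counit_mul_left a b c := by
    induction b using ind with
    | zero => simp only [mul_zero, zero_mul, map_zero]
    | add a a' h h' => simp only [mul_add, add_mul, map_add, h, h']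
    | smul s B =>
      simp only [mul_smul_comm, smul_mul_assoc, map_smul, comul_box, map_sum,
        TensorProduct.map_tmul, LinearMap.mul'_apply, LinearMap.comp_apply,
        LinearMap.mulLeft_apply, LinearMap.mulRight_apply]
      congr 1
      induction a using ind with
      | zero => simp only [zero_mul, map_zero, Finset.sum_const_zero]
      | add a a' h h' => simp only [add_mul, map_add, Finset.sum_add_distrib, h, h']
      | smul r A =>
        simp only [smul_mul_assoc, map_smul, ← Finset.smul_sum]
        congr 1
        induction c using ind with
        | zero => simp only [mul_zero, map_zero, Finset.sum_const_zero]
        | add a a' h h' => simp only [mul_add, map_add, Finset.sum_add_distrib, h, h']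
        | smul t C =>
          simp only [mul_smul_comm, map_smul, ← Finset.smul_sum, box_mul_box, counit_dec]
  counit_mul_right a b c := by
    induction b using ind with
    | zero => simp only [mul_zero, zero_mul, map_zero]
    | add a a' h h' => simp only [mul_add, add_mul, map_add, h, h']
    | smul s B =>
      simp only [mul_smul_comm, smul_mul_assoc, map_smul, comul_box, map_sum,
        TensorProduct.map_tmul, LinearMap.mul'_apply, LinearMap.comp_apply,
        LinearMap.mulLeft_apply, LinearMap.mulRight_apply]
      congr 1
      induction a using ind with
      | zero => simp only [zero_mul, mul_zero, map_zero, Finset.sum_const_zero]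
      | add a a' h h' => simp only [add_mul, mul_add, map_add, Finset.sum_add_distrib, h, h']
      | smul r A =>
        simp only [smul_mul_assoc, mul_smul_comm, map_smul, ← Finset.smul_sum]
        congr 1
        induction c using ind with
        | zero => simp only [mul_zero, zero_mul, map_zero, Finset.sum_const_zero]
        | add a a' h h' => simp only [mul_add, add_mul, map_add, Finset.sum_add_distrib, h, h']
        | smul t C =>
          simp only [mul_smul_comm, smul_mul_assoc, map_smul, ← Finset.smul_sum, box_mul_box,
            counit_dec_right]

end

end QG

/-- A multifusion category over `k`: an abelian `k`-linear category with `k`-bilinear tensor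
product, which is rigid, semisimple (every object is a finite direct sum of simple objects), has
finitely many isomorphism classes of simple objects, and finite-dimensional hom-spaces. -/
structure IsMultifusion (k C : Type*) [Field k] [Category* C] [Preadditive C] [Linear k C]
    [MonoidalCategory C] : Prop where
  abelian : ∃ a : Abelian C, a.toPreadditive = ‹Preadditive C›
  tensor_additive : MonoidalPreadditive C
  tensor_linear : MonoidalLinear k C
  rigid : Nonempty (RigidCategory C)
  semisimple : ∀ X : C, ∃ (n : ℕ) (S : Fin n → C) (b : Limits.Bicone S),
    (∀ i, Simple (S i)) ∧ Nonempty b.IsBilimit ∧ Nonempty (X ≅ b.pt)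
  finite_simples : ∃ (n : ℕ) (S : Fin n → C), ∀ X : C, Simple X → ∃ i, Nonempty (X ≅ S i)
  finiteDimensional_hom : ∀ X Y : C, FiniteDimensional k (X ⟶ Y)

/-! ### Simple and semisimple modules among finitely generated modules. -/

section ModuleCategories

variable {A : Type u} [Ring A]

/-! Bundles and representations of `kT` are the same thing. The vertical identity boxes are
orthogonal idempotents of `kT` with sum 1, so a representation splits into their images; this is a
grading by horizontal edges, and a box carries the component at its bottom to the component at its
top. Conversely the direct sum of the fibres of a bundle is a representation. This gives the
equivalence `TBund.reprFunctor`.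

Semisimplicity is Maschke's theorem for the vertical groupoid (`QG.isSemisimpleRing`). A linear
projection is averaged over all boxes, each weighted by the inverse of the number of boxes with the
same top edge; this is where characteristic zero enters. Bundles are thus equivalent to finitely
generated modules over a semisimple ring, and abelianness, decompositions into simples and
finiteness of the set of simples (all of them occur in the regular module) are pulled back along the
equivalence.

Compatibility with tensor products rests on vacancy: a horizontal decomposition A = BC is determined
by the induced decomposition of the bottom edge, or of the top edge. Hence at most one summand of
Δ(A) acts non-trivially on a tensor v ⊗ w of homogeneous vectors, and Δ(1) projects the tensor
product of the total spaces onto the span of those v ⊗ w whose degrees are composable. That span is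
the total space of the tensor product of bundles (`tensoratorInv_tensorator`). For the units, ε_t
kills every box that is not a horizontal identity and depends only on the top end of g on the
identity box of g; this identifies the target subalgebra with the span of the vectors _P 1
(`unitMap_epsT`, `unitInv_unitMap`).

Rigidity is proved directly on bundles. Evaluation pairs V* in degree x with V in degree x⁻¹, and
coevaluation sends _P 1 to the sum, over the edges x with left end P, of the canonical elements of
V_x ⊗ (V_x)*. Both maps are equivariant because a decomposition BC of a horizontal identity has C
the horizontal inverse of B, so that C acts on the dual by the inverse transpose of B (`act_canon`,
`pairing_act_act`). The triangle identities become dual basis expansions in single fibres. Since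
inverting a box in both directions is an involution, V is isomorphic to V**, and V* is a dual on the
other side too. -/

theorem FGModuleCat.simple_of_isSimpleModule [IsNoetherianRing A] (M : FGModuleCat.{u} A)
    [IsSimpleModule A M] : Simple M where
  mono_isIso_iff_nonzero {Y} f hf := by
    constructor
    · rintro h rfl
      have := IsSimpleModule.nontrivial A M
      obtain ⟨m, hm⟩ := exists_ne (0 : M)
      apply hm
      -- An invertible zero map would make the identity of `M` zero.
      have h' := congrArg (fun g => g.hom.hom m) (IsIso.inv_hom_id (0 : Y ⟶ M))
      simpa using h'.symm
    · intro h
      -- Monomorphisms survive the inclusion into all modules, where they are the injective maps.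
      have h₁ : Function.Injective f.hom.hom :=
        (ModuleCat.mono_iff_injective ((forget₂ (FGModuleCat A) (ModuleCat A)).map f)).1
          inferInstance
      have h₂ : LinearMap.range f.hom.hom = ⊤ := by
        rcases eq_bot_or_eq_top (LinearMap.range f.hom.hom) with h' | h'
        · exact absurd (FGModuleCat.hom_ext (LinearMap.range_eq_bot.1 h')) h
        · exact h'
      let e := (LinearEquiv.ofBijective f.hom.hom
        ⟨h₁, LinearMap.range_eq_top.1 h₂⟩).toFGModuleCatIso
      exact inferInstanceAs (IsIso e.hom)

/-- Finite generation leaves only finitely many summands in the decomposition of a semisimple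
module. It is recorded by injections and projections with the biproduct relations because equations
between morphisms can be pulled back along a fully faithful additive functor. -/
theorem FGModuleCat.exists_sum_simples [IsSemisimpleRing A] (M : FGModuleCat.{u} A) :
    ∃ (n : ℕ) (S : Fin n → FGModuleCat.{u} A) (ι : ∀ i, S i ⟶ M) (π : ∀ i, M ⟶ S i),
      (∀ i, Simple (S i)) ∧ (∀ i, ι i ≫ π i = 𝟙 _) ∧ (∀ i j, i ≠ j → ι i ≫ π j = 0) ∧
        ∑ i, π i ≫ ι i = 𝟙 M := by
  obtain ⟨n, S, e, hS⟩ := IsSemisimpleModule.exists_linearEquiv_fin_dfinsupp A M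
  refine ⟨n, fun i => FGModuleCat.of A (S i),
    fun i => FGModuleCat.ofHom
      (e.symm.toLinearMap ∘ₗ DFinsupp.lsingle (R := A) (M := fun i => S i) i),
    fun i => FGModuleCat.ofHom
      (DFinsupp.lapply (R := A) (M := fun i => S i) i ∘ₗ e.toLinearMap), ?_, ?_, ?_, ?_⟩
  · intro i
    exact FGModuleCat.simple_of_isSimpleModule (FGModuleCat.of A (S i))
  · intro i
    apply FGModuleCat.hom_ext
    refine LinearMap.ext fun x => ?_
    change (e (e.symm (DFinsupp.single i x))) i = x
    simp
  · intro i j h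
    apply FGModuleCat.hom_ext
    refine LinearMap.ext fun x => ?_
    change (e (e.symm (DFinsupp.single i x))) j = 0
    rw [LinearEquiv.apply_symm_apply, DFinsupp.single_eq_of_ne h.symm]
  · apply FGModuleCat.hom_ext
    refine LinearMap.ext fun x => ?_
    -- Evaluation at `x` is additive in the morphism, so the last relation becomes the statement
    -- that `e x` is the sum of its components.
    have : ∀ (s : Finset (Fin n)) (f : Fin n → (M ⟶ M)),
        (∑ i ∈ s, f i).hom.hom x = ∑ i ∈ s, (f i).hom.hom x := by
      intro s f
      classical
      induction s using Finset.induction_on with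
      | empty => simp
      | insert a s ha ih => rw [Finset.sum_insert ha, Finset.sum_insert ha, ← ih]; rfl
    rw [this]
    change ∑ i, e.symm (DFinsupp.single i (e x i)) = x
    rw [← map_sum, LinearEquiv.symm_apply_eq]
    ext i
    simp [DFinsupp.finsetSum_apply, DFinsupp.single_apply]

end ModuleCategories

/-! ### Pulling the abelian and semisimple structure back along an equivalence. -/

section Transfer

variable {C : Type*} [Category* C] [Preadditive C]

/-- Simplicity speaks of monomorphisms, isomorphisms and zero morphisms; the equivalence preserves
the first and reflects the other two. -/
theorem Simple.of_equivalence {D : Type*} [Category* D] [Preadditive D] (G : C ⥤ D)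
    [G.IsEquivalence] [G.PreservesZeroMorphisms] (X : C) [Simple (G.obj X)] : Simple X where
  mono_isIso_iff_nonzero f _ := by
    rw [← isIso_iff_of_reflects_iso f G, Simple.mono_isIso_iff_nonzero (G.map f), Ne, Ne,
      G.map_eq_zero_iff]

variable {A : Type u} [Ring A]

/-- Finitely generated modules over a Noetherian ring form an abelian category, and abelianness
passes along equivalences. The equation in the conclusion ensures that the abelian structure uses
the given addition of morphisms. -/
theorem exists_abelian_of_equivalence [IsNoetherianRing A] (G : C ⥤ FGModuleCat.{u} A)
    [G.IsEquivalence] : ∃ a : Abelian C, a.toPreadditive = ‹Preadditive C› := by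
  have : Limits.HasFiniteProducts C :=
    ⟨fun n => Adjunction.hasLimitsOfShape_of_equivalence G⟩
  exact ⟨abelianOfEquivalence G, rfl⟩

variable [IsSemisimpleRing A]

/-- The biproduct relations for `G.obj X` are lifted by full faithfulness, with preimages of the
simple modules as summands. The apex is `X` on the nose. -/
theorem exists_bicone_of_equivalence (G : C ⥤ FGModuleCat.{u} A) [G.IsEquivalence] [G.Additive]
    (X : C) :
    ∃ (n : ℕ) (S : Fin n → C) (b : Limits.Bicone S),
      (∀ i, Simple (S i)) ∧ Nonempty b.IsBilimit ∧ b.pt = X := by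
  obtain ⟨n, S, ι, π, hS, h₁, h₂, h₃⟩ := FGModuleCat.exists_sum_simples (G.obj X)
  let e := fun i => G.objObjPreimageIso (S i)
  let b : Limits.Bicone (fun i => G.objPreimage (S i)) :=
    { pt := X
      π := fun i => G.preimage (π i ≫ (e i).inv)
      ι := fun i => G.preimage ((e i).hom ≫ ι i)
      ι_π := fun i j => by
        apply G.map_injective
        split_ifs with h
        · subst h
          simp [reassoc_of% h₁ i]
        · have := h₂ i j h
          simp [reassoc_of% this] }
  refine ⟨n, _, b, fun i => ?_, ⟨Limits.isBilimitOfTotal b ?_⟩, rfl⟩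
  · have := Simple.of_iso (e i)
    exact Simple.of_equivalence G _
  · apply G.map_injective
    simp [b, G.map_sum, h₃]

/-- The list consists of the simple summands of the regular module. A non-zero element of a simple
module defines a non-zero map from `A`, which is non-zero on some simple summand, and by Schur's
lemma it is an isomorphism there. -/
theorem exists_simples_of_equivalence (G : C ⥤ FGModuleCat.{u} A) [G.IsEquivalence]
    [G.Additive] :
    ∃ (n : ℕ) (S : Fin n → C), ∀ X : C, Simple X → ∃ i, Nonempty (X ≅ S i) := by
  let e := G.objObjPreimageIso (FGModuleCat.of A A)
  obtain ⟨n, S, b, hS, ⟨hb⟩, hP⟩ := exists_bicone_of_equivalence G (G.objPreimage (.of A A))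
  refine ⟨n, S, fun X hX => ?_⟩
  -- Schur's lemma needs kernels; these come from the abelian structure, whose addition is now
  -- identified with the given one.
  obtain ⟨a, ha⟩ := exists_abelian_of_equivalence G
  subst ha
  -- If `G.obj X` were the zero module, the identity of `X` would vanish, against simplicity.
  obtain ⟨x, hx⟩ : ∃ x : G.obj X, x ≠ 0 := by
    by_contra! h
    refine id_nonzero X (G.map_injective ?_)
    apply FGModuleCat.hom_ext
    exact LinearMap.ext fun x => (h _).trans (h _).symm
  let f : FGModuleCat.of A A ⟶ G.obj X := FGModuleCat.ofHom (LinearMap.toSpanSingleton A _ x)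
  have hf : f ≠ 0 := fun h => hx (by
    have := congrArg (fun g => g.hom.hom (1 : A)) h
    exact (one_smul A x).symm.trans this)
  let g : b.pt ⟶ X := eqToHom hP ≫ G.preimage (e.hom ≫ f)
  have hg : g ≠ 0 := by
    intro h
    apply hf
    have h' := congrArg (fun t => e.inv ≫ G.map (eqToHom hP.symm ≫ t)) h
    simpa [g] using h'
  obtain ⟨i, hi⟩ : ∃ i, b.ι i ≫ g ≠ 0 := by
    by_contra! h
    exact hg (hb.isColimit.hom_ext fun j => by simpa using h j.as)
  have := hS i
  have : IsIso (b.ι i ≫ g) := isIso_of_hom_simple hi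
  exact ⟨i, ⟨(asIso (b.ι i ≫ g)).symm⟩⟩

end Transfer

/-! ### Representations of a finite-dimensional algebra as finitely generated modules. -/

namespace FDRepr

noncomputable section

variable {k A : Type u} [Field k] [Ring A] [Algebra k A]

/-- The underlying module of a representation. -/
abbrev toModule (V : FDRepr k A) : Module A V.carrier := Module.compHom V.carrier V.ρ.toRingHom

attribute [local instance] toModule

theorem smul_eq (V : FDRepr k A) (a : A) (v : V.carrier) : a • v = V.ρ a v := rfl

instance isScalarTower (V : FDRepr k A) : IsScalarTower k A V.carrier where
  smul_assoc c a v := by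
    rw [smul_eq, smul_eq, map_smul, LinearMap.smul_apply]

/-- The functor from finite-dimensional representations of a `k`-algebra `A` to finitely generated
`A`-modules. -/
def toFGModuleCat (k A : Type u) [Field k] [Ring A] [Algebra k A] :
    FDRepr k A ⥤ FGModuleCat.{u} A where
  obj V :=
    have : Module.Finite A V.carrier := Module.Finite.of_restrictScalars_finite k A V.carrier
    FGModuleCat.of A V.carrier
  map {V W} f :=
    have : Module.Finite A V.carrier := Module.Finite.of_restrictScalars_finite k A V.carrier
    have : Module.Finite A W.carrier := Module.Finite.of_restrictScalars_finite k A W.carrier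
    FGModuleCat.ofHom { f.lin with map_smul' := f.comm }

instance : (toFGModuleCat k A).Additive where
  map_add := rfl

instance : (toFGModuleCat k A).Faithful where
  map_injective {V W f g} h := by
    ext v
    exact congrArg (fun f => f.hom.hom v) h

/-- The scalars in `k` act through `A`, so every `A`-linear map is automatically `k`-linear. -/
instance : (toFGModuleCat k A).Full where
  map_surjective {V W} f := by
    let g : V.carrier →ₗ[A] W.carrier := f.hom.hom
    exact ⟨⟨g.restrictScalars k, fun a v => g.map_smul a v⟩, rfl⟩

/-- A finitely generated module over a finite-dimensional algebra becomes a finite-dimensional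
vector space by restricting scalars along `k → A`. -/
instance [FiniteDimensional k A] : (toFGModuleCat k A).EssSurj where
  mem_essImage M := by
    let : Module k M := Module.compHom M (algebraMap k A)
    have : IsScalarTower k A M := ⟨fun c a m => by
      rw [Algebra.smul_def, mul_smul]; rfl⟩
    have : FiniteDimensional k M := Module.Finite.trans A M
    let V : FDRepr k A := { carrier := M, ρ := Algebra.lsmul k k M }
    -- The isomorphism is the identity on elements: the action recovered from `V` is the original
    -- one by definition.
    exact ⟨V, ⟨(ModuleCat.isFG A).isoMk (LinearEquiv.toModuleIso (X₁ := V.carrier) (X₂ := M)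
      { AddEquiv.refl M with map_smul' := fun _ _ => rfl })⟩⟩

instance [FiniteDimensional k A] : (toFGModuleCat k A).IsEquivalence where

end

end FDRepr

/-! ### Maschke's theorem for the vertical groupoid. -/

namespace QG

noncomputable section

open scoped Classical
open DoubleGroupoid ArrowGroupoid

attribute [local instance] Fintype.ofFinite

variable {k : Type u} [Field k] {T : DoubleGroupoid.{u}}

theorem box_mul_inv (A : T.Box) : box k A * box k (T.vert.inv A) = idem k (T.vert.src A) := by
  rw [box_mul_box, boxMul_isComp (isComp_inv_right A), idem]

variable [T.IsFinite]

/-- The number of boxes with a given top edge. -/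
def topCard (T : DoubleGroupoid.{u}) [T.IsFinite] (x : T.Hor) : ℕ :=
  Fintype.card {A : T.Box // T.vert.src A = x}

theorem topCard_ne_zero (x : T.Hor) : topCard T x ≠ 0 :=
  have : Nonempty {A : T.Box // T.vert.src A = x} := ⟨T.vert.one x, T.vert.src_one x⟩
  Fintype.card_ne_zero

/-- Composition with a box is a bijection on the boxes with suitable top edges. -/
def compEquiv (B : T.Box) : {A : T.Box // T.vert.src A = T.vert.tgt B} ≃
    {A : T.Box // T.vert.src A = T.vert.src B} where
  toFun A := ⟨T.vert.comp B A.1 A.2.symm, T.vert.src_comp _ _ _⟩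
  invFun A := ⟨T.vert.comp (T.vert.inv B) A.1 ((T.vert.tgt_inv B).trans A.2.symm),
    (T.vert.src_comp _ _ _).trans (T.vert.src_inv B)⟩
  left_inv A := Subtype.ext
    ((isComp_comp _ _ _).eq (isComp_comp B A.1 A.2.symm).inv_left)
  right_inv A := Subtype.ext (by
    have h := (isComp_comp (T.vert.inv B) A.1 ((T.vert.tgt_inv B).trans A.2.symm)).inv_left
    rw [ArrowGroupoid.inv_inv] at h
    exact (isComp_comp _ _ _).eq h)

/-- The number of boxes out of an edge is constant on the connected components of the vertical
groupoid. This makes the averaging weights invariant under composition with `B`. -/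
theorem topCard_src (B : T.Box) : topCard T (T.vert.src B) = topCard T (T.vert.tgt B) :=
  (Fintype.card_congr (compEquiv B)).symm

section Average

variable {M N : Type u} [AddCommGroup M] [Module k M] [Module (QG k T) M]
  [IsScalarTower k (QG k T) M] [AddCommGroup N] [Module k N] [Module (QG k T) N]
  [IsScalarTower k (QG k T) N]

/-- The average of a linear map over the boxes. -/
def average (p : M →ₗ[k] N) : M →ₗ[k] N :=
  ∑ A : T.Box, ((topCard T (T.vert.src A) : k)⁻¹) •
    (Algebra.lsmul k k N (box k A) ∘ₗ p ∘ₗ Algebra.lsmul k k M (box k (T.vert.inv A)))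

theorem average_apply (p : M →ₗ[k] N) (m : M) : average (T := T) p m =
    ∑ A : T.Box, ((topCard T (T.vert.src A) : k)⁻¹) •
      box k A • p (box k (T.vert.inv A) • m) := by
  simp [average, LinearMap.sum_apply]

/-- The usual substitution A ↦ BA in the average: B · A p(A⁻¹ m) equals (BA) p((BA)⁻¹ B m), and A
and BA carry the same weight. In a groupoid both sums must first be cut down to the boxes whose
terms are composable with `B`, namely those with the top of `B` as top edge on the left and those
with the bottom of `B` on the right. -/
theorem average_box_smul (p : M →ₗ[k] N) (B : T.Box) (m : M) :
    average (T := T) p (box k B • m) = box k B • average (T := T) p m := by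
  have key : ∀ (F : T.Box → N) (x : T.Hor), (∀ A, T.vert.src A ≠ x → F A = 0) →
      ∑ A, F A = ∑ A : {A : T.Box // T.vert.src A = x}, F A := by
    intro F x h
    rw [← Finset.sum_subtype (Finset.univ.filter fun A => T.vert.src A = x) (by simp) F]
    exact (Finset.sum_filter_of_ne fun A _ hA => not_not.1 fun h' => hA (h A h')).symm
  rw [average_apply, average_apply, Finset.smul_sum, key _ (T.vert.src B), key _ (T.vert.tgt B)]
  · refine (Fintype.sum_equiv (compEquiv B) _ _ fun A => ?_).symm
    have w := isComp_comp B A.1 A.2.symm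
    change box k B • (topCard T (T.vert.src A.1) : k)⁻¹ •
        box k A.1 • p (box k (T.vert.inv A.1) • m) =
      (topCard T (T.vert.src (T.vert.comp B A.1 _)) : k)⁻¹ • box k (T.vert.comp B A.1 _) •
        p (box k (T.vert.inv (T.vert.comp B A.1 _)) • box k B • m)
    rw [T.vert.src_comp, A.2, topCard_src, smul_comm (box k B), ← SemigroupAction.mul_smul (box k B),
      ← SemigroupAction.mul_smul,
      box_mul_box, box_mul_box, boxMul_isComp w]
    -- From BA = C follows C⁻¹B = A⁻¹.
    have w' := w.inv.inv_right
    rw [ArrowGroupoid.inv_inv] at w'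
    rw [boxMul_isComp w']
  · intro A hA
    rw [smul_comm (box k B), ← SemigroupAction.mul_smul (box k B), box_mul_box,
      boxMul_zero (Ne.symm hA), zero_smul, smul_zero]
  · intro A hA
    rw [← SemigroupAction.mul_smul (box k _), box_mul_box, boxMul_zero, zero_smul, map_zero,
      smul_zero, smul_zero]
    rwa [T.vert.tgt_inv]

/-- The average of a linear map as a map of modules. -/
def averageHom (p : M →ₗ[k] N) : M →ₗ[QG k T] N where
  __ := average (T := T) p
  map_smul' a m := by
    induction a using ind with
    | zero => simp
    | add a b h h' =>
      simp only [AddHom.toFun_eq_coe, LinearMap.coe_toAddHom, RingHom.id_apply] at h h' ⊢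
      rw [add_smul, add_smul, map_add, h, h']
    | smul c B =>
      simp only [smul_assoc, AddHom.toFun_eq_coe, LinearMap.coe_toAddHom, map_smul,
        RingHom.id_apply,
        average_box_smul]

theorem averageHom_apply (p : M →ₗ[k] N) (m : M) :
    averageHom (T := T) p m = average (T := T) p m := rfl

end Average

/-- Maschke's theorem for the groupoid algebra of a finite groupoid. -/
instance isSemisimpleRing [CharZero k] : IsSemisimpleRing (QG k T) where
  exists_isCompl N := by
    -- A `k`-linear retraction onto the left ideal; its average is still a retraction, now
    -- `kT`-linear, and the kernel of the average is the complement.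
    obtain ⟨p, hp⟩ := (N.restrictScalars k).subtype.exists_leftInverse_of_injective
      (LinearMap.ker_eq_bot.2 Subtype.val_injective)
    have hp' : ∀ n (hn : n ∈ N), p n = (⟨n, hn⟩ : N) := fun n hn => LinearMap.congr_fun hp ⟨n, hn⟩
    let q : QG k T →ₗ[k] N := p
    refine ⟨LinearMap.ker (averageHom (T := T) q), LinearMap.isCompl_of_proj fun n => ?_⟩
    rw [averageHom_apply, average_apply]
    -- The ideal is stable under A⁻¹, so the retraction does nothing there and A A⁻¹ collapses to
    -- the idempotent of the top edge.
    have h : ∀ A : T.Box, box k A • q (box k (T.vert.inv A) • (n : QG k T)) =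
        idem k (T.vert.src A) • n := by
      intro A
      have h' : q (box k (T.vert.inv A) • (n : QG k T)) = box k (T.vert.inv A) • n :=
        hp' _ (N.smul_mem _ n.2)
      rw [h', ← SemigroupAction.mul_smul, box_mul_inv]
    simp only [h]
    rw [← Finset.sum_fiberwise Finset.univ (fun A => T.vert.src A)]
    -- The weights of the boxes with top `x` add up to 1, since their number is invertible in
    -- characteristic zero. The idempotents that remain sum to the unit of `kT`.
    have h₂ : ∀ x : T.Hor, ∑ A : T.Box with T.vert.src A = x,
        (topCard T (T.vert.src A) : k)⁻¹ • idem k (T.vert.src A) • n = idem k x • n := by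
      intro x
      have e : ∀ A ∈ Finset.univ.filter (fun A : T.Box => T.vert.src A = x),
          (topCard T (T.vert.src A) : k)⁻¹ • idem k (T.vert.src A) • n =
            (topCard T x : k)⁻¹ • idem k x • n := by
        intro A hA
        rw [(Finset.mem_filter.1 hA).2]
      rw [Finset.sum_congr rfl e, Finset.sum_const, ← Nat.cast_smul_eq_nsmul k,
        ← SemigroupAction.mul_smul]
      rw [show (Finset.univ.filter (fun A : T.Box => T.vert.src A = x)).card = topCard T x from
        (Fintype.card_subtype _).symm, mul_inv_cancel₀ (Nat.cast_ne_zero.2 (topCard_ne_zero x)),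
        one_smul]
    simp only [h₂]
    rw [← Finset.sum_smul]
    exact one_smul (QG k T) n

end

end QG

/-! ### The equivalence between bundles and representations. -/

namespace TBund

noncomputable section

open scoped Classical DirectSum
open DoubleGroupoid ArrowGroupoid

attribute [local instance] Fintype.ofFinite

variable {k : Type u} [Field k] {T : DoubleGroupoid.{u}}

section Total

variable {U V W : TBund k T}

/-- The total space of a bundle. -/
abbrev Total (V : TBund k T) : Type u := ∀ x, V.fib x

/-- The vector `v` of degree `x` in the total space. -/
def single (x : T.Hor) : V.fib x →ₗ[k] Total V := LinearMap.single k V.fib x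

theorem single_same (x : T.Hor) (v : V.fib x) : single x v x = v := Pi.single_eq_same x v

theorem single_of_ne {x y : T.Hor} (h : y ≠ x) (v : V.fib x) : single x v y = 0 :=
  Pi.single_eq_of_ne h v

/-- The action of a box on the total space. -/
def totalAct (V : TBund k T) (A : T.Box) : Module.End k (Total V) :=
  single (T.vert.src A) ∘ₗ V.act A rfl rfl ∘ₗ LinearMap.proj (T.vert.tgt A)

theorem totalAct_apply (A : T.Box) (v : Total V) :
    totalAct V A v = single (T.vert.src A) (V.act A rfl rfl (v (T.vert.tgt A))) := rfl

theorem totalAct_single {A : T.Box} {x y : T.Hor} (hx : T.vert.src A = x) (hy : T.vert.tgt A = y)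
    (v : V.fib y) : totalAct V A (single y v) = single x (V.act A hx hy v) := by
  subst hx hy
  rw [totalAct_apply, single_same]

theorem totalAct_single_of_ne {A : T.Box} {y : T.Hor} (hy : T.vert.tgt A ≠ y) (v : V.fib y) :
    totalAct V A (single y v) = 0 := by
  rw [totalAct_apply, single_of_ne hy, map_zero, map_zero]

theorem totalAct_vone (x : T.Hor) (v : Total V) :
    totalAct V (T.vert.one x) v = single x (v x) := by
  -- The endpoints of the identity box equal `x` only propositionally; they are replaced by
  -- variables so that the equations can be eliminated. The same is done below for the top edge.
  have h : ∀ y (_ : T.vert.tgt (T.vert.one x) = y) (e : y = x),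
      V.act (T.vert.one x) (T.vert.src_one x) ‹_› (v y) = v x := by
    rintro y h rfl
    rw [V.act_one]
    rfl
  rw [totalAct_apply, ← h _ rfl (T.vert.tgt_one x)]
  have h' : ∀ z (hz : T.vert.src (T.vert.one x) = z), single (V := V) (T.vert.src (T.vert.one x))
      (V.act (T.vert.one x) rfl rfl (v (T.vert.tgt (T.vert.one x)))) =
      single z (V.act (T.vert.one x) hz rfl (v (T.vert.tgt (T.vert.one x)))) := by
    rintro _ rfl
    rfl
  exact h' x _

theorem totalAct_comp {A B C : T.Box} (w : T.vert.IsComp A B C) :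
    totalAct V C = totalAct V A * totalAct V B := by
  ext1 v
  rw [Module.End.mul_apply, totalAct_apply (A := B), totalAct_single rfl w.mid]
  -- The bottoms of `C` and `B` are given separate names, since their fibres can be compared only
  -- after the equation between them is eliminated.
  have h : ∀ c c' (h : T.vert.tgt C = c) (h' : T.vert.tgt B = c'), c = c' →
    V.act C w.src h (v c) = V.act A rfl w.mid (V.act B rfl h' (v c')) := by
    rintro c _ h h' rfl
    exact V.act_isComp w _ _ _ _ _ _ _
  rw [← h _ _ rfl rfl w.tgt]
  have h' : ∀ z (hz : T.vert.src C = z), single (V := V) (T.vert.src C)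
      (V.act C rfl rfl (v (T.vert.tgt C))) = single z (V.act C hz rfl (v (T.vert.tgt C))) := by
    rintro _ rfl
    rfl
  exact h' _ w.src

theorem totalAct_mul_of_ne {A B : T.Box} (h : T.vert.tgt A ≠ T.vert.src B) :
    totalAct V A * totalAct V B = 0 := by
  ext1 v
  rw [Module.End.mul_apply, totalAct_apply (A := B), totalAct_single_of_ne h]
  rfl

/-- The map of total spaces induced by a morphism of bundles. -/
def totalMap (f : V ⟶ W) : Total V →ₗ[k] Total W :=
  LinearMap.pi fun x => f.app x ∘ₗ LinearMap.proj x

theorem totalMap_apply (f : V ⟶ W) (v : Total V) (x : T.Hor) : totalMap f v x = f.app x (v x) := rfl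

theorem totalMap_single (f : V ⟶ W) (x : T.Hor) (v : V.fib x) :
    totalMap f (single x v) = single x (f.app x v) := by
  ext y
  rw [totalMap_apply]
  by_cases h : y = x
  · subst h; rw [single_same, single_same]
  · rw [single_of_ne h, single_of_ne h, map_zero]

theorem totalMap_totalAct (f : V ⟶ W) (A : T.Box) (v : Total V) :
    totalMap f (totalAct V A v) = totalAct W A (totalMap f v) := by
  rw [totalAct_apply, totalAct_apply, totalMap_single, f.comm]
  rfl

theorem idem_mul_box {A : T.Box} {x : T.Hor} (h : T.vert.src A = x) :
    QG.idem k x * QG.box k A = QG.box k A := by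
  rw [QG.idem, QG.box_mul_box, QG.vone_boxMul, if_pos h]

/-- The linear extension of the action of boxes on the total space. -/
def totalRho (V : TBund k T) : QG k T →ₗ[k] Module.End k (Total V) := QG.ext (totalAct V)

theorem totalRho_box (A : T.Box) : totalRho V (QG.box k A) = totalAct V A := QG.ext_box _ A

variable [T.IsFinite]

theorem sum_single (v : Total V) : ∑ x, single x (v x) = v :=
  LinearMap.sum_single_apply V.fib v

theorem total_ext {M : Type u} [AddCommGroup M] [Module k M] {f g : Total V →ₗ[k] M}
    (h : ∀ x v, f (single x v) = g (single x v)) : f = g :=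
  LinearMap.pi_ext h

/-- The representation of `kT` on the total space of a bundle. -/
def toRepr (V : TBund k T) : FDRepr k (QG k T) where
  carrier := Total V
  ρ := AlgHom.ofLinearMap (totalRho V)
    (by
      rw [QG.one_def, map_sum]
      refine LinearMap.ext fun v => ?_
      simp only [totalRho_box, LinearMap.sum_apply, totalAct_vone, sum_single, Module.End.one_apply])
    (fun a b => by
      induction a using QG.ind with
      | zero => simp only [zero_mul, map_zero]
      | add a a' h h' => simp only [add_mul, map_add, h, h']
      | smul r A =>
        induction b using QG.ind with
        | zero => simp only [mul_zero, map_zero]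
        | add a a' h h' => simp only [mul_add, map_add, h, h']
        | smul s B =>
          simp only [smul_mul_assoc, mul_smul_comm, map_smul, QG.box_mul_box, totalRho_box]
          congr 2
          by_cases p : T.vert.tgt A = T.vert.src B
          · have w := isComp_comp A B p
            rw [QG.boxMul_isComp w, totalRho_box, totalAct_comp w]
          · rw [QG.boxMul_zero p, map_zero, totalAct_mul_of_ne p])

theorem toRepr_ρ_box (A : T.Box) : (toRepr V).ρ (QG.box k A) = totalAct V A :=
  QG.ext_box (totalAct V) A

/-- The boxes span `kT`, so equivariance needs to be tested on boxes only. -/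
theorem comm_of_box {M N : FDRepr k (QG k T)} (f : M.carrier →ₗ[k] N.carrier)
    (h : ∀ A m, f (M.ρ (QG.box k A) m) = N.ρ (QG.box k A) (f m)) (a : QG k T) (m : M.carrier) :
    f (M.ρ a m) = N.ρ a (f m) := by
  induction a using QG.ind with
  | zero => simp
  | add a b h h' => simp only [map_add, LinearMap.add_apply, h, h']
  | smul c A => simp only [map_smul, LinearMap.smul_apply, h]

/-- The functor from bundles to representations. -/
def reprFunctor (k : Type u) [Field k] (T : DoubleGroupoid.{u}) [T.IsFinite] :
    TBund k T ⥤ FDRepr k (QG k T) where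
  obj := toRepr
  map {V W} f :=
    { lin := totalMap f
      comm := comm_of_box (M := toRepr V) (N := toRepr W) _ fun A m => by
        rw [toRepr_ρ_box, toRepr_ρ_box]
        exact totalMap_totalAct f A m }

instance : (reprFunctor k T).Additive where
  map_add := rfl

instance : (reprFunctor k T).Linear k where
  map_smul _ _ := rfl

instance : (reprFunctor k T).Faithful where
  map_injective {V W f g} h := by
    ext x v
    have h' : totalMap f (single x v) = totalMap g (single x v) := 
      LinearMap.congr_fun (congrArg FDRepr.Hom.lin h) _
    rw [totalMap_single, totalMap_single] at h'
    exact (single_same _ _).symm.trans ((congrFun h' x).trans (single_same _ _))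

instance : (reprFunctor k T).Full where
  map_surjective {V W} f := by
    let f' : Total V →ₗ[k] Total W := f.lin
    have hf : ∀ A v, f' (totalAct V A v) = totalAct W A (f' v) := fun A v => by
      rw [← toRepr_ρ_box, ← toRepr_ρ_box]
      exact f.comm _ v
    -- An equivariant map commutes with the idempotent of `x`, which is the projection to degree
    -- `x`; hence it preserves degrees.
    have hs : ∀ x v, f' (single x v) = single x (f' (single x v) x) := fun x v => by
      rw [← totalAct_vone, ← hf, totalAct_vone, single_same]
    refine ⟨⟨fun x => LinearMap.proj x ∘ₗ f' ∘ₗ single x, fun A x y hx hy v => ?_⟩, ?_⟩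
    · simp only [LinearMap.comp_apply, LinearMap.proj_apply]
      rw [← totalAct_single hx hy, hf, hs, totalAct_single hx hy, single_same, single_same]
    · apply FDRepr.hom_ext
      refine total_ext (V := V) fun x v => ?_
      exact (totalMap_single _ x v).trans (hs x v).symm

section EssSurj

variable (M : FDRepr k (QG k T))

/-- The bundle of a representation, with fibres the images of the idempotents of the horizontal
edges. -/
def ofRepr : TBund k T where
  fib x := LinearMap.range (M.ρ (QG.idem k x))
  act A {x y} hx _ := LinearMap.codRestrict _ (M.ρ (QG.box k A) ∘ₗ Submodule.subtype _) fun m => by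
    -- Multiplication by the idempotent of its top edge fixes the box, so everything in the image of
    -- the box lies in the fibre at the top.
    refine ⟨M.ρ (QG.box k A) m, ?_⟩
    rw [← Module.End.mul_apply, ← map_mul, idem_mul_box hx]
    rfl
  act_one x h h' := by
    ext ⟨_, m, rfl⟩
    change M.ρ (QG.idem k x) (M.ρ (QG.idem k x) m) = M.ρ (QG.idem k x) m
    rw [← Module.End.mul_apply, ← map_mul, QG.idem_mul_idem, if_pos rfl]
  act_comp {f g} p _ _ _ _ _ _ _ _ _ := by
    ext m
    change M.ρ (QG.box k _) m = M.ρ (QG.box k f) (M.ρ (QG.box k g) m)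
    rw [← Module.End.mul_apply, ← map_mul, QG.box_mul_box, QG.boxMul_isComp ⟨p, rfl⟩]

theorem coe_act_ofRepr (A : T.Box) {x y : T.Hor} (hx : T.vert.src A = x) (hy : T.vert.tgt A = y)
    (m : (ofRepr M).fib y) : ((ofRepr M).act A hx hy m).1 = M.ρ (QG.box k A) m.1 := rfl

theorem idem_coe_ofRepr (x y : T.Hor) (m : (ofRepr M).fib y) :
    M.ρ (QG.idem k x) m.1 = if x = y then m.1 else 0 := by
  obtain ⟨_, m, rfl⟩ := m
  rw [← Module.End.mul_apply, ← map_mul, QG.idem_mul_idem]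
  split_ifs with h
  · rw [h]
  · rw [map_zero]; rfl

/-- The map from the total space of the bundle of a representation to the representation. -/
def sumMap : Total (ofRepr M) →ₗ[k] M.carrier :=
  ∑ x, Submodule.subtype _ ∘ₗ LinearMap.proj (R := k) (φ := (ofRepr M).fib) x

theorem sumMap_apply (v : Total (ofRepr M)) : sumMap M v = ∑ x, (v x).1 := by
  simp only [sumMap, LinearMap.sum_apply]; rfl

theorem sumMap_single (x : T.Hor) (m : (ofRepr M).fib x) : sumMap M (single x m) = m.1 := by
  rw [sumMap_apply, Fintype.sum_eq_single x, single_same]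
  intro y h
  rw [single_of_ne h]
  rfl

theorem sumMap_totalAct (A : T.Box) (v : Total (ofRepr M)) :
    sumMap M (totalAct _ A v) = M.ρ (QG.box k A) (sumMap M v) := by
  refine LinearMap.congr_fun (f := sumMap M ∘ₗ totalAct _ A) (g := M.ρ (QG.box k A) ∘ₗ sumMap M)
    (total_ext fun x m => ?_) v
  rw [LinearMap.comp_apply, LinearMap.comp_apply, sumMap_single]
  by_cases h : T.vert.tgt A = x
  · rw [totalAct_single rfl h, sumMap_single, coe_act_ofRepr]
  · rw [totalAct_single_of_ne h, map_zero]
    obtain ⟨_, m, rfl⟩ := m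
    rw [← Module.End.mul_apply, ← map_mul, QG.idem, QG.box_mul_box, QG.boxMul_vone, if_neg h,
      map_zero]
    rfl

theorem idem_sumMap (x : T.Hor) (v : Total (ofRepr M)) :
    M.ρ (QG.idem k x) (sumMap M v) = (v x).1 := by
  rw [sumMap_apply, map_sum, Fintype.sum_eq_single x, idem_coe_ofRepr, if_pos rfl]
  intro y h
  rw [idem_coe_ofRepr, if_neg h.symm]

/-- The isomorphism between the total space of the bundle of a representation and the
representation. -/
def ofReprIso : toRepr (ofRepr M) ≅ M :=
  FDRepr.isoMk
    { lin := sumMap M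
      comm := comm_of_box (M := toRepr (ofRepr M)) _ fun A m => by
        rw [toRepr_ρ_box]
        exact sumMap_totalAct M A m }
    -- The inverse sends `m` to its components under the idempotents; they add up to `m` because the
    -- idempotents sum to 1.
    (LinearMap.pi fun x => (M.ρ (QG.idem k x)).rangeRestrict)
    (fun m => funext fun x => Subtype.ext (idem_sumMap M x m))
    (fun m => by
      refine (sumMap_apply M _).trans ?_
      change ∑ x, M.ρ (QG.idem k x) m = m
      rw [← LinearMap.sum_apply, ← map_sum]
      exact LinearMap.congr_fun (map_one M.ρ) m)

instance : (reprFunctor k T).EssSurj where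
  mem_essImage M := ⟨ofRepr M, ⟨ofReprIso M⟩⟩

instance : (reprFunctor k T).IsEquivalence where

end EssSurj

end Total

end

end TBund

/-! ### Total spaces of tensor products. -/

namespace TBund

noncomputable section

open scoped Classical DirectSum
open DoubleGroupoid ArrowGroupoid

attribute [local instance] Fintype.ofFinite

variable {k : Type u} [Field k] {T : DoubleGroupoid.{u}}

section Tensorator

variable {U V W V' W' : TBund k T} [T.IsFinite]

theorem tmul_ext {M : Type u} [AddCommGroup M] [Module k M] {f g : Total V ⊗[k] Total W →ₗ[k] M}
    (h : ∀ x y v w, f (single x v ⊗ₜ single y w) = g (single x v ⊗ₜ single y w)) : f = g := by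
  refine TensorProduct.ext ?_
  refine total_ext fun x v => total_ext fun y w => ?_
  exact h x y v w

/-- The action of `kT ⊗ kT` on the tensor product of the total spaces. -/
def totalAct₂ (V W : TBund k T) :
    QG k T ⊗[k] QG k T →ₗ[k] Total V ⊗[k] Total W →ₗ[k] Total V ⊗[k] Total W :=
  (FDRepr.act₂ (toRepr V) (toRepr W)).toLinearMap

theorem totalAct₂_tmul (B C : T.Box) (v : Total V) (w : Total W) :
    totalAct₂ V W (QG.box k B ⊗ₜ QG.box k C) (v ⊗ₜ w) = totalAct V B v ⊗ₜ totalAct W C w := by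
  rw [← toRepr_ρ_box, ← toRepr_ρ_box]
  rfl

theorem totalAct₂_sum {ι : Type u} [Fintype ι] (X : ι → QG k T ⊗[k] QG k T)
    (t : Total V ⊗[k] Total W) :
    totalAct₂ V W (∑ i, X i) t = ∑ i, totalAct₂ V W (X i) t := by
  rw [map_sum, LinearMap.sum_apply]

/-- In a decomposition A = BC the bottoms of B and C compose to the bottom of A. Unless `x` and `y`
do so, each summand of Δ(A) has a factor that kills its vector for reasons of degree. -/
theorem totalAct₂_comul_box_of_not {A : T.Box} {x y : T.Hor}
    (h : ¬ T.hor.IsComp x y (T.vert.tgt A)) (v : V.fib x) (w : W.fib y) :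
    totalAct₂ V W (Coalgebra.comul (R := k) (QG.box k A)) (single x v ⊗ₜ single y w) = 0 := by
  rw [QG.comul_box, totalAct₂_sum]
  refine Finset.sum_eq_zero fun q _ => ?_
  rw [totalAct₂_tmul]
  by_cases hB : T.vert.tgt q.1.1 = x
  · by_cases hC : T.vert.tgt q.1.2 = y
    · subst hB hC
      exact absurd (bot_isComp q.2) h
    · rw [totalAct_single_of_ne hC, TensorProduct.tmul_zero]
  · rw [totalAct_single_of_ne hB, TensorProduct.zero_tmul]

variable [T.IsVacant]

/-- The product `v ⊗ w` in the total space of the tensor product of homogeneous elements of degrees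
`x` and `y`. -/
def homMul (V W : TBund k T) (x y : T.Hor) : V.fib x →ₗ[k] W.fib y →ₗ[k] Total (tens V W) :=
  if h : T.hor.tgt x = T.hor.src y then
    (mk (V := V) (W := W) (isComp_comp x y h)).compr₂ (single (T.hor.comp x y h)) else 0

theorem homMul_isComp {x y z : T.Hor} (c : T.hor.IsComp x y z) (v : V.fib x) (w : W.fib y) :
    homMul V W x y v w = single z (mk c v w) := by
  obtain ⟨h, rfl⟩ := c
  rw [homMul, dif_pos h]
  rfl

theorem homMul_of_ne {x y : T.Hor} (h : T.hor.tgt x ≠ T.hor.src y) (v : V.fib x) (w : W.fib y) :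
    homMul V W x y v w = 0 := by
  rw [homMul, dif_neg h]
  rfl

/-- The map from the tensor product of the total spaces to the total space of the tensor
product. -/
def tensorator (V W : TBund k T) : Total V ⊗[k] Total W →ₗ[k] Total (tens V W) :=
  TensorProduct.lift (∑ x, ∑ y, (homMul V W x y).compl₁₂ (LinearMap.proj x) (LinearMap.proj y))

theorem tensorator_single (x y : T.Hor) (v : V.fib x) (w : W.fib y) :
    tensorator V W (single x v ⊗ₜ single y w) = homMul V W x y v w := by
  simp only [tensorator, TensorProduct.lift.tmul, LinearMap.sum_apply, LinearMap.compl₁₂_apply,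
    LinearMap.proj_apply]
  rw [Fintype.sum_eq_single x, Fintype.sum_eq_single y, single_same, single_same]
  · intro y' h
    rw [single_of_ne h, map_zero]
  · intro x' h
    refine Finset.sum_eq_zero fun y' _ => ?_
    rw [single_of_ne h, map_zero, LinearMap.zero_apply]

theorem tensorator_isComp {x y z : T.Hor} (c : T.hor.IsComp x y z) (v : V.fib x) (w : W.fib y) :
    tensorator V W (single x v ⊗ₜ single y w) = single z (mk c v w) := by
  rw [tensorator_single, homMul_isComp c]

theorem tensorator_of_ne {x y : T.Hor} (h : T.hor.tgt x ≠ T.hor.src y) (v : V.fib x)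
    (w : W.fib y) : tensorator V W (single x v ⊗ₜ single y w) = 0 := by
  rw [tensorator_single, homMul_of_ne h]

/-- The inclusion of the total space of the tensor product in the tensor product of the total
spaces. -/
def tensoratorInv (V W : TBund k T) : Total (tens V W) →ₗ[k] Total V ⊗[k] Total W :=
  ∑ z, desc (fun x y _ => (TensorProduct.mk k (Total V) (Total W)).compl₁₂ (single x) (single y)) ∘ₗ
    LinearMap.proj z

theorem tensoratorInv_single {x y z : T.Hor} (c : T.hor.IsComp x y z) (v : V.fib x) (w : W.fib y) :
    tensoratorInv V W (single z (mk c v w)) = single x v ⊗ₜ single y w := by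
  simp only [tensoratorInv, LinearMap.sum_apply, LinearMap.comp_apply, LinearMap.proj_apply]
  rw [Fintype.sum_eq_single z, single_same, desc_mk]
  · rfl
  · intro z' h
    rw [single_of_ne h, map_zero]

theorem total_tens_ext {M : Type u} [AddCommGroup M] [Module k M]
    {f g : Total (tens V W) →ₗ[k] M}
    (h : ∀ x y z (c : T.hor.IsComp x y z) v w, f (single z (mk c v w)) = g (single z (mk c v w))) :
    f = g :=
  total_ext fun z t => LinearMap.congr_fun (f := f ∘ₗ single z) (g := g ∘ₗ single z)
    (tens_ext fun x y c v w => h x y z c v w) t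

theorem tensorator_tensoratorInv (t : Total (tens V W)) :
    tensorator V W (tensoratorInv V W t) = t := by
  refine LinearMap.congr_fun (f := tensorator V W ∘ₗ tensoratorInv V W) (g := LinearMap.id)
    (total_tens_ext fun x y z c v w => ?_) t
  rw [LinearMap.comp_apply, tensoratorInv_single, tensorator_isComp c]
  rfl

/-- By vacancy, the bottom of the right factor determines a decomposition of `A`, so exactly one
summand of Δ(A) can act non-trivially on vectors of these degrees. -/
theorem totalAct₂_comul_box {A : T.Box} {x y : T.Hor} {B C : T.Box} (q : T.horiz.IsComp B C A)
    (hB : T.vert.tgt B = x) (hC : T.vert.tgt C = y) (v : V.fib x) (w : W.fib y) :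
    totalAct₂ V W (Coalgebra.comul (R := k) (QG.box k A)) (single x v ⊗ₜ single y w) =
      single (T.vert.src B) (V.act B rfl hB v) ⊗ₜ single (T.vert.src C) (W.act C rfl hC w) := by
  rw [QG.comul_box, totalAct₂_sum, Fintype.sum_eq_single (⟨(B, C), q⟩ : QG.Dec A), totalAct₂_tmul,
    totalAct_single rfl hB, totalAct_single rfl hC]
  rintro ⟨⟨B', C'⟩, q'⟩ h
  rw [totalAct₂_tmul]
  by_cases hC' : T.vert.tgt C' = y
  · exfalso
    obtain ⟨a, b⟩ := split_unique q' q (hC'.trans hC.symm)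
    exact h (Subtype.ext (Prod.ext a b))
  · rw [totalAct_single_of_ne hC', TensorProduct.tmul_zero]

/-- Equivariance of the tensorator, checked on homogeneous vectors. If `x` and `y` compose to the
bottom of `A`, the decomposition of that edge lifts to `A` and both sides use the lifted factors;
otherwise both sides vanish, either because `A` does not meet the degree xy or because there is no
such degree. -/
theorem tensorator_comul_box (A : T.Box) (t : Total V ⊗[k] Total W) :
    tensorator V W (totalAct₂ V W (Coalgebra.comul (R := k) (QG.box k A)) t) =
      totalAct (tens V W) A (tensorator V W t) := by
  refine LinearMap.congr_fun
    (f := tensorator V W ∘ₗ totalAct₂ V W (Coalgebra.comul (R := k) (QG.box k A)))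
    (g := totalAct (tens V W) A ∘ₗ tensorator V W) (tmul_ext fun x y v w => ?_) t
  rw [LinearMap.comp_apply, LinearMap.comp_apply]
  by_cases h : T.hor.IsComp x y (T.vert.tgt A)
  · obtain ⟨B, C, q, hB, hC⟩ := exists_split A h
    rw [totalAct₂_comul_box q hB hC, tensorator_isComp (top_isComp q), tensorator_isComp h,
      totalAct_single rfl rfl, act_mk q rfl rfl hB hC rfl rfl h (top_isComp q)]
  · rw [totalAct₂_comul_box_of_not h, map_zero]
    by_cases h' : T.hor.tgt x = T.hor.src y
    · have c := isComp_comp x y h'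
      rw [tensorator_isComp c, totalAct_single_of_ne]
      intro e
      exact h (e ▸ c)
    · rw [tensorator_of_ne h', map_zero]

/-- The unit is the sum of the vertical identity boxes. On vectors of degrees `x` and `y` only the
box of the composite edge contributes, and it acts trivially, while nothing contributes if the edges
are not composable. Thus Δ(1) is the projection onto composable degrees, and its image is the total
space of the tensor product of bundles. -/
theorem tensoratorInv_tensorator (t : Total V ⊗[k] Total W) :
    tensoratorInv V W (tensorator V W t) =
      totalAct₂ V W (Coalgebra.comul (R := k) (1 : QG k T)) t := by
  refine LinearMap.congr_fun (f := tensoratorInv V W ∘ₗ tensorator V W)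
    (g := totalAct₂ V W (Coalgebra.comul (R := k) (1 : QG k T))) (tmul_ext fun x y v w => ?_) t
  rw [LinearMap.comp_apply, QG.one_def, map_sum, totalAct₂_sum]
  by_cases h : T.hor.tgt x = T.hor.src y
  · have c := isComp_comp x y h
    rw [tensorator_isComp c, tensoratorInv_single, Fintype.sum_eq_single (T.hor.comp x y h),
      totalAct₂_comul_box (isComp_vone c) (T.vert.tgt_one _)
        (T.vert.tgt_one _)]
    -- The surviving summand acts by an identity box on each factor, that is, trivially.
    · rw [← totalAct_single rfl, ← totalAct_single rfl, totalAct_vone, totalAct_vone, single_same,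
        single_same]
    · intro z hz
      rw [totalAct₂_comul_box_of_not]
      intro c'
      rw [T.vert.tgt_one] at c'
      exact hz (c'.eq c)
  · rw [tensorator_of_ne h, map_zero]
    symm
    refine Finset.sum_eq_zero fun z _ => totalAct₂_comul_box_of_not (fun c => h c.mid) v w

theorem tensorator_comul_one (t : Total V ⊗[k] Total W) :
    tensorator V W (totalAct₂ V W (Coalgebra.comul (R := k) (1 : QG k T)) t) =
      tensorator V W t := by
  rw [← tensoratorInv_tensorator, tensorator_tensoratorInv]

/-- The tensorator of the functor from bundles to representations. -/
def tensoratorIso (V W : TBund k T) :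
    FDRepr.tens (toRepr V) (toRepr W) ≅ toRepr (tens V W) :=
  FDRepr.isoMk
    { lin := tensorator V W ∘ₗ FDRepr.inc (toRepr V) (toRepr W)
      comm := comm_of_box (M := FDRepr.tens (toRepr V) (toRepr W)) (N := toRepr (tens V W)) _
        fun A t => ((congrArg (tensorator V W) (FDRepr.inc_ρ _ t)).trans
          (tensorator_comul_box A _)).trans (LinearMap.congr_fun (toRepr_ρ_box A).symm _) }
    (FDRepr.pro (toRepr V) (toRepr W) ∘ₗ tensoratorInv V W)
    -- One composite is two applications of Δ(1), which fixes the subspace Δ(1)(V ⊗ W); in the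
    -- other, the tensorator absorbs Δ(1) and is then a left inverse of the inclusion.
    (fun t => by
      apply FDRepr.inc_injective
      refine Eq.trans ?_ (FDRepr.act₂_inc t)
      refine (FDRepr.inc_pro _).trans ?_
      conv_rhs => rw [← FDRepr.act₂_inc t]
      exact congrArg _ (tensoratorInv_tensorator _))
    (fun t => by
      refine (congrArg (tensorator V W) (FDRepr.inc_pro _)).trans ?_
      exact (tensorator_comul_one _).trans (tensorator_tensoratorInv t))

theorem tensorator_natural (f : V ⟶ V') (g : W ⟶ W') (t : Total V ⊗[k] Total W) :
    tensorator V' W' (TensorProduct.map (totalMap f) (totalMap g) t) =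
      totalMap (tensMap f g) (tensorator V W t) := by
  refine LinearMap.congr_fun
    (f := tensorator V' W' ∘ₗ TensorProduct.map (totalMap f) (totalMap g))
    (g := totalMap (tensMap f g) ∘ₗ tensorator V W) (tmul_ext fun x y v w => ?_) t
  rw [LinearMap.comp_apply, LinearMap.comp_apply, TensorProduct.map_tmul, totalMap_single,
    totalMap_single]
  by_cases h : T.hor.tgt x = T.hor.src y
  · have c := isComp_comp x y h
    rw [tensorator_isComp c, tensorator_isComp c, totalMap_single, tensMap_mk]
  · rw [tensorator_of_ne h, tensorator_of_ne h, map_zero]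

/-- On homogeneous vectors with composable degrees both sides are the same triple tensor; if either
of the two adjacent pairs is not composable, both sides are zero. -/
theorem tensorator_assoc (t : (Total U ⊗[k] Total V) ⊗[k] Total W) :
    totalMap (assocIso U V W).hom (tensorator (tens U V) W ((tensorator U V).rTensor _ t)) =
      tensorator U (tens V W) ((tensorator V W).lTensor _ (TensorProduct.assoc k _ _ _ t)) := by
  refine LinearMap.congr_fun
    (f := totalMap (assocIso U V W).hom ∘ₗ tensorator (tens U V) W ∘ₗ (tensorator U V).rTensor _)
    (g := tensorator U (tens V W) ∘ₗ (tensorator V W).lTensor _ ∘ₗ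
      (TensorProduct.assoc k _ _ _).toLinearMap) ?_ t
  refine TensorProduct.ext (tmul_ext fun x y v w => total_ext fun z u => ?_)
  change totalMap (assocIso U V W).hom (tensorator (tens U V) W
      (tensorator U V (single x v ⊗ₜ single y w) ⊗ₜ single z u)) =
    tensorator U (tens V W) (single x v ⊗ₜ tensorator V W (single y w ⊗ₜ single z u))
  by_cases h : T.hor.tgt x = T.hor.src y
  · have c := isComp_comp x y h
    rw [tensorator_isComp c]
    by_cases h' : T.hor.tgt y = T.hor.src z
    · have d := isComp_comp y z h'
      have e := isComp_comp _ z (c.tgt.trans h')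
      rw [tensorator_isComp e, tensorator_isComp d, tensorator_isComp (c.assoc d e),
        totalMap_single, assocIso_mk e c d (c.assoc d e)]
    · rw [tensorator_of_ne (by rwa [c.tgt]), tensorator_of_ne h', TensorProduct.tmul_zero, map_zero,
        map_zero]
  · rw [tensorator_of_ne h, TensorProduct.zero_tmul, map_zero, map_zero]
    by_cases h' : T.hor.tgt y = T.hor.src z
    · have d := isComp_comp y z h'
      rw [tensorator_isComp d, tensorator_of_ne (by rwa [d.src])]
    · rw [tensorator_of_ne h', TensorProduct.tmul_zero, map_zero]

end Tensorator

end

end TBund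

/-! ### The target subalgebra as unit object, and coherence of the monoidal functor. -/

namespace TBund

noncomputable section

open scoped Classical DirectSum
open DoubleGroupoid ArrowGroupoid

attribute [local instance] Fintype.ofFinite

variable {k : Type u} [Field k] {T : DoubleGroupoid.{u}}

theorem idem_one (P : T.Pt) : QG.idem k (T.hor.one P) = QG.box k (T.horiz.one (T.ver.one P)) := by
  rw [QG.idem, T.one_one]

variable [T.IsFinite]

theorem counit_idem_mul_box (x : T.Hor) (A : T.Box) :
    Coalgebra.counit (R := k) (QG.idem k x * QG.box k A) =
      if T.vert.src A = x ∧ IsHone A then 1 else 0 := by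
  rw [QG.idem, QG.box_mul_box, QG.vone_boxMul]
  split_ifs with h h' h'
  · rw [QG.counit_box, if_pos h'.2]
  · rw [QG.counit_box, if_neg fun e => h' ⟨h, e⟩]
  · exact absurd h'.1 h
  · rw [map_zero]

/-- A sum of idempotents acts on a homogeneous vector by 1 or 0 according to its degree. The
elements ε_t and σ of horizontal identities have this form, so this computes the unit constraints.
-/
theorem totalRho_sum_idem (V : TBund k T) (p : T.Hor → Prop) (y : T.Hor) (w : V.fib y) :
    totalRho V (∑ x, if p x then QG.idem k x else 0) (single y w) =
      if p y then single y w else 0 := by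
  have h : ∀ x, totalRho V (if p x then QG.idem k x else 0) (single y w) =
      if p x then single x ((single y w : Total V) x) else 0 := by
    intro x
    split_ifs
    · rw [QG.idem, totalRho_box, totalAct_vone]
    · rw [map_zero]; rfl
  rw [map_sum, LinearMap.sum_apply, Finset.sum_congr rfl fun x _ => h x, Fintype.sum_eq_single y,
    single_same]
  · intro x hx
    rw [single_of_ne hx, map_zero, ite_self]

variable [T.IsVacant]

section Unit

variable (k) in
/-- The basis vector `_P 1` of the total space of the unit object. -/
def unitPt (P : T.Pt) : Total (unit k T) := single (T.hor.one P) (unitVec P rfl 1)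

theorem single_unitVec {x : T.Hor} (P : T.Pt) (hP : T.hor.one P = x) :
    single x (unitVec P hP 1) = unitPt k P := by
  subst hP
  rfl

theorem unit_total_ext {M : Type u} [AddCommGroup M] [Module k M]
    {f g : Total (unit k T) →ₗ[k] M} (h : ∀ P, f (unitPt k P) = g (unitPt k P)) : f = g :=
  total_ext fun x v => LinearMap.congr_fun (f := f ∘ₗ single x) (g := g ∘ₗ single x)
    (unit_ext fun P hP => by
      rw [LinearMap.comp_apply, LinearMap.comp_apply, single_unitVec]
      exact h P) v

theorem totalAct_unitPt (g : T.Ver) :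
    totalAct (unit k T) (T.horiz.one g) (unitPt k (T.ver.tgt g)) = unitPt k (T.ver.src g) := by
  rw [unitPt, totalAct_single (T.top_hone g) (T.bot_hone g),
    act_unitVec g rfl _ _ _ (T.ver.src g) _ rfl rfl rfl]
  rfl

theorem totalAct_unitPt_of_ne {A : T.Box} {P : T.Pt} (h : T.vert.tgt A ≠ T.hor.one P) :
    totalAct (unit k T) A (unitPt k P) = 0 :=
  totalAct_single_of_ne h _

variable (k T) in
/-- The sum of the basis vectors of the unit object. -/
def unitSum : Total (unit k T) := ∑ P, unitPt k P

/-- The identity box of `g` meets only the summand at the bottom end of `g`. Applied to identities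
of points it produces every basis vector, so the sum generates the unit object. -/
theorem totalAct_unitSum (g : T.Ver) :
    totalAct (unit k T) (T.horiz.one g) (unitSum k T) = unitPt k (T.ver.src g) := by
  rw [unitSum, map_sum, Fintype.sum_eq_single (T.ver.tgt g), totalAct_unitPt]
  intro P h
  refine totalAct_unitPt_of_ne fun h' => h ?_
  rw [T.bot_hone] at h'
  exact (one_injective T.hor h').symm

theorem totalAct_unitSum_of_not {A : T.Box} (h : ¬ IsHone A) :
    totalAct (unit k T) A (unitSum k T) = 0 := by
  rw [unitSum, map_sum]
  exact Finset.sum_eq_zero fun P _ => totalAct_unitPt_of_ne fun h' => h (isHone_of_bot h')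

variable (k T) in
/-- The map `a ↦ a · ∑ _P 1`. -/
def unitMap : QG k T →ₗ[k] Total (unit k T) :=
  (FDRepr.ρ (toRepr (unit k T))).toLinearMap.flip (unitSum k T)

theorem unitMap_box (A : T.Box) :
    unitMap k T (QG.box k A) = totalAct (unit k T) A (unitSum k T) :=
  LinearMap.congr_fun (toRepr_ρ_box A) _

theorem unitMap_hone (g : T.Ver) :
    unitMap k T (QG.box k (T.horiz.one g)) = unitPt k (T.ver.src g) := by
  rw [unitMap_box, totalAct_unitSum]

theorem unitMap_of_not {A : T.Box} (h : ¬ IsHone A) : unitMap k T (QG.box k A) = 0 := by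
  rw [unitMap_box, totalAct_unitSum_of_not h]

theorem unitMap_idem_one (P : T.Pt) : unitMap k T (QG.idem k (T.hor.one P)) = unitPt k P := by
  rw [idem_one, unitMap_hone, T.ver.src_one]

/-- Writing ε_t(a) as 1 · ε_t(a), `mul_epsT` turns it into a sum over the terms id x ⊗ id y of Δ(1)
with coefficient ε(id x · a). The coefficient singles out the identity edge at the top of `g`, and
composability leaves the edges `y` that start there. -/
theorem epsT_hone (g : T.Ver) : WeakBialgebra.epsT k (QG k T) (QG.box k (T.horiz.one g)) =
    ∑ y : T.Hor, if T.hor.src y = T.ver.src g then QG.idem k y else 0 := by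
  rw [← one_mul (WeakBialgebra.epsT k (QG k T) _), WeakBialgebra.mul_epsT, QG.comul_one]
  simp only [map_sum]
  rw [Finset.sum_comm]
  refine Finset.sum_congr rfl fun y _ => ?_
  rw [Fintype.sum_eq_single (T.hor.one (T.ver.src g))]
  · rw [T.hor.tgt_one]
    split_ifs with h h' h'
    · rw [WeakBialgebra.ctrL_tmul, counit_idem_mul_box, if_pos ⟨T.top_hone g, isHone_one g⟩,
        one_smul]
    · exact absurd h.symm h'
    · exact absurd h'.symm h
    · rw [map_zero]
  · intro x hx
    split_ifs with h
    · rw [WeakBialgebra.ctrL_tmul, counit_idem_mul_box, if_neg, zero_smul]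
      rw [T.top_hone]
      exact fun e => hx e.1.symm
    · rw [map_zero]

theorem epsT_of_not {A : T.Box} (h : ¬ IsHone A) :
    WeakBialgebra.epsT k (QG k T) (QG.box k A) = 0 := by
  rw [← one_mul (WeakBialgebra.epsT k (QG k T) _), WeakBialgebra.mul_epsT, QG.comul_one]
  simp only [map_sum]
  refine Finset.sum_eq_zero fun x _ => Finset.sum_eq_zero fun y _ => ?_
  split_ifs
  · rw [WeakBialgebra.ctrL_tmul, counit_idem_mul_box, if_neg fun e => h e.2, zero_smul]
  · rw [map_zero]

/-- The mirror image of `epsT_hone`: now the right tensor factor of Δ(1) is contracted, leaving the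
edges that end at the top of `g`. -/
theorem sig_hone (g : T.Ver) : WeakBialgebra.sig k (QG k T) (QG.box k (T.horiz.one g)) =
    ∑ x : T.Hor, if T.hor.tgt x = T.ver.src g then QG.idem k x else 0 := by
  rw [← one_mul (WeakBialgebra.sig k (QG k T) _), WeakBialgebra.mul_sig, QG.comul_one]
  simp only [map_sum]
  refine Finset.sum_congr rfl fun y _ => ?_
  rw [Fintype.sum_eq_single (T.hor.one (T.ver.src g))]
  · rw [T.hor.src_one]
    split_ifs with h
    · rw [WeakBialgebra.ctrR_tmul, counit_idem_mul_box, if_pos ⟨T.top_hone g, isHone_one g⟩,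
        one_smul]
    · rw [map_zero]
  · intro x hx
    split_ifs with h
    · rw [WeakBialgebra.ctrR_tmul, counit_idem_mul_box, if_neg, zero_smul]
      rw [T.top_hone]
      exact fun e => hx e.1.symm
    · rw [map_zero]

theorem unitMap_idem_of_src (P : T.Pt) (y : T.Hor) (h : T.hor.src y = P) (h' : y ≠ T.hor.one P) :
    unitMap k T (QG.idem k y) = 0 := by
  refine unitMap_of_not fun e => h' ?_
  obtain ⟨Q, hQ⟩ := e.top
  rw [T.vert.src_one] at hQ
  rw [hQ, T.hor.src_one] at h
  rw [hQ, h]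

/-- Acting on the generating vector forgets ε_t. In the sum of idempotents that ε_t gives for a
horizontal identity, only the identity edge of the point is itself a horizontal identity; all other
idempotents kill the generator. This makes the map equivariant on the target subalgebra. -/
theorem unitMap_epsT (a : QG k T) :
    unitMap k T (WeakBialgebra.epsT k (QG k T) a) = unitMap k T a := by
  induction a using QG.ind with
  | zero => simp only [map_zero]
  | add a b h h' => simp only [map_add, h, h']
  | smul c A =>
    rw [map_smul, map_smul, map_smul]
    congr 1
    by_cases h : IsHone A
    · rw [h, epsT_hone, unitMap_hone, map_sum,
        Fintype.sum_eq_single (T.hor.one (T.ver.src (T.horiz.src A))), if_pos (T.hor.src_one _),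
        unitMap_idem_one]
      intro y hy
      split_ifs with h'
      · exact unitMap_idem_of_src _ y h' hy
      · rw [map_zero]
    · rw [epsT_of_not h, unitMap_of_not h, map_zero]

variable (k T) in
/-- The inverse of the unit isomorphism. -/
def unitInv : Total (unit k T) →ₗ[k] (FDRepr.unit k (QG k T)).carrier :=
  ∑ x, unitDesc (fun _ _ => FDRepr.eT (QG.idem k x)) ∘ₗ LinearMap.proj x

theorem unitInv_unitPt (P : T.Pt) :
    unitInv k T (unitPt k P) = FDRepr.eT (QG.idem k (T.hor.one P)) := by
  simp only [unitInv, LinearMap.sum_apply, LinearMap.comp_apply, LinearMap.proj_apply]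
  rw [Fintype.sum_eq_single (T.hor.one P), unitPt, single_same, unitDesc_unitVec, one_smul]
  intro y h
  rw [unitPt, single_of_ne h, map_zero]

/-- On the identity box of `g` both sides depend only on the top end of `g`, so `g` may be replaced
by the identity at that end; every other box goes to zero on both sides. -/
theorem unitInv_unitMap (a : QG k T) : unitInv k T (unitMap k T a) = FDRepr.eT a := by
  induction a using QG.ind with
  | zero => simp only [map_zero]
  | add a b h h' => simp only [map_add, h, h']
  | smul c A =>
    rw [map_smul, map_smul, map_smul]
    congr 1
    apply FDRepr.toA_injective
    rw [FDRepr.toA_eT]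
    by_cases h : IsHone A
    · rw [h, unitMap_hone, unitInv_unitPt, FDRepr.toA_eT, idem_one, epsT_hone, epsT_hone,
        T.ver.src_one]
    · rw [epsT_of_not h, unitMap_of_not h, map_zero, map_zero]

variable (k T) in
/-- The unit isomorphism of the functor from bundles to representations. -/
def unitIso : FDRepr.unit k (QG k T) ≅ toRepr (unit k T) :=
  FDRepr.isoMk
    { lin := unitMap k T ∘ₗ FDRepr.toA
      comm := fun a z => by
        -- The action on the target subalgebra is z ↦ ε_t(a z), and `unitMap` does not see the ε_t.
        refine (unitMap_epsT _).trans ?_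
        exact LinearMap.congr_fun (map_mul (FDRepr.ρ (toRepr (unit k T))) a (FDRepr.toA z)) _ }
    (unitInv k T)
    (fun z => by
      obtain ⟨_, a, rfl⟩ := z
      exact (congrArg _ (unitMap_epsT a)).trans (unitInv_unitMap a))
    (fun t => LinearMap.congr_fun (f := (unitMap k T ∘ₗ FDRepr.toA) ∘ₗ unitInv k T)
      (g := LinearMap.id) (unit_total_ext fun P => by
        rw [LinearMap.comp_apply, unitInv_unitPt]
        exact (unitMap_epsT _).trans (unitMap_idem_one P)) t)

theorem unitIso_lin_eT (a : QG k T) :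
    FDRepr.Hom.lin (unitIso k T).hom (FDRepr.eT a) = unitMap k T a := unitMap_epsT a

/-- The target subalgebra is spanned by the values of ε_t at the idempotents of identity edges,
because `unitInv` is onto; linear maps from the unit object are compared on these. -/
theorem unitRepr_ext {M : Type u} [AddCommGroup M] [Module k M]
    {f g : (FDRepr.unit k (QG k T)).carrier →ₗ[k] M}
    (h : ∀ P : T.Pt, f (FDRepr.eT (QG.idem k (T.hor.one P))) =
      g (FDRepr.eT (QG.idem k (T.hor.one P)))) :
    f = g := by
  have e : f ∘ₗ unitInv k T = g ∘ₗ unitInv k T := unit_total_ext fun P => by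
    rw [LinearMap.comp_apply, LinearMap.comp_apply, unitInv_unitPt, h]
  ext z
  obtain ⟨_, a, rfl⟩ := z
  have h' := LinearMap.congr_fun e (unitMap k T a)
  rw [LinearMap.comp_apply, LinearMap.comp_apply, unitInv_unitMap] at h'
  exact h'

end Unit

variable (V : TBund k T)

/-- For the idempotent of a point P, ε_t is the sum of the idempotents of edges with left end P.
Both sides therefore keep a vector of degree `y` if `y` starts at P and kill it otherwise. -/
theorem left_unitality_aux (s : (FDRepr.unit k (QG k T)).carrier ⊗[k] Total V) :
    FDRepr.mu (toRepr V) s = totalMap (leftIso V).hom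
      (tensorator (unit k T) V ((FDRepr.Hom.lin (unitIso k T).hom).rTensor _ s)) := by
  refine LinearMap.congr_fun (f := FDRepr.mu (toRepr V)) (g := totalMap (leftIso V).hom ∘ₗ
    tensorator (unit k T) V ∘ₗ (FDRepr.Hom.lin (unitIso k T).hom).rTensor _)
    (TensorProduct.ext (unitRepr_ext fun P => total_ext (V := V) fun y w => ?_)) s
  change totalRho V (FDRepr.toA (FDRepr.eT (QG.idem k (T.hor.one P)))) (single y w) =
    totalMap (leftIso V).hom (tensorator (unit k T) V
      (FDRepr.Hom.lin (unitIso k T).hom (FDRepr.eT (QG.idem k (T.hor.one P))) ⊗ₜ single y w))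
  rw [unitIso_lin_eT, unitMap_idem_one, FDRepr.toA_eT, idem_one, epsT_hone, totalRho_sum_idem,
    T.ver.src_one, unitPt]
  split_ifs with h
  · subst h
    rw [tensorator_isComp (isComp_one_left y), totalMap_single, leftIso_mk, one_smul]
  · rw [tensorator_of_ne, map_zero]
    rw [T.hor.tgt_one]
    exact Ne.symm h

/-- The same with σ in place of ε_t: both sides keep a vector exactly when its degree ends at P. -/
theorem right_unitality_aux (s : Total V ⊗[k] (FDRepr.unit k (QG k T)).carrier) :
    FDRepr.nu (toRepr V) s = totalMap (rightIso V).hom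
      (tensorator V (unit k T) ((FDRepr.Hom.lin (unitIso k T).hom).lTensor _ s)) := by
  refine LinearMap.congr_fun (f := FDRepr.nu (toRepr V)) (g := totalMap (rightIso V).hom ∘ₗ
    tensorator V (unit k T) ∘ₗ (FDRepr.Hom.lin (unitIso k T).hom).lTensor _)
    (TensorProduct.ext (total_ext (V := V) fun y w => unitRepr_ext fun P => ?_)) s
  change totalRho V (WeakBialgebra.sig k (QG k T)
      (FDRepr.toA (FDRepr.eT (QG.idem k (T.hor.one P))))) (single y w) =
    totalMap (rightIso V).hom (tensorator V (unit k T)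
      (single y w ⊗ₜ FDRepr.Hom.lin (unitIso k T).hom (FDRepr.eT (QG.idem k (T.hor.one P)))))
  rw [unitIso_lin_eT, unitMap_idem_one, FDRepr.toA_eT, WeakBialgebra.sig_epsT, idem_one, sig_hone,
    totalRho_sum_idem, T.ver.src_one, unitPt]
  split_ifs with h
  · subst h
    rw [tensorator_isComp (isComp_one_right y), totalMap_single, rightIso_mk, one_smul]
  · rw [tensorator_of_ne, map_zero]
    rwa [T.hor.src_one]

variable (k T) in
/-- The monoidal structure of the functor from bundles to representations. -/
def reprFunctorCoreMonoidal : (reprFunctor k T).CoreMonoidal where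
  εIso := unitIso k T
  μIso := tensoratorIso
  μIso_hom_natural_left {V V'} f W := by
    apply FDRepr.hom_ext
    refine LinearMap.ext fun t => ?_
    refine (congrArg (tensorator V' W) (FDRepr.inc_tensMap _ _ t)).trans ?_
    refine Eq.trans ?_ (tensorator_natural f (𝟙 W) _)
    rfl
  μIso_hom_natural_right {W W'} V f := by
    apply FDRepr.hom_ext
    refine LinearMap.ext fun t => ?_
    refine (congrArg (tensorator V W') (FDRepr.inc_tensMap _ _ t)).trans ?_
    refine Eq.trans ?_ (tensorator_natural (𝟙 V) f _)
    rfl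
  associativity U V W := by
    apply FDRepr.hom_ext
    refine LinearMap.ext fun t => ?_
    -- Through the inclusions into tensor products of vector spaces both sides become maps on the
    -- threefold tensor product of total spaces, where `tensorator_assoc` applies.
    have h₁ := FDRepr.inc_tensMap (tensoratorIso U V).hom (𝟙 (toRepr W)) t
    have h₂ := FDRepr.inc_tensMap (𝟙 (toRepr U)) (tensoratorIso V W).hom
      (FDRepr.Hom.lin (FDRepr.assocIso (toRepr W) (toRepr U) (toRepr V)).hom t)
    refine (congrArg
      (fun s => totalMap (assocIso U V W).hom (tensorator (tens U V) W s)) h₁).trans ?_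
    refine Eq.trans ?_ (congrArg (tensorator U (tens V W)) h₂).symm
    have e₁ : TensorProduct.map (FDRepr.Hom.lin (tensoratorIso U V).hom)
        (FDRepr.Hom.lin (𝟙 (toRepr W))) (FDRepr.inc _ _ t) =
        (tensorator U V).rTensor (Total W) (FDRepr.incL _ _ _ t) :=
      LinearMap.rTensor_comp_apply _ _ _ _
    have e₂ : TensorProduct.map (FDRepr.Hom.lin (𝟙 (toRepr U)))
        (FDRepr.Hom.lin (tensoratorIso V W).hom) (FDRepr.inc _ _
          (FDRepr.Hom.lin (FDRepr.assocIso (toRepr W) (toRepr U) (toRepr V)).hom t)) =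
        (tensorator V W).lTensor (Total U) (FDRepr.incR _ _ _
          (FDRepr.Hom.lin (FDRepr.assocIso (toRepr W) (toRepr U) (toRepr V)).hom t)) :=
      LinearMap.lTensor_comp_apply _ _ _ _
    have e₃ := congrArg ((tensorator V W).lTensor (Total U)) (FDRepr.incR_assocIso t)
    refine (congrArg
      (fun s => totalMap (assocIso U V W).hom (tensorator (tens U V) W s)) e₁).trans ?_
    refine Eq.trans ?_ (congrArg (tensorator U (tens V W)) (e₂.trans e₃)).symm
    exact tensorator_assoc _
  left_unitality V := by
    apply FDRepr.hom_ext
    refine LinearMap.ext fun t => ?_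
    refine (left_unitality_aux V (FDRepr.inc _ _ t)).trans ?_
    exact congrArg (fun s => totalMap (leftIso V).hom (tensorator (unit k T) V s))
      (FDRepr.inc_tensMap (unitIso k T).hom (𝟙 (toRepr V)) t).symm
  right_unitality V := by
    apply FDRepr.hom_ext
    refine LinearMap.ext fun t => ?_
    refine (right_unitality_aux V (FDRepr.inc _ _ t)).trans ?_
    exact congrArg (fun s => totalMap (rightIso V).hom (tensorator V (unit k T) s))
      (FDRepr.inc_tensMap (𝟙 (toRepr V)) (unitIso k T).hom t).symm

end

end TBund

/-! ### The canonical element of a space and its dual. -/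

section Canonical

variable {k : Type u} [Field k] {V W M : Type u} [AddCommGroup V] [Module k V]
  [FiniteDimensional k V] [AddCommGroup W] [Module k W] [FiniteDimensional k W]
  [AddCommGroup M] [Module k M]

theorem sum_coord_smul (v : V) : ∑ i, (Module.finBasis k V).coord i v • Module.finBasis k V i = v :=
  (Module.finBasis k V).sum_repr v

theorem sum_apply_coord (φ : Module.Dual k V) :
    ∑ i, φ (Module.finBasis k V i) • (Module.finBasis k V).coord i = φ := by
  refine LinearMap.ext fun v => ?_
  conv_rhs => rw [← sum_coord_smul (k := k) v]
  simp

/-- The canonical element does not depend on the basis: `e` carries the chosen basis of `V` to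
another basis of `W`. It is phrased through a bilinear map so that it applies to the products of
homogeneous elements of bundles. -/
theorem sum_basis_coord_equiv (e : V ≃ₗ[k] W) (Φ : W →ₗ[k] Module.Dual k W →ₗ[k] M) :
    ∑ i, Φ (e (Module.finBasis k V i)) ((Module.finBasis k V).coord i ∘ₗ e.symm.toLinearMap) =
      ∑ i, Φ (Module.finBasis k W i) ((Module.finBasis k W).coord i) := by
  -- The images are expanded in the basis of `W`; after exchanging the sums, the functionals with
  -- the same basis vector add up to its coordinate functional.
  have h : ∀ i, Φ (e (Module.finBasis k V i))
      ((Module.finBasis k V).coord i ∘ₗ e.symm.toLinearMap) =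
      ∑ j, (Module.finBasis k W).coord j (e (Module.finBasis k V i)) •
        Φ (Module.finBasis k W j) ((Module.finBasis k V).coord i ∘ₗ e.symm.toLinearMap) := by
    intro i
    conv_lhs => rw [← sum_coord_smul (k := k) (e (Module.finBasis k V i))]
    simp only [map_sum, map_smul, LinearMap.sum_apply, LinearMap.smul_apply]
  simp only [h]
  rw [Finset.sum_comm]
  refine Finset.sum_congr rfl fun j _ => ?_
  simp only [← map_smul, ← map_sum]
  congr 1
  refine LinearMap.ext fun w => ?_
  have h' := congrArg (fun v => (Module.finBasis k W).coord j (e v))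
    (sum_coord_smul (k := k) (e.symm w))
  simp only [map_sum, map_smul, LinearEquiv.apply_symm_apply] at h'
  rw [← h']
  simp [mul_comm]

end Canonical

/-! ### The two inversions of boxes commute. -/

namespace DoubleGroupoid

open ArrowGroupoid

variable {T : DoubleGroupoid.{u}}

/-- Horizontal inversion respects vertical composition and vertical identities, hence also vertical
inverses. -/
theorem hinv_vinv (A : T.Box) : T.horiz.inv (T.vert.inv A) = T.vert.inv (T.horiz.inv A) := by
  have h := isComp_hinv (isComp_inv_right (G := T.vert) A)
  rw [hinv_vone] at h
  exact h.eq_inv_of_one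

theorem boxInv_boxInv (A : T.Box) : T.boxInv (T.boxInv A) = A := by
  rw [boxInv, boxInv, hinv_vinv, ArrowGroupoid.inv_inv, ArrowGroupoid.inv_inv]

end DoubleGroupoid

/-! ### Dual bundles: double duals, coevaluation and evaluation. -/

namespace TBund

noncomputable section

open scoped Classical DirectSum
open DoubleGroupoid ArrowGroupoid

attribute [local instance] Fintype.ofFinite

variable {k : Type u} [Field k] {T : DoubleGroupoid.{u}}

section Transport

variable (V : TBund k T)

/-- The identification of the fibres over equal horizontal edges. -/
def castFib {x y : T.Hor} (h : x = y) : V.fib x →ₗ[k] V.fib y :=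
  V.act (T.vert.one y) (T.vert.src_one y) ((T.vert.tgt_one y).trans h.symm)

/-- Comparison of fibres over equal edges is the action of an identity box, hence linear; the lemmas
below absorb it into neighbouring actions. -/
theorem castFib_rfl {x : T.Hor} (h : x = x) (v : V.fib x) : castFib V h v = v := by
  rw [castFib, V.act_one]; rfl

theorem castFib_act {A : T.Box} {x x' y : T.Hor} (hx : T.vert.src A = x) (hy : T.vert.tgt A = y)
    (h : x = x') (v : V.fib y) : castFib V h (V.act A hx hy v) = V.act A (hx.trans h) hy v := by
  subst h
  rw [castFib_rfl]

theorem act_castFib {A : T.Box} {x y y' : T.Hor} (hx : T.vert.src A = x) (hy : T.vert.tgt A = y)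
    (h : y' = y) (v : V.fib y') :
    V.act A hx hy (castFib V h v) = V.act A hx (hy.trans h.symm) v := by
  subst h
  rw [castFib_rfl]

theorem castFib_castFib {x y z : T.Hor} (h : x = y) (h' : y = z) (v : V.fib x) :
    castFib V h' (castFib V h v) = castFib V (h.trans h') v := by
  subst h h'
  rw [castFib_rfl, castFib_rfl]

theorem act_congr {A B : T.Box} (h : A = B) {x y : T.Hor} (hx : T.vert.src A = x)
    (hy : T.vert.tgt A = y) (hx' : T.vert.src B = x) (hy' : T.vert.tgt B = y) :
    V.act A hx hy = V.act B hx' hy' := by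
  subst h; rfl

theorem act_inv_act (A : T.Box) {x y : T.Hor} (hx : T.vert.src A = x) (hy : T.vert.tgt A = y)
    (hx' : T.vert.tgt (T.vert.inv A) = x) (hy' : T.vert.src (T.vert.inv A) = y) (v : V.fib y) :
    V.act (T.vert.inv A) hy' hx' (V.act A hx hy v) = v := by
  subst hx hy
  rw [← V.act_isComp (isComp_inv_left A) hy' hx' rfl rfl (T.vert.src_one _) (T.vert.tgt_one _),
    V.act_one]
  rfl

theorem act_act_inv (A : T.Box) {x y : T.Hor} (hx : T.vert.src A = x) (hy : T.vert.tgt A = y)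
    (hx' : T.vert.tgt (T.vert.inv A) = x) (hy' : T.vert.src (T.vert.inv A) = y) (v : V.fib x) :
    V.act A hx hy (V.act (T.vert.inv A) hy' hx' v) = v := by
  subst hx hy
  rw [← V.act_isComp (isComp_inv_right A) rfl rfl hy' hx' (T.vert.src_one _) (T.vert.tgt_one _),
    V.act_one]
  rfl

/-- The action of a box as a linear equivalence. -/
def actEquiv (A : T.Box) {x y : T.Hor} (hx : T.vert.src A = x) (hy : T.vert.tgt A = y) :
    V.fib y ≃ₗ[k] V.fib x :=
  LinearEquiv.ofLinearMap (V.act A hx hy)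
    (V.act (T.vert.inv A) ((T.vert.src_inv A).trans hy) ((T.vert.tgt_inv A).trans hx))
    (LinearMap.ext fun v => act_act_inv V A hx hy _ _ v)
    (LinearMap.ext fun v => act_inv_act V A hx hy _ _ v)

end Transport

theorem isComp_inv_of_eq {x z : T.Hor} {P : T.Pt} (hx : T.hor.src x = P) (hz : T.hor.one P = z) :
    T.hor.IsComp x (T.hor.inv x) z := by
  subst hx hz
  exact isComp_inv_right x

variable (V : TBund k T)

/-- A homogeneous element of the dual bundle as a functional. -/
def toFunctional (x : T.Hor) : (dual V).fib x →ₗ[k] Module.Dual k (V.fib (T.hor.inv x)) :=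
  LinearMap.id

variable {V} in
theorem dual_ext {x : T.Hor} {φ ψ : (dual V).fib x}
    (h : ∀ v, toFunctional V x φ v = toFunctional V x ψ v) : φ = ψ :=
  LinearMap.ext h

theorem toFunctional_act (A : T.Box) {x y : T.Hor} (hx : T.vert.src A = x) (hy : T.vert.tgt A = y)
    (φ : (dual V).fib y) (v : V.fib (T.hor.inv x)) :
    toFunctional V x ((dual V).act A hx hy φ) v =
      toFunctional V y φ (V.act (T.boxInv A) (by rw [src_boxInv, hy]) (by rw [tgt_boxInv, hx]) v) :=
  rfl

/-- The identification of a finite-dimensional fibre with the fibre of the double dual. -/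
def doubleDualEquiv (x : T.Hor) :
    V.fib (T.hor.inv (T.hor.inv x)) ≃ₗ[k] (dual (dual V)).fib x :=
  Module.evalEquiv k (V.fib (T.hor.inv (T.hor.inv x)))

theorem toFunctional_doubleDualEquiv (x : T.Hor) (v : V.fib (T.hor.inv (T.hor.inv x)))
    (φ : (dual V).fib (T.hor.inv x)) :
    toFunctional (dual V) x (doubleDualEquiv V x v) φ = toFunctional V _ φ v := rfl

/-- A functional on the fibre over `x`, as an element of the dual bundle over `y = x⁻¹`. -/
def toDual {x y : T.Hor} (e : T.hor.inv y = x) : Module.Dual k (V.fib x) →ₗ[k] (dual V).fib y :=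
  Module.Dual.transpose (R := k) (castFib V e)

theorem toFunctional_toDual {x y : T.Hor} (e : T.hor.inv y = x) (φ : Module.Dual k (V.fib x))
    (v : V.fib (T.hor.inv y)) : toFunctional V y (toDual V e φ) v = φ (castFib V e v) := rfl

/-- The pairing between the dual bundle in degree `x` and the bundle in degree `y = x⁻¹`. -/
def pairing {x y : T.Hor} (e : y = T.hor.inv x) : (dual V).fib x →ₗ[k] V.fib y →ₗ[k] k :=
  Module.Dual.transpose (R := k) (castFib V e) ∘ₗ toFunctional V x

theorem pairing_apply {x y : T.Hor} (e : y = T.hor.inv x) (φ : (dual V).fib x) (v : V.fib y) :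
    pairing V e φ v = toFunctional V x φ (castFib V e v) := rfl

/-- Invariance of the pairing. On the dual, `B` acts by the transpose of its inverse in both
directions, which is the vertical inverse of `C` when `C` is the horizontal inverse of `B`; it
cancels the action of `C`. -/
theorem pairing_act_act {B C : T.Box} (h : C = T.horiz.inv B) {x y x' y' : T.Hor}
    (e : y = T.hor.inv x) (e' : y' = T.hor.inv x') (hx : T.vert.tgt B = x) (hy : T.vert.tgt C = y)
    (hx' : T.vert.src B = x') (hy' : T.vert.src C = y') (φ : (dual V).fib x) (v : V.fib y) :
    pairing V e' ((dual V).act B hx' hx φ) (V.act C hy' hy v) = pairing V e φ v := by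
  subst h
  rw [pairing_apply, pairing_apply, toFunctional_act, act_castFib]
  congr 1
  refine Eq.trans ?_ (congrArg (castFib V e) (act_inv_act V (T.horiz.inv B) hy' hy
    ((T.vert.tgt_inv _).trans hy') ((T.vert.src_inv _).trans hy) v))
  rw [castFib_act]
  rfl

theorem pairing_toDual {x y y' : T.Hor} (e : T.hor.inv y = x) (e' : y' = T.hor.inv y) (h : y' = x)
    (φ : Module.Dual k (V.fib x)) (v : V.fib y') :
    pairing V e' (toDual V e φ) v = φ (castFib V h v) := by
  rw [pairing_apply, toFunctional_toDual, castFib_castFib]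

/-- The expansion of a functional in the dual basis, as needed for the triangle identity on the dual
side. -/
theorem sum_toDual_pairing {x y z : T.Hor} (e : T.hor.inv y = x) (e' : x = T.hor.inv z) (h : y = z)
    (φ : (dual V).fib z) :
    ∑ i, pairing V e' φ (Module.finBasis k (V.fib x) i) •
      toDual V e ((Module.finBasis k (V.fib x)).coord i) = castFib (dual V) h.symm φ := by
  subst h
  rw [castFib_rfl]
  simp only [← map_smul, ← map_sum, sum_apply_coord]
  refine dual_ext fun v => ?_
  rw [toFunctional_toDual, pairing_apply, castFib_castFib, castFib_rfl]

theorem not_isComp_one_of_ne {x y w : T.Hor} (c : T.hor.IsComp x y w)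
    (h : y ≠ T.hor.inv x) : ¬ ∃ P, T.hor.one P = w := by
  rintro ⟨P, rfl⟩
  exact h c.eq_inv_of_one

variable [T.IsFinite] [T.IsVacant]

/-- The isomorphism between a bundle and its double dual. -/
def doubleDualIso : V ≅ dual (dual V) :=
  Bundle.isoMk
    { app := fun x => (doubleDualEquiv V x).toLinearMap ∘ₗ
        castFib V (ArrowGroupoid.inv_inv (G := T.hor) x).symm
      comm := fun A {x y} hx hy v => by
        -- Dualising twice replaces the action of `A` by that of its double inverse, which is `A`.
        refine dual_ext fun φ => ?_
        rw [toFunctional_act]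
        simp only [LinearMap.comp_apply, LinearEquiv.coe_coe]
        rw [toFunctional_doubleDualEquiv, toFunctional_doubleDualEquiv, toFunctional_act,
          castFib_act, act_castFib, act_congr V (boxInv_boxInv A)] }
    (fun x => castFib V (ArrowGroupoid.inv_inv (G := T.hor) x) ∘ₗ
      (doubleDualEquiv V x).symm.toLinearMap)
    (fun x => LinearMap.ext fun v => by
      simp only [LinearMap.comp_apply, LinearEquiv.coe_coe, LinearEquiv.symm_apply_apply]
      rw [castFib_castFib, castFib_rfl]
      rfl)
    (fun x => LinearMap.ext fun φ => by
      simp only [LinearMap.comp_apply, LinearEquiv.coe_coe]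
      rw [castFib_castFib, castFib_rfl, LinearEquiv.apply_symm_apply]
      rfl)

/-- The canonical element of the tensor product of a bundle and its dual, with components in
degrees `x` and `y = x⁻¹`. -/
def canon {x y z : T.Hor} (c : T.hor.IsComp x y z) (e : T.hor.inv y = x) :
    (tens V (dual V)).fib z :=
  ∑ i, mk c (Module.finBasis k (V.fib x) i) (toDual V e ((Module.finBasis k (V.fib x)).coord i))

/-- If `A` is a horizontal identity, `B` acts on the left factor and its inverse transpose on the
right one, so canonical element goes to canonical element. -/
theorem act_canon {A B C : T.Box} (q : T.horiz.IsComp B C A) {x y z x' y' z' : T.Hor}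
    (hx : T.vert.tgt B = x) (hy : T.vert.tgt C = y) (hz : T.vert.tgt A = z)
    (hx' : T.vert.src B = x') (hy' : T.vert.src C = y') (hz' : T.vert.src A = z')
    (c : T.hor.IsComp x y z) (c' : T.hor.IsComp x' y' z')
    (e : T.hor.inv y = x) (e' : T.hor.inv y' = x') (hA : IsHone A) :
    (tens V (dual V)).act A hz' hz (canon V c e) = canon V c' e' := by
  -- As `C` is the horizontal inverse of `B`, the two horizontal inversions cancel.
  have hC : T.boxInv C = T.vert.inv B := by
    rw [hA] at q
    rw [q.eq_inv_of_one, boxInv, ArrowGroupoid.inv_inv]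
  rw [canon, canon, map_sum]
  refine Eq.trans ?_ (sum_basis_coord_equiv (actEquiv V B hx' hx)
    ((mk c').compl₂ (toDual V e')))
  refine Finset.sum_congr rfl fun i _ => ?_
  rw [act_mk q hz' hz hx hy hx' hy' c c', LinearMap.compl₂_apply]
  congr 1
  refine dual_ext fun v => ?_
  rw [toFunctional_act, toFunctional_toDual, toFunctional_toDual, castFib_act, act_congr V hC]
  change _ = (Module.finBasis k (V.fib x)).coord i (V.act (T.vert.inv B) _ _ (castFib V e' v))
  rw [act_castFib]

/-- The coevaluation in degree `z`. -/
def coevApp (z : T.Hor) : (unit k T).fib z →ₗ[k] (tens V (dual V)).fib z :=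
  unitDesc fun P hP => ∑ x : {x : T.Hor // T.hor.src x = P},
    canon V (isComp_inv_of_eq x.2 hP) (ArrowGroupoid.inv_inv x.1)

theorem coevApp_unitVec {z : T.Hor} (P : T.Pt) (hP : T.hor.one P = z) :
    coevApp V z (unitVec P hP 1) = ∑ x : {x : T.Hor // T.hor.src x = P},
      canon V (isComp_inv_of_eq x.2 hP) (ArrowGroupoid.inv_inv x.1) := by
  rw [coevApp, unitDesc_unitVec, one_smul]

/-- The coevaluation. -/
def coev : unit k T ⟶ tens V (dual V) where
  app := coevApp V
  comm A {a b} ha hb t := by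
    refine LinearMap.congr_fun (f := coevApp V a ∘ₗ (unit k T).act A ha hb)
      (g := (tens V (dual V)).act A ha hb ∘ₗ coevApp V b) (unit_ext fun P hP => ?_) t
    have hA : IsHone A := isHone_of_bot (hb.trans hP.symm)
    obtain ⟨g, rfl⟩ : ∃ g, T.horiz.one g = A := ⟨_, hA.symm⟩
    have eP : T.ver.tgt g = P := one_injective T.hor (by rw [← T.bot_hone, hb, hP])
    have hQ : T.hor.one (T.ver.src g) = a := by rw [← T.top_hone, ha]
    rw [LinearMap.comp_apply, LinearMap.comp_apply, act_unitVec g rfl ha hb P _ hP hQ eP rfl,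
      coevApp_unitVec, coevApp_unitVec, map_sum]
    -- Each edge `x` from the bottom end of `g` gives a splitting of the identity box of `g` with
    -- bottoms x and x⁻¹, whose tops are y and y⁻¹ for some `y` from the top end.
    have key : ∀ x : {x : T.Hor // T.hor.src x = P}, ∃ y : {y : T.Hor // T.hor.src y = T.ver.src g},
        ∃ B C, T.horiz.IsComp B C (T.horiz.one g) ∧ T.vert.tgt B = x.1 ∧
          T.vert.tgt C = T.hor.inv x.1 ∧ T.vert.src B = y.1 ∧ T.vert.src C = T.hor.inv y.1 := by
      intro x
      obtain ⟨B, C, q, hB, hC⟩ := exists_split (T.horiz.one g)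
        (hb ▸ isComp_inv_of_eq x.2 hP)
      have h := top_isComp q
      rw [T.top_hone] at h
      exact ⟨⟨T.vert.src B, by rw [← h.src, T.hor.src_one]⟩, B, C, q, hB, hC, rfl, h.eq_inv_of_one⟩
    choose y B C q hB hC hy hy' using key
    symm
    -- The passage from `x` to `y` is a bijection, because splittings are determined by, and lift
    -- from, either horizontal edge; it matches the summands of the two coevaluations.
    refine Fintype.sum_bijective y ⟨?_, ?_⟩ _ _ ?_
    · intro x x' h
      have h' : T.vert.src (C x) = T.vert.src (C x') := by rw [hy', hy', h]
      obtain ⟨h₁, -⟩ := split_unique_top (q x) (q x') h'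
      exact Subtype.ext (by rw [← hB, ← hB, h₁])
    · intro w
      obtain ⟨B', C', q', hB', hC'⟩ := exists_split_top (T.horiz.one g)
        (ha ▸ isComp_inv_of_eq w.2 hQ)
      have h := bot_isComp q'
      rw [T.bot_hone, eP] at h
      let x : {x : T.Hor // T.hor.src x = P} := ⟨T.vert.tgt B', by rw [← h.src, T.hor.src_one]⟩
      refine ⟨x, Subtype.ext ?_⟩
      obtain ⟨h₁, -⟩ := split_unique (q x) q' (by rw [hC, h.eq_inv_of_one])
      rw [← hy, h₁, hB']
    · intro x
      exact act_canon V (q x) (hB x) (hC x) hb (hy x) (hy' x) ha _ _ _ _ hA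

/-- The evaluation in degree `z`. -/
def evalApp (z : T.Hor) : (tens (dual V) V).fib z →ₗ[k] (unit k T).fib z :=
  desc fun _ _ c => if h : ∃ P, T.hor.one P = z then
    (pairing V (IsComp.eq_inv_of_one (h.choose_spec.symm ▸ c))).compr₂
      (unitVec h.choose h.choose_spec)
    -- The unit object vanishes in degrees that are not identities.
    else 0

theorem evalApp_mk {x y z : T.Hor} (c : T.hor.IsComp x y z) (P : T.Pt) (hP : T.hor.one P = z)
    (e : y = T.hor.inv x) (φ : (dual V).fib x) (v : V.fib y) :
    evalApp V z (mk c φ v) = unitVec P hP (pairing V e φ v) := by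
  rw [evalApp, desc_mk, dif_pos ⟨P, hP⟩]
  -- The point chosen in the definition is immaterial, as an identity edge determines its point.
  have h : ∀ (Q : T.Pt) (hQ : T.hor.one Q = z), unitVec (k := k) Q hQ = unitVec P hP := by
    intro Q hQ
    obtain rfl : Q = P := one_injective T.hor (hQ.trans hP.symm)
    rfl
  rw [h]
  rfl

theorem evalApp_mk_of_not {x y z : T.Hor} (c : T.hor.IsComp x y z) (h : ¬ ∃ P, T.hor.one P = z)
    (φ : (dual V).fib x) (v : V.fib y) : evalApp V z (mk c φ v) = 0 := by
  rw [evalApp, desc_mk, dif_neg h]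
  rfl

/-- For a horizontal identity this is the invariance of the pairing. Any other box has, by vacancy,
neither top nor bottom an identity, and both evaluations vanish. -/
theorem evalApp_act (A : T.Box) {a b : T.Hor} (ha : T.vert.src A = a) (hb : T.vert.tgt A = b)
    (t : (tens (dual V) V).fib b) :
    evalApp V a ((tens (dual V) V).act A ha hb t) = (unit k T).act A ha hb (evalApp V b t) := by
  refine LinearMap.congr_fun (f := evalApp V a ∘ₗ (tens (dual V) V).act A ha hb)
    (g := (unit k T).act A ha hb ∘ₗ evalApp V b) (tens_ext fun x y c φ v => ?_) t
  obtain ⟨B, C, q, hB, hC⟩ := exists_split A (hb ▸ c)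
  have c' : T.hor.IsComp (T.vert.src B) (T.vert.src C) a := ha ▸ top_isComp q
  rw [LinearMap.comp_apply, LinearMap.comp_apply, act_mk q ha hb hB hC rfl rfl c c']
  by_cases hA : IsHone A
  · obtain ⟨g, rfl⟩ : ∃ g, T.horiz.one g = A := ⟨_, hA.symm⟩
    have ha' := (T.top_hone g).symm.trans ha
    have hb' := (T.bot_hone g).symm.trans hb
    rw [evalApp_mk V c' _ ha' (IsComp.eq_inv_of_one (ha'.symm ▸ c')),
      evalApp_mk V c _ hb' (IsComp.eq_inv_of_one (hb'.symm ▸ c)),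
      act_unitVec g rfl ha hb _ _ hb' ha' rfl rfl, pairing_act_act V q.eq_inv_of_one]
  · rw [evalApp_mk_of_not, evalApp_mk_of_not, map_zero]
    · rintro ⟨P, hP⟩; exact hA (isHone_of_bot (hb.trans hP.symm))
    · rintro ⟨P, hP⟩; exact hA (isHone_of_top (ha.trans hP.symm))

/-- The evaluation. -/
def eval : tens (dual V) V ⟶ unit k T where
  app := evalApp V
  comm A _ _ ha hb t := evalApp_act V A ha hb t

end

end TBund

/-! ### The triangle identities. -/

namespace TBund

noncomputable section

open scoped Classical DirectSum
open DoubleGroupoid ArrowGroupoid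

attribute [local instance] Fintype.ofFinite

variable {k : Type u} [Field k] {T : DoubleGroupoid.{u}} [T.IsFinite] [T.IsVacant]
  (V : TBund k T)

/-- The first triangle identity on elements. -/
theorem rightApp_eval_canon {x y p z : T.Hor} (c : T.hor.IsComp x y p)
    (e : T.hor.inv y = x) (d : T.hor.IsComp p z z) (v : V.fib z) :
    rightApp V z (tensMapApp (𝟙 V) (eval V) z (assocApp V (dual V) V z (mk d (canon V c e) v))) =
      if x = z then v else 0 := by
  have c' := isComp_comp y z (c.tgt.symm.trans d.mid)
  have d' := c.assoc c' d
  rw [canon, map_sum, LinearMap.sum_apply, map_sum, map_sum, map_sum]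
  simp only [assocApp_mk d c c' d', tensMapApp_mk]
  change ∑ i, rightApp V z (mk d' (Module.finBasis k (V.fib x) i) (evalApp V _ (mk c' _ v))) = _
  -- After reassociation the dual factor of degree `y` meets `v` of degree `z`. The pairing is
  -- non-zero only for z = y⁻¹ = x, and then the sum is the basis expansion of `v`.
  split_ifs with h
  · subst h
    have hP := (c'.eq (e ▸ isComp_inv_right (G := T.hor) y)).symm
    have h : ∀ i, rightApp V x (mk d' (Module.finBasis k (V.fib x) i) (evalApp V _ (mk c'
        (toDual V e ((Module.finBasis k (V.fib x)).coord i)) v))) =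
        (Module.finBasis k (V.fib x)).coord i v • Module.finBasis k (V.fib x) i := by
      intro i
      rw [evalApp_mk V c' _ hP e.symm, rightApp_mk, pairing_toDual V e _ rfl, castFib_rfl]
    exact (Finset.sum_congr rfl fun i _ => h i).trans (sum_coord_smul v)
  · have h' : z ≠ T.hor.inv y := by rw [e]; exact Ne.symm h
    refine Finset.sum_eq_zero fun i _ => ?_
    rw [evalApp_mk_of_not V c' (not_isComp_one_of_ne c' h'), map_zero, map_zero]

/-- The second triangle identity on elements. -/
theorem leftApp_eval_canon {x y p z : T.Hor} (c : T.hor.IsComp x y p)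
    (e : T.hor.inv y = x) (d : T.hor.IsComp z p z) (φ : (dual V).fib z) :
    leftApp (dual V) z (tensMapApp (eval V) (𝟙 (dual V)) z
      (assocInvApp (dual V) V (dual V) z (mk d φ (canon V c e)))) =
      if y = z then φ else 0 := by
  have c' := isComp_comp z x (d.mid.trans c.src)
  have d' := c'.assoc' c d
  rw [canon, map_sum, map_sum, map_sum, map_sum]
  simp only [assocInvApp_mk d' c' c d, tensMapApp_mk]
  change ∑ i, leftApp (dual V) z (mk d' (evalApp V _ (mk c' φ (Module.finBasis k (V.fib x) i)))
    _) = _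
  split_ifs with h
  · subst h
    have hP := (c'.eq (e ▸ isComp_inv_right (G := T.hor) y)).symm
    have h : ∀ i, leftApp (dual V) y (mk d' (evalApp V _ (mk c' φ (Module.finBasis k (V.fib x) i)))
        (toDual V e ((Module.finBasis k (V.fib x)).coord i))) =
        pairing V e.symm φ (Module.finBasis k (V.fib x) i) •
          toDual V e ((Module.finBasis k (V.fib x)).coord i) := by
      intro i
      rw [evalApp_mk V c' _ hP e.symm, leftApp_mk]
    refine (Finset.sum_congr rfl fun i _ => h i).trans ?_
    rw [sum_toDual_pairing V e e.symm rfl, castFib_rfl]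
  · have h' : x ≠ T.hor.inv z := by
      intro h'
      apply h
      rw [← e] at h'
      rw [← ArrowGroupoid.inv_inv (G := T.hor) y, h', ArrowGroupoid.inv_inv]
    refine Finset.sum_eq_zero fun i _ => ?_
    rw [evalApp_mk_of_not V c' (not_isComp_one_of_ne c' h'), map_zero, LinearMap.zero_apply,
      map_zero]

/-- The dual bundle is a right dual. -/
abbrev exactPairingDual : ExactPairing V (dual V) where
  coevaluation' := coev V
  evaluation' := eval V
  coevaluation_evaluation' := by
    -- The inverse unitor is moved to the other side, so that both sides can be evaluated on a
    -- product with _P 1.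
    rw [Iso.eq_comp_inv]
    apply Bundle.hom_ext
    intro z
    refine right_ext fun x c P hP φ => ?_
    refine Eq.trans ?_ ((rightApp_mk (V := dual V) c P hP 1 φ).trans (one_smul _ _)).symm
    have h : tensMapApp (𝟙 (dual V)) (coev V) z (mk c φ (unitVec P hP 1)) =
        mk c φ (coevApp V x (unitVec P hP 1)) := tensMapApp_mk _ _ _ _ _
    refine (congrArg (fun t => leftApp (dual V) z (tensMapApp (eval V) (𝟙 (dual V)) z
      (assocInvApp (dual V) V (dual V) z t))) h).trans ?_
    rw [coevApp_unitVec, map_sum, map_sum, map_sum, map_sum]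
    simp only [leftApp_eval_canon]
    have hz : T.hor.src (T.hor.inv z) = P := by
      rw [T.hor.src_inv, c.mid, ← hP, T.hor.src_one]
    -- The coevaluation term at an edge has its dual factor in the inverse degree, so only the edge
    -- z⁻¹ contributes.
    rw [Fintype.sum_eq_single (⟨T.hor.inv z, hz⟩ : {x : T.Hor // T.hor.src x = P}),
      if_pos (ArrowGroupoid.inv_inv z)]
    intro y hy
    exact if_neg fun h => hy (Subtype.ext
      ((ArrowGroupoid.inv_inv (G := T.hor) y.1).symm.trans (congrArg T.hor.inv h)))
  evaluation_coevaluation' := by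
    rw [Iso.eq_comp_inv]
    apply Bundle.hom_ext
    intro z
    refine left_ext fun x c P hP v => ?_
    refine Eq.trans ?_ ((leftApp_mk (V := V) c P hP 1 v).trans (one_smul _ _)).symm
    have h : tensMapApp (coev V) (𝟙 V) z (mk c (unitVec P hP 1) v) =
        mk c (coevApp V x (unitVec P hP 1)) v := tensMapApp_mk _ _ _ _ _
    refine (congrArg (fun t => rightApp V z (tensMapApp (𝟙 V) (eval V) z
      (assocApp V (dual V) V z t))) h).trans ?_
    rw [coevApp_unitVec, map_sum, LinearMap.sum_apply, map_sum, map_sum, map_sum]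
    simp only [rightApp_eval_canon]
    have hz : T.hor.src z = P := by rw [← c.mid, ← hP, T.hor.tgt_one]
    -- Only the canonical element with first factor in degree `z` survives, and `z` does start at P.
    rw [Fintype.sum_eq_single (⟨z, hz⟩ : {x : T.Hor // T.hor.src x = P}), if_pos rfl]
    intro y hy
    exact if_neg fun h => hy (Subtype.ext h)

end

end TBund

/-! ### Two-sided duals, hom-spaces and bilinearity of the tensor product. -/

namespace TBund

noncomputable section

open scoped Classical
open DoubleGroupoid

attribute [local instance] Fintype.ofFinite

variable {k : Type u} [Field k] {T : DoubleGroupoid.{u}} [T.IsFinite]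

instance finiteDimensional_hom (V W : TBund k T) : FiniteDimensional k (V ⟶ W) :=
  FiniteDimensional.of_injective
    ({ toFun := fun f x => f.app x
       map_add' := fun _ _ => rfl
       map_smul' := fun _ _ => rfl } : (V ⟶ W) →ₗ[k] ∀ x, V.fib x →ₗ[k] W.fib x)
    Bundle.app_injective

variable [T.IsVacant]

/-- The dual bundle is a left dual. -/
abbrev exactPairingDual' (V : TBund k T) : ExactPairing (dual V) V :=
  -- This pairs V* with V**, and V** is isomorphic to V.
  have := exactPairingDual (dual V)
  exactPairingCongrRight (doubleDualIso V)

instance : MonoidalPreadditive (TBund k T) where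
  whiskerLeft_zero := by
    intro V W W'
    apply Bundle.hom_ext
    refine fun z => tens_ext fun x y c v w => ?_
    refine (tensMap_mk (𝟙 V) (0 : W ⟶ W') c v w).trans ?_
    exact map_zero _
  zero_whiskerRight := by
    intro V W W'
    apply Bundle.hom_ext
    refine fun z => tens_ext fun x y c v w => ?_
    refine (tensMap_mk (0 : W ⟶ W') (𝟙 V) c v w).trans ?_
    exact LinearMap.congr_fun (map_zero _) _
  whiskerLeft_add := by
    intro V W W' f g
    apply Bundle.hom_ext
    refine fun z => tens_ext fun x y c v w => ?_
    refine (tensMap_mk (𝟙 V) (f + g) c v w).trans ((map_add _ _ _).trans ?_)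
    exact (congrArg₂ (· + ·) (tensMap_mk (𝟙 V) f c v w) (tensMap_mk (𝟙 V) g c v w)).symm
  add_whiskerRight := by
    intro V W W' f g
    apply Bundle.hom_ext
    refine fun z => tens_ext fun x y c v w => ?_
    refine (tensMap_mk (f + g) (𝟙 V) c v w).trans
      ((LinearMap.congr_fun (map_add (mk c) (f.app x v) (g.app x v)) w).trans ?_)
    exact (congrArg₂ (· + ·) (tensMap_mk f (𝟙 V) c v w) (tensMap_mk g (𝟙 V) c v w)).symm

instance : MonoidalLinear k (TBund k T) where
  whiskerLeft_smul := by
    intro V W W' r f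
    apply Bundle.hom_ext
    refine fun z => tens_ext fun x y c v w => ?_
    refine (tensMap_mk (𝟙 V) (r • f) c v w).trans ((map_smul _ _ _).trans ?_)
    exact (congrArg (r • ·) (tensMap_mk (𝟙 V) f c v w)).symm
  smul_whiskerRight := by
    intro r W W' f V
    apply Bundle.hom_ext
    refine fun z => tens_ext fun x y c v w => ?_
    refine (tensMap_mk (r • f) (𝟙 V) c v w).trans
      ((LinearMap.congr_fun (map_smul (mk c) r (f.app x v)) w).trans ?_)
    exact (congrArg (r • ·) (tensMap_mk f (𝟙 V) c v w)).symm

end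

end TBund

/-! ### The multifusion structure and the monoidal equivalence. -/

theorem mainTheorem10 (k : Type u) [Field k] [CharZero k] (T : DoubleGroupoid.{u})
    [T.IsFinite] [T.IsVacant] :
    IsMultifusion k (TBund k T) ∧
    (∀ V : TBund k T, Nonempty (ExactPairing V (TBund.dual V)) ∧
      Nonempty (ExactPairing (TBund.dual V) V)) ∧
    ∃ F : TBund k T ⥤ FDRepr k (QG k T),
      F.IsEquivalence ∧ F.Additive ∧ F.Linear k ∧ Nonempty F.Monoidal := by
  -- Bundles are compared with modules over the semisimple ring `kT`; the purely categorical clauses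
  -- come from this equivalence, while duals and bilinearity are verified on bundles.
  let G : TBund k T ⥤ FGModuleCat.{u} (QG k T) :=
    TBund.reprFunctor k T ⋙ FDRepr.toFGModuleCat k (QG k T)
  refine ⟨{
    abelian := exists_abelian_of_equivalence G
    tensor_additive := inferInstance
    tensor_linear := inferInstance
    rigid := ⟨{
      rightDual := fun V =>
        { rightDual := TBund.dual V
          exact := TBund.exactPairingDual V }
      leftDual := fun V =>
        { leftDual := TBund.dual V
          exact := TBund.exactPairingDual' V } }⟩
    semisimple := fun X => by
      obtain ⟨n, S, b, hS, hb, rfl⟩ := exists_bicone_of_equivalence G X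
      exact ⟨n, S, b, hS, hb, ⟨Iso.refl _⟩⟩
    finite_simples := exists_simples_of_equivalence G
    finiteDimensional_hom := inferInstance },
    fun V => ⟨⟨TBund.exactPairingDual V⟩, ⟨TBund.exactPairingDual' V⟩⟩,
    TBund.reprFunctor k T, inferInstance, inferInstance, inferInstance,
    ⟨(TBund.reprFunctorCoreMonoidal k T).toMonoidal⟩⟩
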